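/- Let $k$ be a field and $B$ a finite dimensional Hopf algebra over $k$ with antipode $S$. Let $X=(B^{\mathrm{op}})^*=(B^*)^{\mathrm{cop}}$, with pairing $\langle x,a\rangle=x(a)$ for $x\in X$, $a\in B$, so that $\langle xy,a\rangle=\langle x,a_1\rangle\langle y,a_2\rangle$ and $\langle x_1,a\rangle\langle x_2,b\rangle=\langle x,ba\rangle$. For $a\in B$, $x\in X$ put $\langle {}^a x,b\rangle=\langle x,ba\rangle$ and $\langle x^a,b\rangle=\langle x,ab\rangle$. Let $D(B)=X\bowtie B$ be the Drinfeld double: $X\otimes B$ with multiplication $$(x\bowtie a)(y\bowtie b)=x\,\bigl({}^{a_1}(y^{S^{-1}(a_3)})\bigr)\bowtie a_2b ,$$ unit $\varepsilon_B\bowtie 1$ and augmentation $x\bowtie a\mapsto\langle x,1\rangle\varepsilon(a)$. For an augmented algebra $A$, let $\mathrm H_h^*(A,k)$ be Hochschild cohomology with trivial coefficients, computed by the standard complex $\mathrm{Hom}_k(A^n,k)$, where $A^n=A^{\otimes n}$. For $\mathbf b=b^1\otimes\cdots\otimes b^n\in B^n$ write $\widehat{\mathbf b}=b^1\cdots b^n$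 and $\mathbf b_1\otimes\mathbf b_2=(b^1_1\otimes\cdots\otimes b^n_1)\otimes(b^1_2\otimes\cdots\otimes b^n_2)$. Let $B$ act on $X^n$ diagonally, ${}^a\mathbf x={}^{a_1}x^1\otimes\cdots\otimes{}^{a_n}x^n$ and $\mathbf x^a=(x^1)^{a_1}\otimes\cdots\otimes(x^n)^{a_n}$, and let $X$ act on $B^n$ by ${}^x\mathbf a=\langle x,\widehat{\mathbf a}_2\rangle\mathbf a_1$ and $\mathbf a^x=\langle x,\widehat{\mathbf a}_1\rangle\mathbf a_2$. Let $\mathbf C$ be the cosimplicial bicomplex with $\mathbf C^{p,q}=\mathrm{Hom}_k(X^p\otimes B^q,k)$ and faces dual to $$\partial^B_0(\mathbf x\otimes\mathbf a)=\mathbf x^{a^1}\otimes(a^2\otimes\cdots\otimes a^{q+1}),\qquad \partial^B_{q+1}(\mathbf x\otimes\mathbf a)={}^{a^{q+1}}\mathbf x\otimes(a^1\otimes\cdots\otimes a^q),$$ $$\partial^X_0(\mathbf x\otimes\mathbf a)=(x^2\otimes\cdots\otimes x^{p+1})\otimes\mathbf a^{x^1},\qquad \partial^X_{p+1}(\mathbf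 x\otimes\mathbf a)=(x^1\otimes\cdots\otimes x^p)\otimes{}^{x^{p+1}}\mathbf a,$$ the inner face $\partial^B_i$ (respectively $\partial^X_j$) multiplying $a^i,a^{i+1}$ (respectively $x^j,x^{j+1}$). Let $\partial^B=\sum_i(-1)^i\partial^B_i$ and $\partial^X=\sum_j(-1)^j\partial^X_j$. The total complex $\mathrm{Tot}\,\mathbf C$ has differential $(\partial^X)^*+(-1)^p(\partial^B)^*$ on $\mathbf C^{p,q}$; the diagonal complex $\mathrm{Diag}\,\mathbf C$ has $\mathrm{Diag}^n\mathbf C=\mathbf C^{n,n}$ and differential dual to $\sum_i(-1)^i\partial^X_i\partial^B_i$. Let $\mathbf C_0\subset\mathbf C$ be the subcomplex whose edges ($p=0$ or $q=0$) are replaced by $0$, let $\mathbf C_1=\mathbf C/\mathbf C_0$ be the edge complex, and let $\pi\colon\mathrm{Tot}\,\mathbf C\to\mathrm{Tot}\,\mathbf C_1$ be the projection. The short exact sequence $0\to\mathrm{Tot}\,\mathbf C_0\to\mathrm{Tot}\,\mathbf C\to\mathrm{Tot}\,\mathbf C_1\to0$ gives the long exact sequence connecting truncated bialgebra cohomology to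 Hochschild cohomology. Let $i\ge1$. Then each of the following cochain maps induces an isomorphism in $i$-th cohomology: * the cosimplicial Alexander–Whitney map $\Phi\colon\mathrm{Tot}^n\mathbf C\to\mathrm{Diag}^n\mathbf C$, given by $\Phi(f)=f\,\partial^X_{p+1}\cdots\partial^X_n\,(\partial^B_0)^p$ for $f\in\mathbf C^{p,q}$, $p+q=n$; * $(\phi_n\tilde c_n)^*\colon\mathrm{Diag}^n\mathbf C\to\mathrm{Hom}_k(D(B)^n,k)$, where $\tilde c_n\colon(X\otimes B)^n\to X^n\otimes B^n$ is obtained by iterating the flip $a\otimes x\mapsto{}^{a_1}(x^{S^{-1}(a_3)})\otimes a_2$ and $\phi_n(\mathbf x\otimes\mathbf a)={}^{S^{-1}(\widehat{\mathbf a}_1)}\mathbf x\otimes\mathbf a_2$; * the pair of edge maps, which identify $\mathrm H^i(\mathrm{Tot}\,\mathbf C_1)$ with $\mathrm H^i_h(B,k)\oplus\mathrm H^i_h(X,k)$. Consequently the map $\bar\pi$ of the long exact sequence, that is the composite $$\mathrm H^i_h(D(B),k)\xleftarrow{\ \simeq\ }\mathrm H^i(\mathrm{Diag}\,\mathbf C)\xleftarrow{\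 \simeq\ }\mathrm H^i(\mathrm{Tot}\,\mathbf C)\xrightarrow{\mathrm H^i(\pi)}\mathrm H^i(\mathrm{Tot}\,\mathbf C_1)\xrightarrow{\ \simeq\ }\mathrm H^i_h(B,k)\oplus\mathrm H^i_h(X,k)$$ (with the first two isomorphisms inverted), is well defined, and it is restriction in each component: $\bar\pi=(\mathrm{res}_B,\mathrm{res}_X)$, where $\mathrm{res}_B$ and $\mathrm{res}_X$ are induced by restricting cochains along $B\to D(B)$, $b\mapsto1\bowtie b$, and $X\to D(B)$, $x\mapsto x\bowtie1$. -/

import Mathlib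

open scoped TensorProduct

namespace BialgebraCohomology

noncomputable section

universe u v w

/-! ### Cohomology of a sequence of linear maps -/

section Cohomology

variable {k : Type u} [Field k]
variable {C : ℕ → Type v} [∀ n, AddCommGroup (C n)] [∀ n, Module k (C n)]
variable {C' : ℕ → Type w} [∀ n, AddCommGroup (C' n)] [∀ n, Module k (C' n)]

/-- The `n`-cocycles of a cochain complex `C⁰ → C¹ → ⋯` of vector spaces. -/
def cocycles (d : ∀ n, C n →ₗ[k] C (n + 1)) (n : ℕ) : Submodule k (C n) :=
  LinearMap.ker (d n)

/-- The `n`-coboundaries; only `0` is a coboundary in degree `0`. -/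
def coboundaries (d : ∀ n, C n →ₗ[k] C (n + 1)) : ∀ n, Submodule k (C n)
  | 0 => ⊥
  | n + 1 => LinearMap.range (d n)

/-- The `n`-th cohomology: cocycles modulo coboundaries. -/
def Cohomology (d : ∀ n, C n →ₗ[k] C (n + 1)) (n : ℕ) : Type v :=
  cocycles d n ⧸ (coboundaries d n).submoduleOf (cocycles d n)

instance (d : ∀ n, C n →ₗ[k] C (n + 1)) (n : ℕ) : AddCommGroup (Cohomology d n) :=
  inferInstanceAs (AddCommGroup (cocycles d n ⧸ (coboundaries d n).submoduleOf (cocycles d n)))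

instance (d : ∀ n, C n →ₗ[k] C (n + 1)) (n : ℕ) : Module k (Cohomology d n) :=
  inferInstanceAs (Module k (cocycles d n ⧸ (coboundaries d n).submoduleOf (cocycles d n)))

/-- The cohomology class of a cocycle. -/
def cohomologyClass (d : ∀ n, C n →ₗ[k] C (n + 1)) (n : ℕ) :
    cocycles d n →ₗ[k] Cohomology d n :=
  ((coboundaries d n).submoduleOf (cocycles d n)).mkQ

/-- The map `h` on `n`-th cohomology is induced by the map `g` on `n`-cochains: `g` sends cocycles
to cocycles and `h [z] = [g z]` for each cocycle `z`. Such an `h` is determined by `g`. -/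
def IsInducedBy (d : ∀ n, C n →ₗ[k] C (n + 1)) (d' : ∀ n, C' n →ₗ[k] C' (n + 1)) (n : ℕ)
    (g : C n →ₗ[k] C' n) (h : Cohomology d n →ₗ[k] Cohomology d' n) : Prop :=
  ∀ z : cocycles d n, ∃ hz : g z ∈ cocycles d' n,
    h (cohomologyClass d n z) = cohomologyClass d' n ⟨g z, hz⟩

end Cohomology

/-! ### Tensor powers -/

section TensorPowers

variable (k : Type u) [Field k] (M : Type v) [AddCommMonoid M] [Module k M]

/-- `m¹ ⊗ ⋯ ⊗ mⁿ⁺¹ ↦ m¹ ⊗ (m² ⊗ ⋯ ⊗ mⁿ⁺¹)`. -/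
def headSplit (n : ℕ) : ⨂[k]^(n + 1) M →ₗ[k] M ⊗[k] ⨂[k]^n M :=
  PiTensorProduct.lift (LinearMap.uncurryLeft (M := fun _ : Fin (n + 1) => M)
    (PiTensorProduct.lift.symm.toLinearMap ∘ₗ TensorProduct.mk k M (⨂[k]^n M)))

/-- `m¹ ⊗ ⋯ ⊗ mⁿ⁺¹ ↦ (m¹ ⊗ ⋯ ⊗ mⁿ) ⊗ mⁿ⁺¹`. -/
def lastSplit (n : ℕ) : ⨂[k]^(n + 1) M →ₗ[k] ⨂[k]^n M ⊗[k] M :=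
  PiTensorProduct.lift (MultilinearMap.uncurryRight (M := fun _ : Fin (n + 1) => M)
    ((TensorProduct.mk k (⨂[k]^n M) M).compMultilinearMap (PiTensorProduct.tprod k)))

/-- `m ⊗ (m¹ ⊗ ⋯ ⊗ mⁿ) ↦ m ⊗ m¹ ⊗ ⋯ ⊗ mⁿ`. -/
def cons (n : ℕ) : M ⊗[k] ⨂[k]^n M →ₗ[k] ⨂[k]^(n + 1) M :=
  TensorProduct.lift (PiTensorProduct.lift.toLinearMap ∘ₗ
    (PiTensorProduct.tprod k : MultilinearMap k (fun _ : Fin (n + 1) => M) _).curryLeft)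

variable {k M}

@[simp]
theorem headSplit_tprod (n : ℕ) (m : Fin (n + 1) → M) :
    headSplit k M n (PiTensorProduct.tprod k m) =
      m 0 ⊗ₜ[k] PiTensorProduct.tprod k (Fin.tail m) := by
  simp [headSplit, PiTensorProduct.lift_symm]

@[simp]
theorem lastSplit_tprod (n : ℕ) (m : Fin (n + 1) → M) :
    lastSplit k M n (PiTensorProduct.tprod k m) =
      PiTensorProduct.tprod k (Fin.init m) ⊗ₜ[k] m (Fin.last n) := by
  simp [lastSplit]

@[simp]
theorem cons_tmul_tprod (n : ℕ) (a : M) (m : Fin n → M) :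
    cons k M n (a ⊗ₜ[k] PiTensorProduct.tprod k m) =
      PiTensorProduct.tprod k (Fin.cons a m : Fin (n + 1) → M) := by
  simp [cons]

theorem contractNth_update (mul : M →ₗ[k] M →ₗ[k] M) {n : ℕ} (j : Fin n) (m : Fin (n + 1) → M)
    (i : Fin (n + 1)) : ∃ (l : Fin n) (φ : M →ₗ[k] M), ∀ x,
      Fin.contractNth j.castSucc (fun a b => mul a b) (Function.update m i x) =
        Function.update (Fin.contractNth j.castSucc (fun a b => mul a b) m) l (φ x) := by
  rcases lt_trichotomy (i : ℕ) j with h | h | h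
  · refine ⟨⟨i, by omega⟩, LinearMap.id, fun x => ?_⟩
    ext l
    simp only [Fin.contractNth, Function.update_apply, Fin.ext_iff, Fin.val_castSucc, Fin.val_succ,
      LinearMap.id_apply]
    split_ifs <;> first | rfl | omega
  · refine ⟨⟨i, by omega⟩, mul.flip (m j.succ), fun x => ?_⟩
    ext l
    by_cases hl : l = j
    · subst hl
      simp [Fin.contractNth, Function.update_apply, Fin.ext_iff, h]
    · have : (l : ℕ) ≠ j := fun e => hl (Fin.ext e)
      simp only [Fin.contractNth, Function.update_apply, Fin.ext_iff, Fin.val_castSucc,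
        Fin.val_succ]
      split_ifs <;> first | rfl | omega
  · by_cases h' : (i : ℕ) = j + 1
    · refine ⟨j, mul (m j.castSucc), fun x => ?_⟩
      ext l
      by_cases hl : l = j
      · subst hl
        simp [Fin.contractNth, Function.update_apply, Fin.ext_iff, h']
      · have : (l : ℕ) ≠ j := fun e => hl (Fin.ext e)
        simp only [Fin.contractNth, Function.update_apply, Fin.ext_iff, Fin.val_castSucc,
          Fin.val_succ]
        split_ifs <;> first | rfl | omega
    · refine ⟨⟨i - 1, by omega⟩, LinearMap.id, fun x => ?_⟩
      ext l
      simp only [Fin.contractNth, Function.update_apply, Fin.ext_iff, Fin.val_castSucc,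
        Fin.val_succ, LinearMap.id_apply]
      split_ifs <;> first | rfl | omega

/-- `m⁰ ⊗ ⋯ ⊗ mⁿ ↦ m⁰ ⊗ ⋯ ⊗ mʲmʲ⁺¹ ⊗ ⋯ ⊗ mⁿ`, for a bilinear multiplication on `M`. -/
def contract (mul : M →ₗ[k] M →ₗ[k] M) {n : ℕ} (j : Fin n) : ⨂[k]^(n + 1) M →ₗ[k] ⨂[k]^n M :=
  PiTensorProduct.lift (MultilinearMap.mk'
    (fun m : Fin (n + 1) → M =>
      PiTensorProduct.tprod k (Fin.contractNth j.castSucc (fun a b => mul a b) m))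
    (by
      intro m i x y
      obtain ⟨l, φ, h⟩ := contractNth_update mul j m i
      simp only [h, map_add, MultilinearMap.map_update_add])
    (by
      intro m i c x
      obtain ⟨l, φ, h⟩ := contractNth_update mul j m i
      simp only [h, map_smul, MultilinearMap.map_update_smul]))

@[simp]
theorem contract_tprod (mul : M →ₗ[k] M →ₗ[k] M) {n : ℕ} (j : Fin n) (m : Fin (n + 1) → M) :
    contract mul j (PiTensorProduct.tprod k m) =
      PiTensorProduct.tprod k (Fin.contractNth j.castSucc (fun a b => mul a b) m) := by
  simp [contract]

end TensorPowers

/-! ### Hochschild cohomology with trivial coefficients -/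

section Hochschild

variable {k : Type u} [Field k] {A : Type v} [AddCommMonoid A] [Module k A]

/-- The faces `Aⁿ⁺¹ → Aⁿ` of the bar complex of an algebra `A` with multiplication `mul` and
augmentation `ε`: the outer ones apply `ε` to the first or to the last factor. -/
def hochschildFace (mul : A →ₗ[k] A →ₗ[k] A) (ε : A →ₗ[k] k) (n : ℕ) (i : Fin (n + 2)) :
    ⨂[k]^(n + 1) A →ₗ[k] ⨂[k]^n A :=
  if h0 : i = 0 then
    (TensorProduct.lid k (⨂[k]^n A)).toLinearMap ∘ₗ ε.rTensor (⨂[k]^n A) ∘ₗ headSplit k A n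
  else if hl : i = Fin.last (n + 1) then
    (TensorProduct.rid k (⨂[k]^n A)).toLinearMap ∘ₗ ε.lTensor (⨂[k]^n A) ∘ₗ lastSplit k A n
  else contract mul (⟨i - 1, by
    have := Fin.val_ne_of_ne h0; have := Fin.val_ne_of_ne hl
    simp only [Fin.val_zero, Fin.val_last] at *; omega⟩ : Fin n)

/-- The differential `Hom(Aⁿ, k) → Hom(Aⁿ⁺¹, k)` of the standard complex computing Hochschild
cohomology of `A` with coefficients in the trivial bimodule `k`. -/
def hochschildD (mul : A →ₗ[k] A →ₗ[k] A) (ε : A →ₗ[k] k) (n : ℕ) :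
    Module.Dual k (⨂[k]^n A) →ₗ[k] Module.Dual k (⨂[k]^(n + 1) A) :=
  (∑ i : Fin (n + 2), (-1 : k) ^ (i : ℕ) • hochschildFace mul ε n i).dualMap

end Hochschild

/-! ### A Hopf algebra `B`, its dual `X = (Bᵒᵖ)* = (B*)ᶜᵒᵖ`, and the double `D(B)` -/

section Hopf

variable (k : Type u) [Field k] (B : Type v) [Ring B] [HopfAlgebra k B]

/-- The composition inverse `S⁻¹` of the antipode (which is bijective when `B` is finite
dimensional; the value `0` is only used when there is no inverse). -/
def antipodeInv : B →ₗ[k] B :=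
  open Classical in
  if h : Function.Bijective (HopfAlgebra.antipode k (A := B)) then
    (LinearEquiv.ofBijective (HopfAlgebra.antipode k (A := B)) h).symm.toLinearMap
  else 0

/-- The underlying space of `X`. -/
abbrev X : Type max u v := Module.Dual k B

/-- The multiplication of `X` (convolution): `⟨xy, a⟩ = ⟨x, a₁⟩⟨y, a₂⟩`. -/
def mulX : X k B →ₗ[k] X k B →ₗ[k] X k B :=
  TensorProduct.curry
    ((Coalgebra.comul (R := k) (A := B)).dualMap ∘ₗ TensorProduct.dualDistrib k B B)

/-- The counit of `X`: `x ↦ ⟨x, 1⟩`. -/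
def counitX : X k B →ₗ[k] k := Module.Dual.eval k B 1

/-- The unit of `X`: the counit of `B`. -/
def oneX : X k B := Coalgebra.counit

/-- The left action of `B` on `X`: `⟨ᵃx, b⟩ = ⟨x, ba⟩`. -/
def actL : B →ₗ[k] X k B →ₗ[k] X k B :=
  LinearMap.mk₂ k (fun a x => x ∘ₗ LinearMap.mulRight k a)
    (fun _ _ _ => by ext; simp [mul_add]) (fun _ _ _ => by ext; simp)
    (fun _ _ _ => by ext; simp) (fun _ _ _ => by ext; simp)

/-- The right action of `B` on `X`: `⟨xᵃ, b⟩ = ⟨x, ab⟩`, written with the scalar first. -/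
def actR : B →ₗ[k] X k B →ₗ[k] X k B :=
  LinearMap.mk₂ k (fun a x => x ∘ₗ LinearMap.mulLeft k a)
    (fun _ _ _ => by ext; simp [add_mul]) (fun _ _ _ => by ext; simp)
    (fun _ _ _ => by ext; simp) (fun _ _ _ => by ext; simp)

/-- The iterated comultiplication `a ↦ a₁ ⊗ ⋯ ⊗ aₙ`; for `n = 0` it is the counit. -/
def iterComul : ∀ n, B →ₗ[k] ⨂[k]^n B
  | 0 => LinearMap.toSpanSingleton k (⨂[k]^0 B) (PiTensorProduct.tprod k Fin.elim0) ∘ₗ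
      Coalgebra.counit
  | n + 1 => cons k B n ∘ₗ (iterComul n).lTensor B ∘ₗ Coalgebra.comul

/-- The diagonal action of `B` on `Mⁿ` coming from an action on `M`:
`a · (m¹ ⊗ ⋯ ⊗ mⁿ) = a₁ m¹ ⊗ ⋯ ⊗ aₙ mⁿ`. -/
def diagAct {M : Type w} [AddCommMonoid M] [Module k M] (act : B →ₗ[k] M →ₗ[k] M) (n : ℕ) :
    B →ₗ[k] ⨂[k]^n M →ₗ[k] ⨂[k]^n M :=
  PiTensorProduct.map₂ (fun _ => act) ∘ₗ iterComul k B n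

/-- The diagonal left action `ᵃ𝐱` of `B` on `Xⁿ`. -/
def diagL (n : ℕ) : B →ₗ[k] ⨂[k]^n (X k B) →ₗ[k] ⨂[k]^n (X k B) := diagAct k B (actL k B) n

/-- The diagonal right action `𝐱ᵃ = (x¹)^{a₁} ⊗ ⋯ ⊗ (xⁿ)^{aₙ}` of `B` on `Xⁿ`. -/
def diagR (n : ℕ) : B →ₗ[k] ⨂[k]^n (X k B) →ₗ[k] ⨂[k]^n (X k B) := diagAct k B (actR k B) n

/-- The multiplication `𝐛 ↦ b¹ ⋯ bⁿ`. -/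
def hat (n : ℕ) : ⨂[k]^n B →ₗ[k] B := PiTensorProduct.lift (MultilinearMap.mkPiAlgebraFin k n B)

/-- The comultiplication `𝐛 ↦ 𝐛₁ ⊗ 𝐛₂ = (b¹₁ ⊗ ⋯ ⊗ bⁿ₁) ⊗ (b¹₂ ⊗ ⋯ ⊗ bⁿ₂)` of `Bⁿ`. -/
def comulPow : ∀ n, ⨂[k]^n B →ₗ[k] ⨂[k]^n B ⊗[k] ⨂[k]^n B
  | 0 => (TensorProduct.mk k (⨂[k]^0 B) (⨂[k]^0 B)).flip (PiTensorProduct.tprod k Fin.elim0)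
  | n + 1 => TensorProduct.map (cons k B n) (cons k B n) ∘ₗ
      (TensorProduct.tensorTensorTensorComm k B B (⨂[k]^n B) (⨂[k]^n B)).toLinearMap ∘ₗ
      TensorProduct.map Coalgebra.comul (comulPow n) ∘ₗ headSplit k B n

/-- The diagonal left action of `X` on `Bⁿ`: `ˣ𝐚 = ⟨x, â₂⟩ 𝐚₁`. -/
def coactL (n : ℕ) : X k B →ₗ[k] ⨂[k]^n B →ₗ[k] ⨂[k]^n B :=
  LinearMap.mk₂ k
    (fun x a => TensorProduct.rid k (⨂[k]^n B) ((x ∘ₗ hat k B n).lTensor _ (comulPow k B n a)))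
    (fun _ _ _ => by simp [LinearMap.add_comp, LinearMap.lTensor_add])
    (fun _ _ _ => by simp [LinearMap.smul_comp, LinearMap.lTensor_smul])
    (fun _ _ _ => by simp) (fun _ _ _ => by simp)

/-- The diagonal right action of `X` on `Bⁿ`: `𝐚ˣ = ⟨x, â₁⟩ 𝐚₂`, written with `x` first. -/
def coactR (n : ℕ) : X k B →ₗ[k] ⨂[k]^n B →ₗ[k] ⨂[k]^n B :=
  LinearMap.mk₂ k
    (fun x a => TensorProduct.lid k (⨂[k]^n B) ((x ∘ₗ hat k B n).rTensor _ (comulPow k B n a)))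
    (fun _ _ _ => by simp [LinearMap.add_comp, LinearMap.rTensor_add])
    (fun _ _ _ => by simp [LinearMap.smul_comp, LinearMap.rTensor_smul])
    (fun _ _ _ => by simp) (fun _ _ _ => by simp)

/-- The flip `c_{1,n} : B ⊗ Xⁿ → Xⁿ ⊗ B`, `a ⊗ 𝐱 ↦ ^{a₁}(𝐱^{S⁻¹(a₃)}) ⊗ a₂`. -/
def flipMap (n : ℕ) : B ⊗[k] ⨂[k]^n (X k B) →ₗ[k] ⨂[k]^n (X k B) ⊗[k] B :=
  -- `(a₁ ⊗ a₃) ⊗ 𝐱 ↦ ^{a₁}(𝐱^{S⁻¹(a₃)})`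
  let act : (B ⊗[k] B) ⊗[k] ⨂[k]^n (X k B) →ₗ[k] ⨂[k]^n (X k B) :=
    TensorProduct.lift (diagL k B n) ∘ₗ
      (TensorProduct.lift (diagR k B n ∘ₗ antipodeInv k B)).lTensor B ∘ₗ
      (TensorProduct.assoc k B B (⨂[k]^n (X k B))).toLinearMap
  -- `a ↦ (a₁ ⊗ a₃) ⊗ a₂`
  let split : B →ₗ[k] (B ⊗[k] B) ⊗[k] B :=
    (TensorProduct.rightComm k B B B).toLinearMap ∘ₗ
      (Coalgebra.comul (R := k) (A := B)).rTensor B ∘ₗ Coalgebra.comul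
  act.rTensor B ∘ₗ (TensorProduct.rightComm k (B ⊗[k] B) B (⨂[k]^n (X k B))).toLinearMap ∘ₗ
    split.rTensor (⨂[k]^n (X k B))

/-- The underlying space `X ⊗ B` of the Drinfeld double `D(B) = X ⋈ B`. -/
abbrev Double : Type max u v := X k B ⊗[k] B

/-- The flip `c : B ⊗ X → X ⊗ B`, `a ⊗ x ↦ ^{a₁}(x^{S⁻¹(a₃)}) ⊗ a₂`. -/
def flipMapOne : B ⊗[k] X k B →ₗ[k] X k B ⊗[k] B :=
  let e : ⨂[k]^1 (X k B) ≃ₗ[k] X k B := PiTensorProduct.subsingletonEquiv 0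
  e.toLinearMap.rTensor B ∘ₗ flipMap k B 1 ∘ₗ e.symm.toLinearMap.lTensor B

/-- The multiplication of `D(B)`: `(x ⋈ a)(y ⋈ b) = x ^{a₁}(y^{S⁻¹(a₃)}) ⋈ a₂ b`. -/
def mulDouble : Double k B →ₗ[k] Double k B →ₗ[k] Double k B :=
  TensorProduct.curry
    (TensorProduct.map (TensorProduct.lift (mulX k B)) (LinearMap.mul' k B) ∘ₗ
      -- `(x ⊗ a) ⊗ (y ⊗ b) ↦ (x ⊗ y') ⊗ (a' ⊗ b)`, where `c (a ⊗ y) = y' ⊗ a'`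
      (TensorProduct.assoc k (X k B) (X k B) (B ⊗[k] B)).symm.toLinearMap ∘ₗ
      ((TensorProduct.assoc k (X k B) B B).toLinearMap ∘ₗ (flipMapOne k B).rTensor B ∘ₗ
        (TensorProduct.assoc k B (X k B) B).symm.toLinearMap).lTensor (X k B) ∘ₗ
      (TensorProduct.assoc k (X k B) B (X k B ⊗[k] B)).toLinearMap)

/-- The counit of `D(B)`: `x ⋈ a ↦ ⟨x, 1⟩ ε(a)`. -/
def counitDouble : Double k B →ₗ[k] k :=
  (TensorProduct.lid k k).toLinearMap ∘ₗ TensorProduct.map (counitX k B) Coalgebra.counit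

/-- The inclusion `B → D(B)`, `b ↦ 1 ⋈ b`. -/
def inclB : B →ₗ[k] Double k B := TensorProduct.mk k (X k B) B (oneX k B)

/-- The inclusion `X → D(B)`, `x ↦ x ⋈ 1`. -/
def inclX : X k B →ₗ[k] Double k B := (TensorProduct.mk k (X k B) B).flip 1

/-! ### The cosimplicial bicomplex `𝐂` -/

/-- The space `X^p ⊗ B^q`. -/
abbrev XB (p q : ℕ) : Type max u v := ⨂[k]^p (X k B) ⊗[k] ⨂[k]^q B

/-- The faces `∂ᴮᵢ : X^p ⊗ B^{q+1} → X^p ⊗ B^q`: for `i = 0` it is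
`𝐱^{a¹} ⊗ (a² ⊗ ⋯ ⊗ a^{q+1})`, for `i = q + 1` it is `^{a^{q+1}}𝐱 ⊗ (a¹ ⊗ ⋯ ⊗ a^q)`, and the others
multiply `aⁱ` and `aⁱ⁺¹`. -/
def faceB (p q : ℕ) (i : Fin (q + 2)) : XB k B p (q + 1) →ₗ[k] XB k B p q :=
  if h0 : i = 0 then
    (TensorProduct.lift (diagR k B p).flip).rTensor (⨂[k]^q B) ∘ₗ
      (TensorProduct.assoc k (⨂[k]^p (X k B)) B (⨂[k]^q B)).symm.toLinearMap ∘ₗ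
      (headSplit k B q).lTensor (⨂[k]^p (X k B))
  else if hl : i = Fin.last (q + 1) then
    (TensorProduct.lift (diagL k B p).flip).rTensor (⨂[k]^q B) ∘ₗ
      (TensorProduct.assoc k (⨂[k]^p (X k B)) B (⨂[k]^q B)).symm.toLinearMap ∘ₗ
      ((TensorProduct.comm k (⨂[k]^q B) B).toLinearMap ∘ₗ lastSplit k B q).lTensor
        (⨂[k]^p (X k B))
  else
    (contract (LinearMap.mul k B) (⟨i - 1, by
      have := Fin.val_ne_of_ne h0; have := Fin.val_ne_of_ne hl
      simp only [Fin.val_zero, Fin.val_last] at *; omega⟩ : Fin q)).lTensor (⨂[k]^p (X k B))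

/-- The faces `∂ˣⱼ : X^{p+1} ⊗ B^q → X^p ⊗ B^q`: for `j = 0` it is
`(x² ⊗ ⋯ ⊗ x^{p+1}) ⊗ 𝐚^{x¹}`, for `j = p + 1` it is `(x¹ ⊗ ⋯ ⊗ x^p) ⊗ ^{x^{p+1}}𝐚`, and the others
multiply `xʲ` and `xʲ⁺¹`. -/
def faceX (p q : ℕ) (j : Fin (p + 2)) : XB k B (p + 1) q →ₗ[k] XB k B p q :=
  if h0 : j = 0 then
    (TensorProduct.lift (coactR k B q)).lTensor (⨂[k]^p (X k B)) ∘ₗ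
      (TensorProduct.assoc k (⨂[k]^p (X k B)) (X k B) (⨂[k]^q B)).toLinearMap ∘ₗ
      ((TensorProduct.comm k (X k B) (⨂[k]^p (X k B))).toLinearMap ∘ₗ
        headSplit k (X k B) p).rTensor (⨂[k]^q B)
  else if hl : j = Fin.last (p + 1) then
    (TensorProduct.lift (coactL k B q)).lTensor (⨂[k]^p (X k B)) ∘ₗ
      (TensorProduct.assoc k (⨂[k]^p (X k B)) (X k B) (⨂[k]^q B)).toLinearMap ∘ₗ
      (lastSplit k (X k B) p).rTensor (⨂[k]^q B)
  else
    (contract (mulX k B) (⟨j - 1, by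
      have := Fin.val_ne_of_ne h0; have := Fin.val_ne_of_ne hl
      simp only [Fin.val_zero, Fin.val_last] at *; omega⟩ : Fin p)).rTensor (⨂[k]^q B)

/-- `∂ᴮ = ∑ (-1)ⁱ ∂ᴮᵢ`. -/
def bdryB (p q : ℕ) : XB k B p (q + 1) →ₗ[k] XB k B p q :=
  ∑ i : Fin (q + 2), (-1 : k) ^ (i : ℕ) • faceB k B p q i

/-- `∂ˣ = ∑ (-1)ʲ ∂ˣⱼ`. -/
def bdryX (p q : ℕ) : XB k B (p + 1) q →ₗ[k] XB k B p q :=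
  ∑ j : Fin (p + 2), (-1 : k) ^ (j : ℕ) • faceX k B p q j

/-! ### The total complex `Tot 𝐂` and its edge quotient `Tot 𝐂₁` -/

/-- `Totⁿ 𝐂 = ⨁_{p+q=n} Hom(X^p ⊗ B^q, k)`. -/
abbrev Tot (n : ℕ) : Type max u v :=
  ∀ pq : Finset.HasAntidiagonal.antidiagonal n, Module.Dual k (XB k B pq.1.1 pq.1.2)

/-- The component in `Hom(X^p ⊗ B^q, k)`, `p + q = n`, of a total cochain. -/
def totProj (n p q : ℕ) (h : p + q = n) : Tot k B n →ₗ[k] Module.Dual k (XB k B p q) :=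
  LinearMap.proj (φ := fun pq : Finset.HasAntidiagonal.antidiagonal n => Module.Dual k (XB k B pq.1.1 pq.1.2))
    ⟨(p, q), Finset.HasAntidiagonal.mem_antidiagonal.mpr h⟩

/-- The `(p, q)`-component of `(∂ˣ)* f`. -/
def totDX (n : ℕ) : ∀ p q : ℕ, p + q = n + 1 → (Tot k B n →ₗ[k] Module.Dual k (XB k B p q))
  | 0, _, _ => 0
  | p + 1, q, h => (bdryX k B p q).dualMap ∘ₗ totProj k B n p q (by omega)

/-- The `(p, q)`-component of `(∂ᴮ)* f`, with the sign `(-1)^p`. -/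
def totDB (n : ℕ) : ∀ p q : ℕ, p + q = n + 1 → (Tot k B n →ₗ[k] Module.Dual k (XB k B p q))
  | _, 0, _ => 0
  | p, q + 1, h => (-1 : k) ^ p • (bdryB k B p q).dualMap ∘ₗ totProj k B n p q (by omega)

/-- The differential of `Tot 𝐂`; it restricts to `(∂ˣ)* ⊕ (-1)^p (∂ᴮ)*` on `Hom(X^p ⊗ B^q, k)`. -/
def totD (n : ℕ) : Tot k B n →ₗ[k] Tot k B (n + 1) :=
  LinearMap.pi fun pq =>
    totDX k B n pq.1.1 pq.1.2 (Finset.HasAntidiagonal.mem_antidiagonal.mp pq.2) +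
      totDB k B n pq.1.1 pq.1.2 (Finset.HasAntidiagonal.mem_antidiagonal.mp pq.2)

/-- `Totⁿ 𝐂₀`: the total cochains whose components on the edges `p = 0` and `q = 0` vanish. -/
def tot₀ (n : ℕ) : Submodule k (Tot k B n) where
  carrier := {f | ∀ pq : Finset.HasAntidiagonal.antidiagonal n, pq.1.1 = 0 ∨ pq.1.2 = 0 → f pq = 0}
  add_mem' hf hg pq h := by simp [hf pq h, hg pq h]
  zero_mem' _ _ := rfl
  smul_mem' c f hf pq h := by simp [hf pq h]

theorem totD_mem_tot₀ (n : ℕ) : tot₀ k B n ≤ (tot₀ k B (n + 1)).comap (totD k B n) := by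
  rintro f hf ⟨⟨p, q⟩, hpq⟩ h
  have hX : ∀ (p q : ℕ) (e : p + q = n + 1), p = 0 ∨ q = 0 → totDX k B n p q e f = 0 := by
    rintro (_ | p) q e h
    · rfl
    · have : totProj k B n p q (by omega) f = 0 :=
        hf ⟨(p, q), Finset.HasAntidiagonal.mem_antidiagonal.mpr (by omega)⟩ (Or.inr (by simpa using h))
      simp [totDX, this]
  have hB : ∀ (p q : ℕ) (e : p + q = n + 1), p = 0 ∨ q = 0 → totDB k B n p q e f = 0 := by
    rintro p (_ | q) e h
    · rfl
    · have : totProj k B n p q (by omega) f = 0 :=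
        hf ⟨(p, q), Finset.HasAntidiagonal.mem_antidiagonal.mpr (by omega)⟩ (Or.inl (by simpa using h))
      simp [totDB, this]
  have e := Finset.HasAntidiagonal.mem_antidiagonal.mp hpq
  change totDX k B n p q e f + totDB k B n p q e f = 0
  rw [hX p q e h, hB p q e h, add_zero]

/-- `Totⁿ 𝐂₁ = Totⁿ 𝐂 / Totⁿ 𝐂₀`, the edges of `𝐂`. -/
def Tot₁ (n : ℕ) : Type max u v := Tot k B n ⧸ tot₀ k B n

instance (n : ℕ) : AddCommGroup (Tot₁ k B n) :=
  inferInstanceAs (AddCommGroup (Tot k B n ⧸ tot₀ k B n))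

instance (n : ℕ) : Module k (Tot₁ k B n) :=
  inferInstanceAs (Module k (Tot k B n ⧸ tot₀ k B n))

/-- The differential of `Tot 𝐂₁`. -/
def tot₁D (n : ℕ) : Tot₁ k B n →ₗ[k] Tot₁ k B (n + 1) :=
  (tot₀ k B n).mapQ (tot₀ k B (n + 1)) (totD k B n) (totD_mem_tot₀ k B n)

/-- The projection `π : Totⁿ 𝐂 → Totⁿ 𝐂₁`. -/
def totPi (n : ℕ) : Tot k B n →ₗ[k] Tot₁ k B n := (tot₀ k B n).mkQ

/-- The edge `Totⁿ 𝐂₁ → Hom(Bⁿ, k)`, identifying `X⁰ ⊗ Bⁿ` with `Bⁿ`. -/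
def edgeB (n : ℕ) : Tot₁ k B n →ₗ[k] Module.Dual k (⨂[k]^n B) :=
  (tot₀ k B n).liftQ
    ((TensorProduct.mk k (⨂[k]^0 (X k B)) (⨂[k]^n B)
      (PiTensorProduct.tprod k Fin.elim0)).dualMap ∘ₗ totProj k B n 0 n (by omega))
    (fun f hf => by
      have : totProj k B n 0 n (by omega) f = 0 := hf ⟨(0, n), by simp⟩ (Or.inl rfl)
      simp [this])

/-- The edge `Totⁿ 𝐂₁ → Hom(Xⁿ, k)`, identifying `Xⁿ ⊗ B⁰` with `Xⁿ`. -/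
def edgeX (n : ℕ) : Tot₁ k B n →ₗ[k] Module.Dual k (⨂[k]^n (X k B)) :=
  (tot₀ k B n).liftQ
    (((TensorProduct.mk k (⨂[k]^n (X k B)) (⨂[k]^0 B)).flip
      (PiTensorProduct.tprod k Fin.elim0)).dualMap ∘ₗ totProj k B n n 0 (by omega))
    (fun f hf => by
      have : totProj k B n n 0 (by omega) f = 0 := hf ⟨(n, 0), by simp⟩ (Or.inr rfl)
      simp [this])

/-! ### The diagonal complex `Diag 𝐂` and the Alexander–Whitney map -/

/-- The differential of `Diag 𝐂`: the dual of `∑ (-1)ⁱ ∂ˣᵢ ∂ᴮᵢ : X^{n+1} ⊗ B^{n+1} → Xⁿ ⊗ Bⁿ`. -/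
def diagD (n : ℕ) : Module.Dual k (XB k B n n) →ₗ[k] Module.Dual k (XB k B (n + 1) (n + 1)) :=
  (∑ i : Fin (n + 2), (-1 : k) ^ (i : ℕ) • (faceX k B n n i ∘ₗ faceB k B (n + 1) n i)).dualMap

/-- `∂ˣ_{p+1} ⋯ ∂ˣ_{p+m} : X^{p+m} ⊗ B^q → X^p ⊗ B^q`, an iteration of last faces. -/
def iterLastX (p q : ℕ) : ∀ m, XB k B (p + m) q →ₗ[k] XB k B p q
  | 0 => LinearMap.id
  | m + 1 => iterLastX p q m ∘ₗ faceX k B (p + m) q (Fin.last (p + m + 1))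

/-- `∂ᴮ₀ ⋯ ∂ᴮ₀ : X^p ⊗ B^{q+m} → X^p ⊗ B^q`, an iteration of zeroth faces. -/
def iterZeroB (p q : ℕ) : ∀ m, XB k B p (q + m) →ₗ[k] XB k B p q
  | 0 => LinearMap.id
  | m + 1 => iterZeroB p q m ∘ₗ faceB k B p (q + m) 0

/-- `∂ˣ_{p+1} ⋯ ∂ˣ_n ∂ᴮ₀ ⋯ ∂ᴮ₀ : Xⁿ ⊗ Bⁿ → X^p ⊗ B^q`, where `p + q = n`. -/
def awFace (n p q : ℕ) (h : p + q = n) : XB k B n n →ₗ[k] XB k B p q :=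
  iterLastX k B p q q ∘ₗ iterZeroB k B (p + q) q p ∘ₗ
    TensorProduct.map (TensorPower.cast k (X k B) h.symm).toLinearMap
      (TensorPower.cast k B (h.symm.trans (Nat.add_comm p q))).toLinearMap

/-- The cosimplicial Alexander–Whitney map `Φ : Totⁿ 𝐂 → Diagⁿ 𝐂`, given on `Hom(X^p ⊗ B^q, k)` by
`Φ f = f ∂ˣ_{p+1} ⋯ ∂ˣ_n ∂ᴮ₀ ⋯ ∂ᴮ₀`. -/
def alexanderWhitney (n : ℕ) : Tot k B n →ₗ[k] Module.Dual k (XB k B n n) :=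
  ∑ pq : Finset.HasAntidiagonal.antidiagonal n,
    (awFace k B n pq.1.1 pq.1.2 (Finset.HasAntidiagonal.mem_antidiagonal.mp pq.2)).dualMap ∘ₗ
      LinearMap.proj pq

/-! ### The isomorphism of `Diag 𝐂` with the standard complex of `D(B)` -/

/-- `c̃ₙ : (X ⋈ B)ⁿ → Xⁿ ⊗ Bⁿ`, moving all factors from `X` to the left by means of the flip `c`:
`c̃ₙ₊₁ = (1 ⊗ c_{1,n} ⊗ 1)(1 ⊗ c̃ₙ)`. -/
def flipAll : ∀ n, ⨂[k]^n (Double k B) →ₗ[k] XB k B n n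
  | 0 => LinearMap.toSpanSingleton k (XB k B 0 0)
      (PiTensorProduct.tprod k Fin.elim0 ⊗ₜ[k] PiTensorProduct.tprod k Fin.elim0) ∘ₗ
      (PiTensorProduct.isEmptyEquiv (R := k) (s := fun _ => Double k B) (Fin 0)).toLinearMap
  | n + 1 =>
    TensorProduct.map (cons k (X k B) n) (cons k B n) ∘ₗ
      (TensorProduct.assoc k (X k B) (⨂[k]^n (X k B)) (B ⊗[k] ⨂[k]^n B)).symm.toLinearMap ∘ₗ
      ((TensorProduct.assoc k (⨂[k]^n (X k B)) B (⨂[k]^n B)).toLinearMap ∘ₗ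
        (flipMap k B n).rTensor (⨂[k]^n B) ∘ₗ
        (TensorProduct.assoc k B (⨂[k]^n (X k B)) (⨂[k]^n B)).symm.toLinearMap).lTensor
          (X k B) ∘ₗ
      (TensorProduct.assoc k (X k B) B (XB k B n n)).toLinearMap ∘ₗ
      (flipAll n).lTensor (Double k B) ∘ₗ headSplit k (Double k B) n

/-- `φₙ : Xⁿ ⊗ Bⁿ → Xⁿ ⊗ Bⁿ`, `𝐱 ⊗ 𝐚 ↦ ⟨x̂₁, S⁻¹(â₁)⟩ 𝐱₂ ⊗ 𝐚₂ = ^{S⁻¹(â₁)}𝐱 ⊗ 𝐚₂`. -/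
def phi (n : ℕ) : XB k B n n →ₗ[k] XB k B n n :=
  (TensorProduct.lift (diagL k B n ∘ₗ antipodeInv k B ∘ₗ hat k B n).flip).rTensor (⨂[k]^n B) ∘ₗ
    (TensorProduct.assoc k (⨂[k]^n (X k B)) (⨂[k]^n B) (⨂[k]^n B)).symm.toLinearMap ∘ₗ
    (comulPow k B n).lTensor (⨂[k]^n (X k B))

/-- The map `(φₙ c̃ₙ)* : Diagⁿ 𝐂 → Hom(D(B)ⁿ, k)`. -/
def psiDual (n : ℕ) : Module.Dual k (XB k B n n) →ₗ[k] Module.Dual k (⨂[k]^n (Double k B)) :=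
  (phi k B n ∘ₗ flipAll k B n).dualMap

/-! ### Hochschild cohomology of `B`, `X` and `D(B)`, and the map to be computed -/

/-- The standard complex for `H_h^*(B, k)`. -/
def dB (n : ℕ) : Module.Dual k (⨂[k]^n B) →ₗ[k] Module.Dual k (⨂[k]^(n + 1) B) :=
  hochschildD (LinearMap.mul k B) Coalgebra.counit n

/-- The standard complex for `H_h^*(X, k)`. -/
def dX (n : ℕ) : Module.Dual k (⨂[k]^n (X k B)) →ₗ[k] Module.Dual k (⨂[k]^(n + 1) (X k B)) :=
  hochschildD (mulX k B) (counitX k B) n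

/-- The standard complex for `H_h^*(D(B), k)`. -/
def dDouble (n : ℕ) :
    Module.Dual k (⨂[k]^n (Double k B)) →ₗ[k] Module.Dual k (⨂[k]^(n + 1) (Double k B)) :=
  hochschildD (mulDouble k B) (counitDouble k B) n

/-- Restriction of cochains from `D(B)` to `B`. -/
def resB (n : ℕ) : Module.Dual k (⨂[k]^n (Double k B)) →ₗ[k] Module.Dual k (⨂[k]^n B) :=
  (PiTensorProduct.map fun _ : Fin n => inclB k B).dualMap

/-- Restriction of cochains from `D(B)` to `X`. -/
def resX (n : ℕ) : Module.Dual k (⨂[k]^n (Double k B)) →ₗ[k] Module.Dual k (⨂[k]^n (X k B)) :=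
  (PiTensorProduct.map fun _ : Fin n => inclX k B).dualMap

/-- `πbar` is the map `H_h^i(D(B), k) → H_h^i(B, k) ⊕ H_h^i(X, k)` of the long exact sequence, that
is, the composite
`H_h^i(D(B), k) ≃ H^i(Diag 𝐂) ≃ H^i(Tot 𝐂) → H^i(Tot 𝐂₁) ≃ H_h^i(B, k) ⊕ H_h^i(X, k)`,
where the first isomorphism is inverse to the one induced by `(φ c̃)*`, the second is inverse to the
one induced by the Alexander–Whitney map, the arrow is `H^i(π)`, and the last isomorphism is
induced by the two edges. -/
def IsPiBar (i : ℕ) (πbar : Cohomology (dDouble k B) i →ₗ[k]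
    Cohomology (dB k B) i × Cohomology (dX k B) i) : Prop :=
  ∃ (Ψ : Cohomology (diagD k B) i ≃ₗ[k] Cohomology (dDouble k B) i)
    (Φ : Cohomology (totD k B) i ≃ₗ[k] Cohomology (diagD k B) i)
    (Hπ : Cohomology (totD k B) i →ₗ[k] Cohomology (tot₁D k B) i)
    (E : Cohomology (tot₁D k B) i ≃ₗ[k] Cohomology (dB k B) i × Cohomology (dX k B) i),
    IsInducedBy (diagD k B) (dDouble k B) i (psiDual k B i) Ψ.toLinearMap ∧
    IsInducedBy (totD k B) (diagD k B) i (alexanderWhitney k B i) Φ.toLinearMap ∧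
    IsInducedBy (totD k B) (tot₁D k B) i (totPi k B i) Hπ ∧
    IsInducedBy (tot₁D k B) (dB k B) i (edgeB k B i) (LinearMap.fst k _ _ ∘ₗ E.toLinearMap) ∧
    IsInducedBy (tot₁D k B) (dX k B) i (edgeX k B i) (LinearMap.snd k _ _ ∘ₗ E.toLinearMap) ∧
    πbar = E.toLinearMap ∘ₗ Hπ ∘ₗ Φ.symm.toLinearMap ∘ₗ Ψ.symm.toLinearMap

end Hopf

end

end BialgebraCohomology

open scoped TensorProduct
namespace BialgebraCohomology
noncomputable section
universe u v w

/-! ### Bicosimplicial abelian groups -/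

/-! The statement combines three comparison theorems with one computation on cocycles.

Eilenberg–Zilber (`BiCosimplicial.aw_bijective`). The Alexander–Whitney map is an isomorphism on
cohomology for every bicosimplicial abelian group `M`. The proof is dimension shifting. Forgetting
the zeroth cofaces in both directions gives the décalage of `M`. It keeps the forgotten
codegeneracies as contracting homotopies, so its total and diagonal complexes are exact in positive
degrees. The zeroth cofaces embed `M` in its décalage, and the quotient is again bicosimplicial.
Hence degree `n + 1` for `M` follows from degree `n` for the quotient. In degree `0` a diagonal
cocycle is automatically a total cocycle, by the codegeneracies.

The double (`faceD_theta`, `flipAll_theta`). Instead of comparing the faces through `φ c̃`, an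
explicit map `Θ : Xⁿ ⊗ Bⁿ → D(B)ⁿ` is built by recursion from the canonical element `∑ eⁱ ⊗ eᵢ` of
`X ⊗ B`: `Θ(x ⊗ 𝐱 ⊗ a ⊗ 𝐚) = ∑ (eⁱ ⋈ a₂) ⊗ Θ(𝐱^{a₃} ⊗ 𝐚^y)` with `y = x^{eᵢ a₁}`. It carries each
diagonal face `∂ˣᵢ ∂ᴮᵢ` to the `i`-th face of the standard complex of `D(B)`. The essential case is
the face multiplying the first two factors (`thetaStep_mul`), where the canonical element turns the
products of `X` and of `D(B)` into the coproduct and product of `B`. The composite `c̃ Θ` is `𝐱 ⊗ 𝐚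
↦ ^{â₁}𝐱 ⊗ 𝐚₂`, and `φ` undoes it because `∑ S⁻¹(h₂) h₁ = ε(h)`. So `φ c̃ Θ = id`, and equality of
dimensions makes `Θ` a two-sided inverse. The use of `S⁻¹` rests on the bijectivity of the antipode,
proved here from a nonzero integral obtained as a trace (`antipode_injective`).

The edges (`exists_equiv_edge`). In positive total degree the two edges are disjoint, and on them
the faces of `𝐂` are the Hochschild faces of `B` and of `X`.

The composite. Restriction along `B → D(B)` precomposed with `(φ c̃)*` is evaluation on `ε ⊗ ⋯ ⊗ ε ⊗
𝐛`, because `ε` is invariant under the actions up to the counit. This is the iterated codegeneracy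
from the diagonal to the edge `p = 0`. It remains to see that for a total cocycle `f` the edge
component of `f` and the codegeneracy of its Alexander–Whitney image are cohomologous
(`exists_bB_eq`). The codegeneracies map `M` to its edge made constant in the other direction, where
the last cofaces are identities. There, `f` and the family concentrated on the edge with that value
have the same Alexander–Whitney image, so injectivity of Alexander–Whitney in cohomology makes them
cohomologous. The argument for `X` is symmetric. -/

/-- A bicosimplicial abelian group, with cofaces and codegeneracies indexed by `ℕ` (only the indices
in the usual range are subject to the cosimplicial identities). -/
structure BiCosimplicial where
  obj : ℕ → ℕ → Type w
  [grp : ∀ p q, AddCommGroup (obj p q)]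
  dX : ∀ p q, ℕ → obj p q →+ obj (p + 1) q
  dB : ∀ p q, ℕ → obj p q →+ obj p (q + 1)
  sX : ∀ p q, ℕ → obj (p + 1) q →+ obj p q
  sB : ∀ p q, ℕ → obj p (q + 1) →+ obj p q
  dX_dX : ∀ p q i j x, i ≤ j → j ≤ p + 1 →
    dX (p + 1) q (j + 1) (dX p q i x) = dX (p + 1) q i (dX p q j x)
  dB_dB : ∀ p q i j x, i ≤ j → j ≤ q + 1 →
    dB p (q + 1) (j + 1) (dB p q i x) = dB p (q + 1) i (dB p q j x)
  sX_dX_lt : ∀ p q i j x, i ≤ j → j ≤ p →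
    sX (p + 1) q (j + 1) (dX (p + 1) q i x) = dX p q i (sX p q j x)
  sX_dX_self : ∀ p q j x, j ≤ p → sX p q j (dX p q j x) = x
  sX_dX_succ : ∀ p q j x, j ≤ p → sX p q j (dX p q (j + 1) x) = x
  sX_dX_gt : ∀ p q i j x, j < i → i ≤ p + 1 →
    sX (p + 1) q j (dX (p + 1) q (i + 1) x) = dX p q i (sX p q j x)
  sB_dB_lt : ∀ p q i j x, i ≤ j → j ≤ q →
    sB p (q + 1) (j + 1) (dB p (q + 1) i x) = dB p q i (sB p q j x)
  sB_dB_self : ∀ p q j x, j ≤ q → sB p q j (dB p q j x) = x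
  sB_dB_succ : ∀ p q j x, j ≤ q → sB p q j (dB p q (j + 1) x) = x
  sB_dB_gt : ∀ p q i j x, j < i → i ≤ q + 1 →
    sB p (q + 1) j (dB p (q + 1) (i + 1) x) = dB p q i (sB p q j x)
  dX_dB : ∀ p q i j x, i ≤ p + 1 → j ≤ q + 1 →
    dX p (q + 1) i (dB p q j x) = dB (p + 1) q j (dX p q i x)
  sX_dB : ∀ p q i j x, i ≤ p → j ≤ q + 1 →
    sX p (q + 1) i (dB (p + 1) q j x) = dB p q j (sX p q i x)
  sB_dX : ∀ p q i j x, i ≤ p + 1 → j ≤ q →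
    sB (p + 1) q j (dX p (q + 1) i x) = dX p q i (sB p q j x)

namespace BiCosimplicial

theorem end_mul_apply {A : Type*} [AddCommMonoid A] (f g : AddMonoid.End A) (x : A) :
    (f * g) x = f (g x) := rfl

attribute [instance] BiCosimplicial.grp

variable (M : BiCosimplicial.{w})

/-- Families of elements of all the groups `M p q`. -/
abbrev Fam : Type w := ∀ p q, M.obj p q

/-- The alternating sum of the cofaces in the first direction. -/
def bX (p q : ℕ) : M.obj p q →+ M.obj (p + 1) q :=
  ∑ i ∈ Finset.range (p + 2), (-1 : ℤ) ^ i • M.dX p q i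

/-- The alternating sum of the cofaces in the second direction. -/
def bB (p q : ℕ) : M.obj p q →+ M.obj p (q + 1) :=
  ∑ i ∈ Finset.range (q + 2), (-1 : ℤ) ^ i • M.dB p q i

/-- The differential of the diagonal. -/
def bD (n : ℕ) : M.obj n n →+ M.obj (n + 1) (n + 1) :=
  ∑ i ∈ Finset.range (n + 2), (-1 : ℤ) ^ i • (M.dB (n + 1) n i).comp (M.dX n n i)

theorem bX_apply (p q : ℕ) (x : M.obj p q) :
    M.bX p q x = ∑ i ∈ Finset.range (p + 2), (-1 : ℤ) ^ i • M.dX p q i x := by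
  simp [bX, AddMonoidHom.finsetSum_apply]

theorem bB_apply (p q : ℕ) (x : M.obj p q) :
    M.bB p q x = ∑ i ∈ Finset.range (q + 2), (-1 : ℤ) ^ i • M.dB p q i x := by
  simp [bB, AddMonoidHom.finsetSum_apply]

theorem bD_apply (n : ℕ) (x : M.obj n n) :
    M.bD n x = ∑ i ∈ Finset.range (n + 2), (-1 : ℤ) ^ i • M.dB (n + 1) n i (M.dX n n i x) := by
  simp [bD, AddMonoidHom.finsetSum_apply]

/-- An operator on families raising the first degree by one. -/
def raiseX (d : ∀ p q, M.obj p q →+ M.obj (p + 1) q) : AddMonoid.End M.Fam where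
  toFun f
    | 0, _ => 0
    | p + 1, q => d p q (f p q)
  map_zero' := by funext p q; cases p <;> simp
  map_add' f g := by funext p q; cases p <;> simp

/-- An operator on families raising the second degree by one. -/
def raiseB (d : ∀ p q, M.obj p q →+ M.obj p (q + 1)) : AddMonoid.End M.Fam where
  toFun f
    | _, 0 => 0
    | p, q + 1 => d p q (f p q)
  map_zero' := by funext p q; cases q <;> simp
  map_add' f g := by funext p q; cases q <;> simp

@[simp] theorem raiseX_zero (d : ∀ p q, M.obj p q →+ M.obj (p + 1) q) (f : M.Fam) (q : ℕ) :
    M.raiseX d f 0 q = 0 := rfl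
@[simp] theorem raiseX_succ (d : ∀ p q, M.obj p q →+ M.obj (p + 1) q) (f : M.Fam) (p q : ℕ) :
    M.raiseX d f (p + 1) q = d p q (f p q) := rfl
@[simp] theorem raiseB_zero (d : ∀ p q, M.obj p q →+ M.obj p (q + 1)) (f : M.Fam) (p : ℕ) :
    M.raiseB d f p 0 = 0 := by cases p <;> rfl
@[simp] theorem raiseB_succ (d : ∀ p q, M.obj p q →+ M.obj p (q + 1)) (f : M.Fam) (p q : ℕ) :
    M.raiseB d f p (q + 1) = d p q (f p q) := by cases p <;> rfl

/-- The total differential on families. -/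
def totDiff (f : M.Fam) : M.Fam :=
  fun p q => M.raiseX M.bX f p q + (-1 : ℤ) ^ p • M.raiseB M.bB f p q

/-- The coface `i` in the first direction, on families; zero where the index is out of range. -/
def opX (i : ℕ) : AddMonoid.End M.Fam :=
  M.raiseX fun p q => if i ≤ p + 1 then M.dX p q i else 0

/-- The coface `i` in the second direction, on families; zero where the index is out of range. -/
def opB (i : ℕ) : AddMonoid.End M.Fam :=
  M.raiseB fun p q => if i ≤ q + 1 then M.dB p q i else 0

/-- The last coface in the first direction, on families. -/
def lastX : AddMonoid.End M.Fam := M.raiseX fun p q => M.dX p q (p + 1)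

/-- The zeroth coface in the second direction, on families. -/
def zeroB : AddMonoid.End M.Fam := M.raiseB fun p q => M.dB p q 0

/-- The Alexander–Whitney map, on families. -/
def aw (n : ℕ) (f : M.Fam) : M.obj n n :=
  ∑ pq ∈ Finset.HasAntidiagonal.antidiagonal n, (M.zeroB ^ pq.1 * M.lastX ^ pq.2) f n n

/-! ### Cofaces as operators on families, and the Alexander–Whitney cochain identity. -/

theorem opX_succ_apply {i p : ℕ} (h : i ≤ p + 1) (f : M.Fam) (q : ℕ) :
    M.opX i f (p + 1) q = M.dX p q i (f p q) := by
  simp [opX, h]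

theorem opB_succ_apply {i q : ℕ} (h : i ≤ q + 1) (f : M.Fam) (p : ℕ) :
    M.opB i f p (q + 1) = M.dB p q i (f p q) := by
  simp [opB, h]

theorem opB_zero : M.opB 0 = M.zeroB := by simp [opB, zeroB]

theorem raise_commute {c : ∀ p q, M.obj p q →+ M.obj (p + 1) q}
    {d : ∀ p q, M.obj p q →+ M.obj p (q + 1)}
    (h : ∀ p q x, c p (q + 1) (d p q x) = d (p + 1) q (c p q x)) :
    Commute (M.raiseX c) (M.raiseB d) := by
  ext f p q
  rcases p with _ | p <;> rcases q with _ | q <;> simp [h]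

theorem opX_commute_opB (i j : ℕ) : Commute (M.opX i) (M.opB j) := by
  refine M.raise_commute fun p q x => ?_
  by_cases hi : i ≤ p + 1 <;> by_cases hj : j ≤ q + 1 <;> simp [hi, hj, M.dX_dB]

theorem lastX_commute_opB (j : ℕ) : Commute M.lastX (M.opB j) := by
  refine M.raise_commute fun p q x => ?_
  by_cases hj : j ≤ q + 1 <;> simp [hj, M.dX_dB]

theorem lastX_commute_zeroB : Commute M.lastX M.zeroB := by
  rw [← opB_zero]; exact M.lastX_commute_opB 0

theorem opX_commute_zeroB (i : ℕ) : Commute (M.opX i) M.zeroB := by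
  rw [← opB_zero]; exact M.opX_commute_opB i 0

/-- The cosimplicial identity `dⱼ₊₁ d₀ = d₀ dⱼ`. Out-of-range cofaces are zero and both sides leave
the range together, so it holds as an operator identity without bounds on `j`. -/
theorem opB_succ_mul_zeroB (j : ℕ) : M.opB (j + 1) * M.zeroB = M.zeroB * M.opB j := by
  ext f p q
  rcases q with _ | _ | q
  · simp [opB, zeroB]
  · simp [opB, zeroB]
  · by_cases hj : j ≤ q + 1 <;> simp [opB, zeroB, hj, M.dB_dB]

/-- Each `d₀` passed lowers the index by one, and there are enough of them to bring it down to `0`.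
-/
theorem opB_mul_zeroB_pow_le {i p : ℕ} (h : i ≤ p) : M.opB i * M.zeroB ^ p = M.zeroB ^ (p + 1) := by
  induction p generalizing i with
  | zero => obtain rfl : i = 0 := by omega
            simp [opB_zero]
  | succ p ih =>
    rcases i with _ | i
    · rw [opB_zero, ← pow_succ']
    · rw [pow_succ', ← mul_assoc, opB_succ_mul_zeroB, mul_assoc, ih (by omega), ← pow_succ']

theorem opB_mul_zeroB_pow (i p : ℕ) : M.opB (p + i) * M.zeroB ^ p = M.zeroB ^ p * M.opB i := by
  induction p with
  | zero => simp
  | succ p ih =>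
    rw [pow_succ', ← mul_assoc, show p + 1 + i = (p + i) + 1 by omega, opB_succ_mul_zeroB,
      mul_assoc, ih, mul_assoc]

/-- A composite of cofaces at a given bidegree reads a single component of the family. This allows a
differential to be replaced there by its sum of cofaces, and families vanishing there to be dropped.
-/
theorem zeroB_pow_mul_lastX_pow_congr {f g : M.Fam} {p q : ℕ} (h : f p q = g p q) (a b : ℕ)
    {P Q : ℕ} (hP : P = p + a) (hQ : Q = q + b) :
    (M.zeroB ^ b * M.lastX ^ a) f P Q = (M.zeroB ^ b * M.lastX ^ a) g P Q := by
  have key : (M.lastX ^ a) f (p + a) q = (M.lastX ^ a) g (p + a) q := by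
    clear hP
    induction a with
    | zero => simpa using h
    | succ a ih =>
      simp only [pow_succ', end_mul_apply]
      exact congrArg (M.dX (p + a) q (p + a + 1)) ih
  subst hP hQ
  simp only [end_mul_apply]
  generalize (M.lastX ^ a) f = f' at key ⊢
  generalize (M.lastX ^ a) g = g' at key ⊢
  induction b with
  | zero => simpa using key
  | succ b ih =>
    simp only [pow_succ', end_mul_apply]
    rw [← add_assoc, zeroB, raiseB_succ, raiseB_succ]
    exact congrArg (M.dB (p + a) (q + b) 0) ih

/-- The index of a last coface depends on the degree. Hence the cosimplicial identity `dⱼ₊₁ dᵢ = dᵢ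
dⱼ`, with `j` the top index, is iterated at a fixed bidegree and not between operators. -/
theorem opX_lastX_pow_lt {i p : ℕ} (h : i ≤ p + 1) (q r : ℕ) (f : M.Fam) :
    M.opX i ((M.lastX ^ q) f) (p + q + 1) r = (M.lastX ^ q) (M.opX i f) (p + q + 1) r := by
  induction q with
  | zero => simp
  | succ q ih =>
    simp only [pow_succ', end_mul_apply]
    rw [opX_succ_apply _ (by omega)]
    conv_rhs => rw [lastX, raiseX_succ]
    change _ = M.dX (p + q + 1) r (p + q + 1 + 1) ((M.lastX ^ q) (M.opX i f) (p + q + 1) r)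
    rw [← ih, opX_succ_apply _ (by omega), M.dX_dX _ _ _ _ _ (by omega) (by omega)]
    rfl

/-- A coface of index above `p` slides inward past last cofaces until its index is the top one.
There it is itself a last coface. -/
theorem opX_lastX_pow_ge {i p q : ℕ} (h : p + 1 ≤ i) (h' : i ≤ p + q + 1) (r : ℕ) (f : M.Fam) :
    M.opX i ((M.lastX ^ q) f) (p + q + 1) r = (M.lastX ^ (q + 1)) f (p + q + 1) r := by
  induction q with
  | zero =>
    obtain rfl : i = p + 1 := by omega
    simp [opX, lastX]
  | succ q ih =>
    rw [opX_succ_apply _ (by omega), pow_succ' _ (q + 1), end_mul_apply]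
    conv_rhs => rw [lastX, raiseX_succ]
    by_cases hi : i = p + q + 2
    · subst hi; rfl
    · change _ = M.dX (p + q + 1) r (p + q + 1 + 1) ((M.lastX ^ (q + 1)) f (p + q + 1) r)
      rw [← ih (by omega), opX_succ_apply _ (by omega), M.dX_dX _ _ _ _ _ (by omega) (by omega),
        pow_succ', end_mul_apply]
      rfl

theorem bD_eq (n : ℕ) (f : M.Fam) :
    M.bD n (f n n) = ∑ i ∈ Finset.range (n + 2), (-1 : ℤ) ^ i • M.opB i (M.opX i f) (n+1) (n+1) := by
  rw [bD_apply]
  refine Finset.sum_congr rfl fun i hi => ?_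
  have := Finset.mem_range.mp hi
  rw [opB_succ_apply _ (by omega), opX_succ_apply _ (by omega)]

theorem fam_sum_apply {ι : Type*} (s : Finset ι) (F : ι → M.Fam) (p q : ℕ) :
    (∑ i ∈ s, F i) p q = ∑ i ∈ s, F i p q := by simp [Finset.sum_apply]

/-- For `f` in bidegree `(p, q)` the diagonal cofaces with `i ≤ p` produce the `dˣᵢ f`, and those
with `i > p` produce the `dᴮ_{i-p} f`. What is missing from the total differential is `dˣ_{p+1} f`
and `dᴮ₀ f`. Their images agree and carry opposite signs. -/
theorem bD_aw_term (p q : ℕ) (f : M.Fam) :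
    M.bD (p + q) ((M.zeroB ^ p * M.lastX ^ q) f (p + q) (p + q)) =
      (M.zeroB ^ (p + 1) * M.lastX ^ q) (M.raiseX M.bX f) (p + q + 1) (p + q + 1) +
        (-1 : ℤ) ^ p • (M.zeroB ^ p * M.lastX ^ (q + 1)) (M.raiseB M.bB f)
          (p + q + 1) (p + q + 1) := by
  rw [bD_eq]
  have e1 : ∀ i, M.opB i (M.opX i ((M.zeroB ^ p * M.lastX ^ q) f)) =
      (M.opB i * M.zeroB ^ p) (M.opX i ((M.lastX ^ q) f)) := fun i => by
    have := ((M.opX_commute_zeroB i).pow_right p).eq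
    change (M.opB i * M.opX i * (M.zeroB ^ p * M.lastX ^ q)) f =
      (M.opB i * M.zeroB ^ p * (M.opX i * M.lastX ^ q)) f
    congr 1
    simp only [mul_assoc]
    rw [← mul_assoc (M.opX i), this, mul_assoc]
  simp only [e1]
  -- The split is at `i = p`: below it the `B`-coface is absorbed by the powers of `d₀`, above it
  -- the `X`-coface is absorbed by the last cofaces.
  rw [show p + q + 2 = (p + 1) + (q + 1) by omega, Finset.sum_range_add]
  have h1 : ∀ i ∈ Finset.range (p + 1), (-1 : ℤ) ^ i • (M.opB i * M.zeroB ^ p)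
      (M.opX i ((M.lastX ^ q) f)) (p + q + 1) (p + q + 1) =
      (-1 : ℤ) ^ i • (M.zeroB ^ (p + 1) * M.lastX ^ q) (M.opX i f) (p + q + 1) (p + q + 1) := by
    intro i hi
    have := Finset.mem_range.mp hi
    rw [opB_mul_zeroB_pow_le _ (by omega), end_mul_apply]
    congr 1
    have := M.zeroB_pow_mul_lastX_pow_congr (p := p + q + 1) (q := q) 
      (M.opX_lastX_pow_lt (i := i) (p := p) (by omega) q q f) 0 (p + 1) (P := p + q + 1)
      (Q := p + q + 1) (by omega) (by omega)
    simpa using this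
  have h2 : ∀ i ∈ Finset.range (q + 1), (-1 : ℤ) ^ (p + 1 + i) • (M.opB (p + 1 + i) * M.zeroB ^ p)
      (M.opX (p + 1 + i) ((M.lastX ^ q) f)) (p + q + 1) (p + q + 1) =
      (-1 : ℤ) ^ (p + 1 + i) • (M.zeroB ^ p * M.lastX ^ (q + 1)) (M.opB (i + 1) f)
        (p + q + 1) (p + q + 1) := by
    intro i hi
    have := Finset.mem_range.mp hi
    rw [show p + 1 + i = p + (i + 1) by omega, opB_mul_zeroB_pow]
    congr 1
    have hc := ((M.lastX_commute_opB (i + 1)).pow_left (q + 1)).eq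
    have e2 : (M.zeroB ^ p * M.lastX ^ (q + 1)) (M.opB (i + 1) f) =
        (M.zeroB ^ p) (M.opB (i + 1) ((M.lastX ^ (q + 1)) f)) := by
      rw [end_mul_apply, ← end_mul_apply (M.lastX ^ (q + 1)), hc, end_mul_apply]
    rw [e2, end_mul_apply]
    have h3 : M.opB (i + 1) (M.opX (p + (i + 1)) ((M.lastX ^ q) f)) (p + q + 1) (q + 1) =
        M.opB (i + 1) ((M.lastX ^ (q + 1)) f) (p + q + 1) (q + 1) := by
      rw [opB_succ_apply _ (by omega), opB_succ_apply _ (by omega),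
        M.opX_lastX_pow_ge (by omega) (by omega)]
    simpa using M.zeroB_pow_mul_lastX_pow_congr h3 0 p (P := p + q + 1) (Q := p + q + 1)
      (by omega) (by omega)
  rw [Finset.sum_congr rfl h1, Finset.sum_congr rfl h2]
  have h4 : (M.zeroB ^ (p + 1) * M.lastX ^ q) (M.raiseX M.bX f) (p + q + 1) (p + q + 1) =
      ∑ i ∈ Finset.range (p + 2), (-1 : ℤ) ^ i •
        (M.zeroB ^ (p + 1) * M.lastX ^ q) (M.opX i f) (p + q + 1) (p + q + 1) := by
    rw [M.zeroB_pow_mul_lastX_pow_congr (p := p + 1) (q := q) (a := q) (b := p + 1)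
      (g := ∑ i ∈ Finset.range (p + 2), (-1 : ℤ) ^ i • M.opX i f) _ (by omega) (by omega)]
    · simp only [map_sum, map_zsmul, fam_sum_apply, Pi.smul_apply]
    · rw [raiseX_succ, bX_apply, fam_sum_apply]
      refine Finset.sum_congr rfl fun i hi => ?_
      have := Finset.mem_range.mp hi
      rw [Pi.smul_apply, Pi.smul_apply, opX_succ_apply _ (by omega)]
  have h5 : (M.zeroB ^ p * M.lastX ^ (q + 1)) (M.raiseB M.bB f) (p + q + 1) (p + q + 1) =
      ∑ i ∈ Finset.range (q + 2), (-1 : ℤ) ^ i •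
        (M.zeroB ^ p * M.lastX ^ (q + 1)) (M.opB i f) (p + q + 1) (p + q + 1) := by
    rw [M.zeroB_pow_mul_lastX_pow_congr (p := p) (q := q + 1) (a := q + 1) (b := p)
      (g := ∑ i ∈ Finset.range (q + 2), (-1 : ℤ) ^ i • M.opB i f) _ (by omega) (by omega)]
    · simp only [map_sum, map_zsmul, fam_sum_apply, Pi.smul_apply]
    · rw [raiseB_succ, bB_apply, fam_sum_apply]
      refine Finset.sum_congr rfl fun i hi => ?_
      have := Finset.mem_range.mp hi
      rw [Pi.smul_apply, Pi.smul_apply, opB_succ_apply _ (by omega)]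
  -- The two terms absent from the diagonal differential: `dˣ_{p+1}` is a last coface on bidegree
  -- `(p, q)` and `dᴮ₀` a zeroth one, so both composites equal `d₀^{p+1}` after `q + 1` last
  -- cofaces.
  have h6 : (M.zeroB ^ (p + 1) * M.lastX ^ q) (M.opX (p + 1) f) (p + q + 1) (p + q + 1) =
      (M.zeroB ^ p * M.lastX ^ (q + 1)) (M.opB 0 f) (p + q + 1) (p + q + 1) := by
    rw [M.zeroB_pow_mul_lastX_pow_congr (p := p + 1) (q := q) (a := q) (b := p + 1)
      (g := M.lastX f) _ (by omega) (by omega)]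
    · rw [opB_zero, ← end_mul_apply, ← end_mul_apply, mul_assoc, ← pow_succ, mul_assoc,
        (M.lastX_commute_zeroB.pow_left (q + 1)).eq, ← mul_assoc, pow_succ]
    · rw [opX_succ_apply _ le_rfl, lastX, raiseX_succ]
  rw [h4, h5, Finset.sum_range_succ _ (p + 1), Finset.sum_range_succ' _ (q + 1), smul_add,
    Finset.smul_sum, h6]
  have h7 : ∀ i, (-1 : ℤ) ^ p • (-1 : ℤ) ^ (i + 1) •
      (M.zeroB ^ p * M.lastX ^ (q + 1)) (M.opB (i + 1) f) (p + q + 1) (p + q + 1) =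
      (-1 : ℤ) ^ (p + 1 + i) •
      (M.zeroB ^ p * M.lastX ^ (q + 1)) (M.opB (i + 1) f) (p + q + 1) (p + q + 1) := fun i => by
    rw [smul_smul, ← pow_add, show p + (i + 1) = p + 1 + i by omega]
  simp only [h7]
  rw [pow_zero, one_smul, pow_succ (-1 : ℤ) p, mul_neg_one, neg_smul]
  abel

/-- The Alexander–Whitney map commutes with the differentials. -/
theorem bD_aw (n : ℕ) (f : M.Fam) : M.bD n (M.aw n f) = M.aw (n + 1) (M.totDiff f) := by
  have hD : M.totDiff f = M.raiseX M.bX f + fun p q => (-1 : ℤ) ^ p • M.raiseB M.bB f p q := rfl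
  rw [aw, aw, map_sum, hD]
  simp only [map_add, Pi.add_apply, Finset.sum_add_distrib]
  -- Nothing maps in the `X`-direction into `p = 0`, nor in the `B`-direction into `q = 0`. Once
  -- these end terms vanish, both sums are indexed by `p + q = n`.
  rw [Finset.Nat.sum_antidiagonal_succ, Finset.Nat.sum_antidiagonal_succ']
  have z1 : (M.zeroB ^ 0 * M.lastX ^ (n + 1)) (M.raiseX M.bX f) (n + 1) (n + 1) = 0 := by
    rw [M.zeroB_pow_mul_lastX_pow_congr (p := 0) (q := n + 1) (g := 0) (by simp) _ _ (by omega)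
      (by omega)]
    simp
  have z2 : (M.zeroB ^ (n + 1) * M.lastX ^ 0) (fun p q => (-1 : ℤ) ^ p • M.raiseB M.bB f p q)
      (n + 1) (n + 1) = 0 := by
    rw [M.zeroB_pow_mul_lastX_pow_congr (p := n + 1) (q := 0) (g := 0) (by simp) _ _ (by omega)
      (by omega)]
    simp
  rw [z1, z2, zero_add, zero_add, ← Finset.sum_add_distrib]
  refine Finset.sum_congr rfl fun pq h => ?_
  obtain ⟨p, q⟩ := pq
  obtain rfl : p + q = n := by simpa using h
  rw [bD_aw_term]
  congr 1
  rw [M.zeroB_pow_mul_lastX_pow_congr (p := p) (q := q + 1)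
    (f := fun p q => (-1 : ℤ) ^ p • M.raiseB M.bB f p q) (g := (-1 : ℤ) ^ p • M.raiseB M.bB f)
    (by simp) _ _ (by simp; omega) (by simp; omega), map_zsmul]
  rfl

/-- The terms at `(j + 1, i)` and `(i, j)`, `i ≤ j`, are equal with opposite signs, and these pairs
exhaust the index set. It serves for the `X`-, the `B`- and the diagonal differential. -/
theorem sum_alternating_eq_zero {A : Type*} [AddCommGroup A] (a : ℕ → ℕ → A) (n : ℕ)
    (h : ∀ i j, i ≤ j → j < n → a (j + 1) i = a i j) :
    ∑ i ∈ Finset.range (n + 1), (-1 : ℤ) ^ i • ∑ j ∈ Finset.range n, (-1 : ℤ) ^ j • a i j = 0 := by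
  induction n with
  | zero => simp
  | succ n ih =>
    rw [Finset.sum_range_succ]
    simp only [Finset.sum_range_succ _ n, smul_add, Finset.sum_add_distrib]
    have ih := ih fun i j hij hj => h i j hij (by omega)
    rw [Finset.sum_range_succ, add_eq_zero_iff_eq_neg] at ih
    rw [ih]
    rw [h n n le_rfl (by omega)]
    have : ∀ j ∈ Finset.range n, (-1 : ℤ) ^ (n + 1) • (-1 : ℤ) ^ j • a (n + 1) j =
        - ((-1 : ℤ) ^ j • (-1 : ℤ) ^ n • a j n) := fun j hj => by
      have := Finset.mem_range.mp hj
      rw [h j n (by omega) (by omega), pow_succ, mul_neg_one, neg_smul, smul_comm]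
    rw [Finset.smul_sum (r := (-1 : ℤ) ^ (n + 1)), Finset.sum_congr rfl this,
      Finset.sum_neg_distrib, pow_succ (-1 : ℤ) n,
      mul_neg_one, neg_smul]
    abel

/-! ### The differentials square to zero. -/

theorem bX_bX (p q : ℕ) (x : M.obj p q) : M.bX (p + 1) q (M.bX p q x) = 0 := by
  rw [bX_apply _ _ _ (M.bX p q x), bX_apply]
  simp only [map_sum, map_zsmul]
  refine sum_alternating_eq_zero (fun i j => M.dX (p + 1) q i (M.dX p q j x)) (p + 2) ?_
  intro i j hij hj
  exact M.dX_dX _ _ _ _ _ hij (by omega)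

theorem bB_bB (p q : ℕ) (x : M.obj p q) : M.bB p (q + 1) (M.bB p q x) = 0 := by
  rw [bB_apply _ _ _ (M.bB p q x), bB_apply]
  simp only [map_sum, map_zsmul]
  refine sum_alternating_eq_zero (fun i j => M.dB p (q + 1) i (M.dB p q j x)) (q + 2) ?_
  intro i j hij hj
  exact M.dB_dB _ _ _ _ _ hij (by omega)

theorem bX_bB (p q : ℕ) (x : M.obj p q) :
    M.bX p (q + 1) (M.bB p q x) = M.bB (p + 1) q (M.bX p q x) := by
  simp only [bX_apply, bB_apply, map_sum, map_zsmul, Finset.smul_sum]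
  rw [Finset.sum_comm]
  refine Finset.sum_congr rfl fun j hj => Finset.sum_congr rfl fun i hi => ?_
  rw [Finset.mem_range] at hi hj
  rw [M.dX_dB _ _ _ _ _ (by omega) (by omega), smul_comm]

theorem totDiff_totDiff (f : M.Fam) : M.totDiff (M.totDiff f) = 0 := by
  funext p q
  rcases p with _ | _ | p <;> rcases q with _ | _ | q <;>
    simp [totDiff, bX_bX, bB_bB, bX_bB, pow_succ]

theorem totDiff_add (f g : M.Fam) : M.totDiff (f + g) = M.totDiff f + M.totDiff g := by
  funext p q
  simp only [totDiff, map_add, Pi.add_apply, smul_add]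
  abel

theorem totDiff_sub (f g : M.Fam) : M.totDiff (f - g) = M.totDiff f - M.totDiff g := by
  have := M.totDiff_add (f - g) g
  rw [sub_add_cancel] at this
  rw [this, add_sub_cancel_right]

theorem bD_bD (n : ℕ) (x : M.obj n n) : M.bD (n + 1) (M.bD n x) = 0 := by
  rw [bD_apply _ _ (M.bD n x), bD_apply]
  simp only [map_sum, map_zsmul]
  refine sum_alternating_eq_zero (fun i j => M.dB (n + 2) (n + 1) i (M.dX (n + 1) (n + 1) i
    (M.dB (n + 1) n j (M.dX n n j x)))) (n + 2) ?_
  intro i j hij hj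
  rw [M.dX_dB _ _ _ _ _ (by omega) (by omega), M.dB_dB _ _ _ _ _ hij (by omega),
    M.dX_dX _ _ _ _ _ hij (by omega), M.dX_dB _ _ _ _ _ (by omega) (by omega)]

theorem totDiff_congr {f g : M.Fam} {n : ℕ} (h : ∀ p q, p + q = n → f p q = g p q) (p q : ℕ)
    (hpq : p + q = n + 1) : M.totDiff f p q = M.totDiff g p q := by
  rcases p with _ | p <;> rcases q with _ | q <;> simp only [totDiff, raiseX_zero, raiseX_succ,
    raiseB_zero, raiseB_succ]
  · rw [h 0 q (by omega)]
  · rw [h p 0 (by omega)]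
  · rw [h p (q + 1) (by omega), h (p + 1) q (by omega)]

theorem aw_congr {f g : M.Fam} {n : ℕ} (h : ∀ p q, p + q = n → f p q = g p q) :
    M.aw n f = M.aw n g := by
  refine Finset.sum_congr rfl fun pq hpq => ?_
  have := Finset.HasAntidiagonal.mem_antidiagonal.mp hpq
  exact M.zeroB_pow_mul_lastX_pow_congr (h pq.1 pq.2 this) _ _ this.symm (by omega)

theorem aw_add (n : ℕ) (f g : M.Fam) : M.aw n (f + g) = M.aw n f + M.aw n g := by
  simp [aw, Finset.sum_add_distrib]

/-! ### Décalage -/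

/-- The décalage in both directions: forget the zeroth cofaces and codegeneracies. -/
def dec : BiCosimplicial.{w} where
  obj p q := M.obj (p + 1) (q + 1)
  dX p q i := M.dX (p + 1) (q + 1) (i + 1)
  dB p q i := M.dB (p + 1) (q + 1) (i + 1)
  sX p q i := M.sX (p + 1) (q + 1) (i + 1)
  sB p q i := M.sB (p + 1) (q + 1) (i + 1)
  dX_dX _ _ _ _ _ _ _ := M.dX_dX _ _ _ _ _ (by omega) (by omega)
  dB_dB _ _ _ _ _ _ _ := M.dB_dB _ _ _ _ _ (by omega) (by omega)
  sX_dX_lt _ _ _ _ _ _ _ := M.sX_dX_lt _ _ _ _ _ (by omega) (by omega)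
  sX_dX_self _ _ _ _ _ := M.sX_dX_self _ _ _ _ (by omega)
  sX_dX_succ _ _ _ _ _ := M.sX_dX_succ _ _ _ _ (by omega)
  sX_dX_gt _ _ _ _ _ _ _ := M.sX_dX_gt _ _ _ _ _ (by omega) (by omega)
  sB_dB_lt _ _ _ _ _ _ _ := M.sB_dB_lt _ _ _ _ _ (by omega) (by omega)
  sB_dB_self _ _ _ _ _ := M.sB_dB_self _ _ _ _ (by omega)
  sB_dB_succ _ _ _ _ _ := M.sB_dB_succ _ _ _ _ (by omega)
  sB_dB_gt _ _ _ _ _ _ _ := M.sB_dB_gt _ _ _ _ _ (by omega) (by omega)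
  dX_dB _ _ _ _ _ _ _ := M.dX_dB _ _ _ _ _ (by omega) (by omega)
  sX_dB _ _ _ _ _ _ _ := M.sX_dB _ _ _ _ _ (by omega) (by omega)
  sB_dX _ _ _ _ _ _ _ := M.sB_dX _ _ _ _ _ (by omega) (by omega)

/-- Extra codegeneracies, of index `-1`, in both directions. -/
structure ExtraDegeneracy where
  eX : ∀ p q, M.obj (p + 1) q →+ M.obj p q
  eB : ∀ p q, M.obj p (q + 1) →+ M.obj p q
  eX_zero : ∀ p q x, eX p q (M.dX p q 0 x) = x
  eX_succ : ∀ p q i x, i ≤ p + 1 →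
    eX (p + 1) q (M.dX (p + 1) q (i + 1) x) = M.dX p q i (eX p q x)
  eB_zero : ∀ p q x, eB p q (M.dB p q 0 x) = x
  eB_succ : ∀ p q i x, i ≤ q + 1 →
    eB p (q + 1) (M.dB p (q + 1) (i + 1) x) = M.dB p q i (eB p q x)
  eX_dB : ∀ p q j x, j ≤ q + 1 → eX p (q + 1) (M.dB (p + 1) q j x) = M.dB p q j (eX p q x)
  eB_dX : ∀ p q i x, i ≤ p + 1 → eB (p + 1) q (M.dX p (q + 1) i x) = M.dX p q i (eB p q x)

/-- The forgotten zeroth codegeneracies are extra codegeneracies of the décalage. -/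
def decExtra : M.dec.ExtraDegeneracy where
  eX p q := M.sX (p + 1) (q + 1) 0
  eB p q := M.sB (p + 1) (q + 1) 0
  eX_zero _ _ _ := M.sX_dX_succ _ _ _ _ (by omega)
  eX_succ _ _ _ _ _ := M.sX_dX_gt _ _ _ _ _ (by omega) (by omega)
  eB_zero _ _ _ := M.sB_dB_succ _ _ _ _ (by omega)
  eB_succ _ _ _ _ _ := M.sB_dB_gt _ _ _ _ _ (by omega) (by omega)
  eX_dB _ _ _ _ _ := M.sX_dB _ _ _ _ _ (by omega) (by omega)
  eB_dX _ _ _ _ _ := M.sB_dX _ _ _ _ _ (by omega) (by omega)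

namespace ExtraDegeneracy

variable {M}

/-- The composite of the two extra codegeneracies cancels the zeroth diagonal coface and lowers the
index of every other one. It is therefore a contracting homotopy, and applied to the cocycle it
gives the primitive. -/
theorem diag_exact (e : M.ExtraDegeneracy) (n : ℕ) (g : M.obj (n + 1) (n + 1)) (hg : M.bD (n + 1) g = 0) :
    ∃ h, M.bD n h = g := by
  refine ⟨e.eX n n (e.eB (n + 1) n g), ?_⟩
  have := congrArg (fun z => e.eX (n + 1) (n + 1) (e.eB (n + 2) (n + 1) z)) hg
  simp only [map_zero, bD_apply, map_sum, map_zsmul] at this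
  rw [Finset.sum_range_succ', e.eB_zero, e.eX_zero, Finset.sum_congr rfl fun i hi => by
    rw [e.eB_succ _ _ _ _ (by rw [Finset.mem_range] at hi; omega),
      e.eX_dB _ _ _ _ (by rw [Finset.mem_range] at hi; omega),
      e.eB_dX _ _ _ _ (by rw [Finset.mem_range] at hi; omega),
      e.eX_succ _ _ _ _ (by rw [Finset.mem_range] at hi; omega)]] at this
  rw [bD_apply]
  simp only [pow_succ, mul_neg_one, neg_smul, Finset.sum_neg_distrib, pow_zero, one_smul,
    neg_add_eq_zero] at this
  exact this

/-- The zeroth coface is cancelled and the remaining ones shift by one, which changes their sign. -/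
theorem eX_bX (e : M.ExtraDegeneracy) (p q : ℕ) (x : M.obj (p + 1) q) :
    e.eX (p + 1) q (M.bX (p + 1) q x) = x - M.bX p q (e.eX p q x) := by
  rw [bX_apply, bX_apply, map_sum, Finset.sum_range_succ', pow_zero, one_smul, e.eX_zero,
    sub_eq_neg_add, ← Finset.sum_neg_distrib]
  congr 1
  refine Finset.sum_congr rfl fun i hi => ?_
  have := Finset.mem_range.mp hi
  rw [map_zsmul, pow_succ, mul_neg_one, neg_smul, e.eX_succ _ _ _ _ (by omega)]

theorem eB_bB (e : M.ExtraDegeneracy) (p q : ℕ) (x : M.obj p (q + 1)) :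
    e.eB p (q + 1) (M.bB p (q + 1) x) = x - M.bB p q (e.eB p q x) := by
  rw [bB_apply, bB_apply, map_sum, Finset.sum_range_succ', pow_zero, one_smul, e.eB_zero,
    sub_eq_neg_add, ← Finset.sum_neg_distrib]
  congr 1
  refine Finset.sum_congr rfl fun i hi => ?_
  have := Finset.mem_range.mp hi
  rw [map_zsmul, pow_succ, mul_neg_one, neg_smul, e.eB_succ _ _ _ _ (by omega)]

theorem eX_bB (e : M.ExtraDegeneracy) (p q : ℕ) (x : M.obj (p + 1) q) :
    e.eX p (q + 1) (M.bB (p + 1) q x) = M.bB p q (e.eX p q x) := by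
  rw [bB_apply, bB_apply, map_sum]
  refine Finset.sum_congr rfl fun i hi => ?_
  have := Finset.mem_range.mp hi
  rw [map_zsmul, e.eX_dB _ _ _ _ (by omega)]

theorem eB_bX (e : M.ExtraDegeneracy) (p q : ℕ) (x : M.obj p (q + 1)) :
    e.eB (p + 1) q (M.bX p (q + 1) x) = M.bX p q (e.eB p q x) := by
  rw [bX_apply, bX_apply, map_sum]
  refine Finset.sum_congr rfl fun i hi => ?_
  have := Finset.mem_range.mp hi
  rw [map_zsmul, e.eB_dX _ _ _ _ (by omega)]

/-- The family obtained by applying the extra codegeneracy of the first direction. -/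
def famX (e : M.ExtraDegeneracy) (f : M.Fam) : M.Fam := fun p q => e.eX p q (f (p + 1) q)

/-- The extra codegeneracy of the second direction, applied to the column `p = 0`. -/
def famB (e : M.ExtraDegeneracy) (f : M.Fam) : M.Fam
  | 0, q => e.eB 0 q (f 0 (q + 1))
  | _ + 1, _ => 0

/-- The `X`-contraction anticommutes with the signed `B`-differential, so subtracting `D` of its
value on `f` removes all components with `p ≥ 1`. What remains on the column `p = 0` is a cocycle in
both directions and is contracted by the extra codegeneracy of `B`. -/
theorem tot_exact (e : M.ExtraDegeneracy) (n : ℕ) (f : M.Fam)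
    (hf : ∀ p q, p + q = n + 2 → M.totDiff f p q = 0) :
    ∃ g, ∀ p q, p + q = n + 1 → M.totDiff g p q = f p q := by
  have h1 : ∀ p q, p + 1 + q = n + 1 → M.totDiff (e.famX f) (p + 1) q = f (p + 1) q := by
    intro p q hpq
    have hz := congrArg (e.eX (p + 1) q) (hf (p + 2) q (by omega))
    simp only [totDiff, raiseX_succ] at hz ⊢
    have e2 : e.eX (p + 1) q (M.raiseB M.bB f (p + 2) q) =
        M.raiseB M.bB (e.famX f) (p + 1) q := by
      rcases q with _ | q
      · rw [raiseB_zero, raiseB_zero, map_zero]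
      · exact e.eX_bB (p + 1) q _
    rw [map_zero, map_add, e.eX_bX, map_zsmul, e2, pow_succ _ (p + 1), mul_neg_one, neg_smul,
      ← sub_eq_add_neg, sub_sub, sub_eq_zero] at hz
    exact hz.symm
  -- In total degree `n + 1` this remainder is concentrated in `p = 0`.
  let w : M.Fam := f + -M.totDiff (e.famX f)
  have hw1 : ∀ p q, p + 1 + q = n + 1 → w (p + 1) q = 0 := fun p q hpq => by
    simp [w, h1 p q hpq]
  have hDw : ∀ p q, p + q = n + 2 → M.totDiff w p q = 0 := fun p q hpq => by
    have hn : M.totDiff (-M.totDiff (e.famX f)) = 0 := by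
      have := M.totDiff_add (M.totDiff (e.famX f)) (-M.totDiff (e.famX f))
      rw [totDiff_totDiff, add_neg_cancel, zero_add] at this
      rw [← this]
      funext p q
      simp [totDiff]
    rw [totDiff_add, hn, add_zero, hf p q hpq]
  have hB : M.bB 0 (n + 1) (w 0 (n + 1)) = 0 := by
    have := hDw 0 (n + 2) (by omega)
    simpa [totDiff] using this
  -- This makes the `B`-primitive harmless: since `eB` commutes with `bX`, the differential of that
  -- primitive has no component in the column `p = 1`.
  have hX : M.bX 0 (n + 1) (w 0 (n + 1)) = 0 := by
    have := hDw 1 (n + 1) (by omega)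
    simpa [totDiff, hw1 0 n (by omega)] using this
  refine ⟨e.famX f + e.famB w, fun p q hpq => ?_⟩
  have key : M.totDiff (e.famB w) p q = w p q := by
    rcases p with _ | _ | p
    · obtain rfl : q = n + 1 := by omega
      have := e.eB_bB 0 n (w 0 (n + 1))
      rw [hB, map_zero, eq_comm, sub_eq_zero] at this
      simp only [totDiff, raiseX_zero, raiseB_succ, zero_add, pow_zero, one_smul]
      exact this.symm
    · obtain rfl : q = n := by omega
      have := e.eB_bX 0 q (w 0 (q + 1))
      rw [hX, map_zero] at this
      have h0 : M.raiseB M.bB (e.famB w) 1 q = 0 := by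
        rcases q with _ | q <;> simp [famB]
      simp only [totDiff, raiseX_succ, h0, smul_zero, add_zero, zero_add]
      rw [hw1 0 q (by omega)]
      exact this.symm
    · rw [hw1 (p + 1) q (by omega)]
      have h0 : M.raiseB M.bB (e.famB w) (p + 2) q = 0 := by
        rcases q with _ | q <;> simp [famB]
      simp [totDiff, h0, famB]
  rw [totDiff_add, Pi.add_apply, Pi.add_apply, key]
  simp [w]

end ExtraDegeneracy

/-! ### Morphisms -/

/-- Maps commuting with the cofaces. -/
structure Hom (M N : BiCosimplicial.{w}) where
  app : ∀ p q, M.obj p q →+ N.obj p q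
  app_dX : ∀ p q i x, i ≤ p + 1 → app (p + 1) q (M.dX p q i x) = N.dX p q i (app p q x)
  app_dB : ∀ p q i x, i ≤ q + 1 → app p (q + 1) (M.dB p q i x) = N.dB p q i (app p q x)

namespace Hom

variable {M N : BiCosimplicial.{w}}

/-- The induced map on families. -/
def fam (φ : Hom M N) (f : M.Fam) : N.Fam := fun p q => φ.app p q (f p q)

theorem app_bX (φ : Hom M N) (p q : ℕ) (x : M.obj p q) :
    φ.app (p + 1) q (M.bX p q x) = N.bX p q (φ.app p q x) := by
  rw [bX_apply, bX_apply, map_sum]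
  refine Finset.sum_congr rfl fun i hi => ?_
  rw [map_zsmul, φ.app_dX _ _ _ _ (by rw [Finset.mem_range] at hi; omega)]

theorem app_bB (φ : Hom M N) (p q : ℕ) (x : M.obj p q) :
    φ.app p (q + 1) (M.bB p q x) = N.bB p q (φ.app p q x) := by
  rw [bB_apply, bB_apply, map_sum]
  refine Finset.sum_congr rfl fun i hi => ?_
  rw [map_zsmul, φ.app_dB _ _ _ _ (by rw [Finset.mem_range] at hi; omega)]

theorem app_bD (φ : Hom M N) (n : ℕ) (x : M.obj n n) :
    φ.app (n + 1) (n + 1) (M.bD n x) = N.bD n (φ.app n n x) := by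
  rw [bD_apply, bD_apply, map_sum]
  refine Finset.sum_congr rfl fun i hi => ?_
  rw [map_zsmul, φ.app_dB _ _ _ _ (by rw [Finset.mem_range] at hi; omega),
    φ.app_dX _ _ _ _ (by rw [Finset.mem_range] at hi; omega)]

theorem app_totDiff (φ : Hom M N) (f : M.Fam) (p q : ℕ) :
    φ.app p q (M.totDiff f p q) = N.totDiff (φ.fam f) p q := by
  rcases p with _ | p <;> rcases q with _ | q <;>
    simp [totDiff, fam, φ.app_bX, φ.app_bB]

theorem fam_lastX (φ : Hom M N) (f : M.Fam) : φ.fam (M.lastX f) = N.lastX (φ.fam f) := by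
  funext p q
  rcases p with _ | p <;> simp [fam, lastX, φ.app_dX]

theorem fam_zeroB (φ : Hom M N) (f : M.Fam) : φ.fam (M.zeroB f) = N.zeroB (φ.fam f) := by
  funext p q
  rcases q with _ | q <;> simp [fam, zeroB, φ.app_dB]

theorem fam_pow (φ : Hom M N) (a b : ℕ) (f : M.Fam) :
    φ.fam ((M.zeroB ^ a * M.lastX ^ b) f) = (N.zeroB ^ a * N.lastX ^ b) (φ.fam f) := by
  have h : φ.fam ((M.lastX ^ b) f) = (N.lastX ^ b) (φ.fam f) := by
    induction b with
    | zero => rfl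
    | succ b ih => rw [pow_succ', pow_succ', end_mul_apply, fam_lastX, ih, end_mul_apply]
  induction a with
  | zero => simpa using h
  | succ a ih =>
    rw [pow_succ', pow_succ', mul_assoc, mul_assoc, end_mul_apply, fam_zeroB, ih]
    rfl

theorem app_aw (φ : Hom M N) (n : ℕ) (f : M.Fam) : φ.app n n (M.aw n f) = N.aw n (φ.fam f) := by
  rw [aw, aw, map_sum]
  exact Finset.sum_congr rfl fun pq _ => congrFun (congrFun (φ.fam_pow pq.1 pq.2 f) n) n

end Hom

/-! ### The embedding of `M` into its décalage, and the quotient. -/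

/-- The zeroth cofaces embed `M` into its décalage. -/
def toDec : Hom M M.dec where
  app p q := (M.dB (p + 1) q 0).comp (M.dX p q 0)
  app_dX p q i x hi := by
    change M.dB (p + 2) q 0 (M.dX (p + 1) q 0 (M.dX p q i x)) =
      M.dX (p + 1) (q + 1) (i + 1) (M.dB (p + 1) q 0 (M.dX p q 0 x))
    rw [M.dX_dB _ _ _ _ _ (by omega) (by omega), M.dX_dX _ _ _ _ _ (by omega) (by omega)]
  app_dB p q i x hi := by
    change M.dB (p + 1) (q + 1) 0 (M.dX p (q + 1) 0 (M.dB p q i x)) =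
      M.dB (p + 1) (q + 1) (i + 1) (M.dB (p + 1) q 0 (M.dX p q 0 x))
    rw [M.dX_dB _ _ _ _ _ (by omega) (by omega), M.dB_dB _ _ _ _ _ (by omega) (by omega)]

/-- The codegeneracies must descend to the quotient as well, since they become the contractions of
its décalage at the next stage of the induction. -/
theorem toDec_sX (p q i : ℕ) (x : M.obj (p + 1) q) (hi : i ≤ p) :
    M.dec.sX p q i (M.toDec.app (p + 1) q x) = M.toDec.app p q (M.sX p q i x) := by
  change M.sX (p + 1) (q + 1) (i + 1) (M.dB (p + 2) q 0 (M.dX (p + 1) q 0 x)) =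
    M.dB (p + 1) q 0 (M.dX p q 0 (M.sX p q i x))
  rw [M.sX_dB _ _ _ _ _ (by omega) (by omega), M.sX_dX_lt _ _ _ _ _ (by omega) (by omega)]

theorem toDec_sB (p q i : ℕ) (x : M.obj p (q + 1)) (hi : i ≤ q) :
    M.dec.sB p q i (M.toDec.app p (q + 1) x) = M.toDec.app p q (M.sB p q i x) := by
  change M.sB (p + 1) (q + 1) (i + 1) (M.dB (p + 1) (q + 1) 0 (M.dX p (q + 1) 0 x)) =
    M.dB (p + 1) q 0 (M.dX p q 0 (M.sB p q i x))
  rw [M.sB_dB_lt _ _ _ _ _ (by omega) (by omega), M.sB_dX _ _ _ _ _ (by omega) (by omega)]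

theorem toDec_injective (p q : ℕ) : Function.Injective (M.toDec.app p q) := by
  refine Function.LeftInverse.injective (g := fun x => M.sX p q 0 (M.sB (p + 1) q 0 x)) fun x => ?_
  change M.sX p q 0 (M.sB (p + 1) q 0 (M.dB (p + 1) q 0 (M.dX p q 0 x))) = x
  rw [M.sB_dB_self _ _ _ _ (by omega), M.sX_dX_self _ _ _ _ (by omega)]

/-- The map induced on quotients, or zero if there is none. -/
def quotMap {A B : Type*} [AddCommGroup A] [AddCommGroup B] (S : AddSubgroup A) (T : AddSubgroup B)
    (f : A →+ B) : A ⧸ S →+ B ⧸ T :=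
  open Classical in if h : S ≤ T.comap f then QuotientAddGroup.map S T f h else 0

theorem quotMap_mk {A B : Type*} [AddCommGroup A] [AddCommGroup B] {S : AddSubgroup A}
    {T : AddSubgroup B} {f : A →+ B} (h : S ≤ T.comap f) (a : A) :
    quotMap S T f (a : A ⧸ S) = (f a : B ⧸ T) := by
  simp [quotMap, h]

/-- The image of `M` in its décalage. -/
abbrev decRange (p q : ℕ) : AddSubgroup (M.dec.obj p q) := (M.toDec.app p q).range

theorem decRange_dX (p q i : ℕ) (hi : i ≤ p + 1) :
    M.decRange p q ≤ (M.decRange (p + 1) q).comap (M.dec.dX p q i) := by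
  rintro _ ⟨x, rfl⟩
  exact ⟨M.dX p q i x, M.toDec.app_dX _ _ _ _ hi⟩

theorem decRange_dB (p q i : ℕ) (hi : i ≤ q + 1) :
    M.decRange p q ≤ (M.decRange p (q + 1)).comap (M.dec.dB p q i) := by
  rintro _ ⟨x, rfl⟩
  exact ⟨M.dB p q i x, M.toDec.app_dB _ _ _ _ hi⟩

theorem decRange_sX (p q i : ℕ) (hi : i ≤ p) :
    M.decRange (p + 1) q ≤ (M.decRange p q).comap (M.dec.sX p q i) := by
  rintro _ ⟨x, rfl⟩
  exact ⟨M.sX p q i x, (M.toDec_sX _ _ _ _ hi).symm⟩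

theorem decRange_sB (p q i : ℕ) (hi : i ≤ q) :
    M.decRange p (q + 1) ≤ (M.decRange p q).comap (M.dec.sB p q i) := by
  rintro _ ⟨x, rfl⟩
  exact ⟨M.sB p q i x, (M.toDec_sB _ _ _ _ hi).symm⟩

/-- The quotient of the décalage of `M` by `M`. -/
def decQuot : BiCosimplicial.{w} where
  obj p q := M.dec.obj p q ⧸ M.decRange p q
  -- Out-of-range operators are arbitrary and need not preserve the image of `M`. The zero default
  -- of `quotMap` makes the definition total, and only in-range indices enter the identities.
  dX p q i := quotMap _ _ (M.dec.dX p q i)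
  dB p q i := quotMap _ _ (M.dec.dB p q i)
  sX p q i := quotMap _ _ (M.dec.sX p q i)
  sB p q i := quotMap _ _ (M.dec.sB p q i)
  dX_dX p q i j x h h' := by
    induction x using QuotientAddGroup.induction_on with | H x => ?_
    rw [quotMap_mk (M.decRange_dX _ _ _ (by omega)), quotMap_mk (M.decRange_dX _ _ _ (by omega)),
      quotMap_mk (M.decRange_dX _ _ _ (by omega)), quotMap_mk (M.decRange_dX _ _ _ (by omega)),
      M.dec.dX_dX _ _ _ _ _ h h']
  dB_dB p q i j x h h' := by
    induction x using QuotientAddGroup.induction_on with | H x => ?_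
    rw [quotMap_mk (M.decRange_dB _ _ _ (by omega)), quotMap_mk (M.decRange_dB _ _ _ (by omega)),
      quotMap_mk (M.decRange_dB _ _ _ (by omega)), quotMap_mk (M.decRange_dB _ _ _ (by omega)),
      M.dec.dB_dB _ _ _ _ _ h h']
  sX_dX_lt p q i j x h h' := by
    induction x using QuotientAddGroup.induction_on with | H x => ?_
    rw [quotMap_mk (M.decRange_dX _ _ _ (by omega)), quotMap_mk (M.decRange_sX _ _ _ (by omega)),
      quotMap_mk (M.decRange_sX _ _ _ (by omega)), quotMap_mk (M.decRange_dX _ _ _ (by omega)),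
      M.dec.sX_dX_lt _ _ _ _ _ h h']
  sX_dX_self p q j x h := by
    induction x using QuotientAddGroup.induction_on with | H x => ?_
    rw [quotMap_mk (M.decRange_dX _ _ _ (by omega)), quotMap_mk (M.decRange_sX _ _ _ (by omega)),
      M.dec.sX_dX_self _ _ _ _ h]
  sX_dX_succ p q j x h := by
    induction x using QuotientAddGroup.induction_on with | H x => ?_
    rw [quotMap_mk (M.decRange_dX _ _ _ (by omega)), quotMap_mk (M.decRange_sX _ _ _ (by omega)),
      M.dec.sX_dX_succ _ _ _ _ h]
  sX_dX_gt p q i j x h h' := by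
    induction x using QuotientAddGroup.induction_on with | H x => ?_
    rw [quotMap_mk (M.decRange_dX _ _ _ (by omega)), quotMap_mk (M.decRange_sX _ _ _ (by omega)),
      quotMap_mk (M.decRange_sX _ _ _ (by omega)), quotMap_mk (M.decRange_dX _ _ _ (by omega)),
      M.dec.sX_dX_gt _ _ _ _ _ h h']
  sB_dB_lt p q i j x h h' := by
    induction x using QuotientAddGroup.induction_on with | H x => ?_
    rw [quotMap_mk (M.decRange_dB _ _ _ (by omega)), quotMap_mk (M.decRange_sB _ _ _ (by omega)),
      quotMap_mk (M.decRange_sB _ _ _ (by omega)), quotMap_mk (M.decRange_dB _ _ _ (by omega)),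
      M.dec.sB_dB_lt _ _ _ _ _ h h']
  sB_dB_self p q j x h := by
    induction x using QuotientAddGroup.induction_on with | H x => ?_
    rw [quotMap_mk (M.decRange_dB _ _ _ (by omega)), quotMap_mk (M.decRange_sB _ _ _ (by omega)),
      M.dec.sB_dB_self _ _ _ _ h]
  sB_dB_succ p q j x h := by
    induction x using QuotientAddGroup.induction_on with | H x => ?_
    rw [quotMap_mk (M.decRange_dB _ _ _ (by omega)), quotMap_mk (M.decRange_sB _ _ _ (by omega)),
      M.dec.sB_dB_succ _ _ _ _ h]
  sB_dB_gt p q i j x h h' := by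
    induction x using QuotientAddGroup.induction_on with | H x => ?_
    rw [quotMap_mk (M.decRange_dB _ _ _ (by omega)), quotMap_mk (M.decRange_sB _ _ _ (by omega)),
      quotMap_mk (M.decRange_sB _ _ _ (by omega)), quotMap_mk (M.decRange_dB _ _ _ (by omega)),
      M.dec.sB_dB_gt _ _ _ _ _ h h']
  dX_dB p q i j x h h' := by
    induction x using QuotientAddGroup.induction_on with | H x => ?_
    rw [quotMap_mk (M.decRange_dB _ _ _ (by omega)), quotMap_mk (M.decRange_dX _ _ _ (by omega)),
      quotMap_mk (M.decRange_dX _ _ _ (by omega)), quotMap_mk (M.decRange_dB _ _ _ (by omega)),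
      M.dec.dX_dB _ _ _ _ _ h h']
  sX_dB p q i j x h h' := by
    induction x using QuotientAddGroup.induction_on with | H x => ?_
    rw [quotMap_mk (M.decRange_dB _ _ _ (by omega)), quotMap_mk (M.decRange_sX _ _ _ (by omega)),
      quotMap_mk (M.decRange_sX _ _ _ (by omega)), quotMap_mk (M.decRange_dB _ _ _ (by omega)),
      M.dec.sX_dB _ _ _ _ _ h h']
  sB_dX p q i j x h h' := by
    induction x using QuotientAddGroup.induction_on with | H x => ?_
    rw [quotMap_mk (M.decRange_dX _ _ _ (by omega)), quotMap_mk (M.decRange_sB _ _ _ (by omega)),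
      quotMap_mk (M.decRange_sB _ _ _ (by omega)), quotMap_mk (M.decRange_dX _ _ _ (by omega)),
      M.dec.sB_dX _ _ _ _ _ h h']

/-- The projection of the décalage onto its quotient by `M`. -/
def toQuot : Hom M.dec M.decQuot where
  app p q := QuotientAddGroup.mk' (M.decRange p q)
  app_dX p q i x hi := (quotMap_mk (M.decRange_dX p q i hi) x).symm
  app_dB p q i x hi := (quotMap_mk (M.decRange_dB p q i hi) x).symm

theorem toQuot_surjective (p q : ℕ) : Function.Surjective (M.toQuot.app p q) :=
  QuotientAddGroup.mk'_surjective _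

theorem toQuot_eq_zero {p q : ℕ} {x : M.dec.obj p q} (h : M.toQuot.app p q x = 0) :
    ∃ y, M.toDec.app p q y = x := (QuotientAddGroup.eq_zero_iff x).mp h

theorem toQuot_toDec (p q : ℕ) (x : M.obj p q) : M.toQuot.app p q (M.toDec.app p q x) = 0 :=
  (QuotientAddGroup.eq_zero_iff _).mpr ⟨x, rfl⟩

/-! ### The Eilenberg–Zilber theorem -/

/-- Coboundaries of the diagonal. -/
def IsDiagBdry : ∀ n, M.obj n n → Prop
  | 0, g => g = 0
  | n + 1, g => ∃ h, M.bD n h = g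

/-- Families whose component of total degree `n` is a total coboundary. -/
def IsTotBdry : ℕ → M.Fam → Prop
  | 0, f => f 0 0 = 0
  | n + 1, f => ∃ e, ∀ p q, p + q = n + 1 → M.totDiff e p q = f p q

/-- Families whose component of total degree `n` is a total cocycle. -/
def IsTotCocycle (n : ℕ) (f : M.Fam) : Prop := ∀ p q, p + q = n + 1 → M.totDiff f p q = 0

/-- The hypothesis is `dᴮ₀ dˣ₀ f = dᴮ₁ dˣ₁ f`. A zeroth codegeneracy in one direction cancels both
cofaces of that direction and leaves `d₀ f = d₁ f` in the other. -/
theorem isTotCocycle_zero {f : M.Fam} (h : M.bD 0 (f 0 0) = 0) : M.IsTotCocycle 0 f := by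
  have h' : M.dB 1 0 0 (M.dX 0 0 0 (f 0 0)) = M.dB 1 0 1 (M.dX 0 0 1 (f 0 0)) := by
    rw [bD_apply] at h
    simpa [Finset.sum_range_succ, ← sub_eq_add_neg, sub_eq_zero] using h
  have hX : M.bX 0 0 (f 0 0) = 0 := by
    have := congrArg (M.sB 1 0 0) h'
    rw [M.sB_dB_self _ _ _ _ le_rfl, M.sB_dB_succ _ _ _ _ le_rfl] at this
    simp [bX_apply, Finset.sum_range_succ, this]
  have hB : M.bB 0 0 (f 0 0) = 0 := by
    have := congrArg (M.sX 0 1 0) h'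
    rw [M.sX_dB _ _ _ _ _ (by omega) (by omega), M.sX_dB _ _ _ _ _ (by omega) (by omega),
      M.sX_dX_self _ _ _ _ le_rfl, M.sX_dX_succ _ _ _ _ le_rfl] at this
    simp [bB_apply, Finset.sum_range_succ, this]
  intro p q hpq
  rcases p with _ | p
  · obtain rfl : q = 1 := by omega
    simp [totDiff, hB]
  · obtain ⟨rfl, rfl⟩ : p = 0 ∧ q = 0 := by omega
    simp [totDiff, hX]

theorem aw_zero (f : M.Fam) : M.aw 0 f = f 0 0 := by simp [aw]

/-- The Alexander–Whitney map is surjective and injective on cohomology. -/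
theorem aw_bijective (n : ℕ) : ∀ M : BiCosimplicial.{w},
    (∀ g, M.bD n g = 0 → ∃ f, M.IsTotCocycle n f ∧ M.IsDiagBdry n (g - M.aw n f)) ∧
    (∀ f, M.IsTotCocycle n f → M.IsDiagBdry n (M.aw n f) → M.IsTotBdry n f) := by
  induction n with
  | zero =>
    intro M
    constructor
    · intro g hg
      refine ⟨fun p q => if h : p = 0 ∧ q = 0 then h.1 ▸ h.2 ▸ g else 0, ?_, ?_⟩
      · exact M.isTotCocycle_zero (by simpa using hg)
      · simp [IsDiagBdry, aw_zero]
    · intro f _ h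
      rwa [IsDiagBdry, aw_zero] at h
  | succ n ih =>
    intro M
    constructor
    · intro g hg
      -- The connecting map read backwards: `g` bounds in the décalage, and its primitive `h` is a
      -- cocycle modulo `M`, one degree lower.
      obtain ⟨h, hh⟩ := M.decExtra.diag_exact n (M.toDec.app _ _ g)
        (by rw [← Hom.app_bD, hg, map_zero])
      obtain ⟨f', hf', hb⟩ := (ih M.decQuot).1 (M.toQuot.app _ _ h)
        (by rw [← Hom.app_bD, hh, toQuot_toDec])
      choose f hf using fun p q => M.toQuot_surjective p q (f' p q)
      obtain rfl : M.toQuot.fam f = f' := by funext p q; exact hf p q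
      -- As `f` is a cocycle modulo `M`, its total differential lies in `M`. This `c` is the
      -- required total cocycle; its components outside total degree `n + 1` are irrelevant and set
      -- to `0`.
      have hc : ∀ p q, ∃ y, p + q = n + 1 → M.toDec.app p q y = M.dec.totDiff f p q := by
        intro p q
        by_cases hpq : p + q = n + 1
        · obtain ⟨y, hy⟩ := M.toQuot_eq_zero
            ((M.toQuot.app_totDiff f p q).trans (hf' p q hpq))
          exact ⟨y, fun _ => hy⟩
        · exact ⟨0, fun h => absurd h hpq⟩
      choose c hc using hc
      -- Modulo `M`, `h` and `aw f` differ by a coboundary. Lifting its primitive gives a genuine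
      -- cocycle `u` of the décalage. In degree `0` the only coboundary is `0`, so `u = 0`.
      have hd : ∃ u : M.dec.obj n n, M.dec.bD n u = 0 ∧
          M.toQuot.app n n (h - M.dec.aw n f) = M.toQuot.app n n u := by
        rcases n with _ | n
        · exact ⟨0, map_zero _, by rw [map_sub, Hom.app_aw, map_zero]; exact hb⟩
        · obtain ⟨v, hv⟩ := hb
          obtain ⟨v, rfl⟩ := M.toQuot_surjective _ _ v
          refine ⟨M.dec.bD n v, ?_, by rw [Hom.app_bD, hv, map_sub, Hom.app_aw]⟩
          exact M.dec.bD_bD n v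
      obtain ⟨u, hu, hu'⟩ := hd
      obtain ⟨m, hm⟩ := M.toQuot_eq_zero ((map_sub _ _ _).trans (sub_eq_zero.mpr hu'))
      refine ⟨c, ?_, m, ?_⟩
      · intro p q hpq
        refine M.toDec_injective p q ?_
        rw [Hom.app_totDiff, map_zero, M.dec.totDiff_congr (n := n + 1)
          (f := M.toDec.fam c) (g := M.dec.totDiff f) hc p q hpq, totDiff_totDiff]
        rfl
      · refine M.toDec_injective _ _ ?_
        rw [Hom.app_bD, hm, map_sub, map_sub, map_sub, hu, hh, bD_aw, Hom.app_aw, sub_zero,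
          M.dec.aw_congr (f := M.toDec.fam c) (g := M.dec.totDiff f) hc]
    · intro f hf ⟨h, hh⟩
      obtain ⟨e, he⟩ := M.decExtra.tot_exact n (M.toDec.fam f) fun p q hpq => by
        rw [← Hom.app_totDiff, hf p q hpq, map_zero]
      -- Both `aw e` and `h` are primitives of the Alexander–Whitney image of `f` in the décalage.
      have haw : M.dec.bD n (M.dec.aw n e - M.toDec.app n n h) = 0 := by
        rw [map_sub, bD_aw, ← Hom.app_bD, hh, Hom.app_aw,
          M.dec.aw_congr (f := M.dec.totDiff e) (g := M.toDec.fam f) he, sub_self]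
      have hq : M.decQuot.IsTotCocycle n (M.toQuot.fam e) := fun p q hpq => by
        rw [← Hom.app_totDiff, he p q hpq]; exact M.toQuot_toDec _ _ _
      have hq' : M.toQuot.app n n (M.dec.aw n e - M.toDec.app n n h) =
          M.decQuot.aw n (M.toQuot.fam e) := by
        rw [map_sub, toQuot_toDec, sub_zero, Hom.app_aw]
      rcases n with _ | n
      -- The décalage is not exact in degree `0`, but none is needed: the degree `0` diagonal
      -- cocycle `e - h` is a total cocycle, so `h` itself is a primitive of `f`.
      · let H : M.Fam := fun p q => if h' : p = 0 ∧ q = 0 then h'.1 ▸ h'.2 ▸ h else 0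
        refine ⟨H, fun p q hpq => M.toDec_injective p q ?_⟩
        have := M.dec.isTotCocycle_zero (f := e - M.toDec.fam H)
          (by simpa [H, aw_zero, Hom.fam] using haw) p q hpq
        rw [totDiff_sub, Pi.sub_apply, Pi.sub_apply, sub_eq_zero] at this
        rw [Hom.app_totDiff, ← this, he p q hpq]
        rfl
      -- Modulo `M`, `h` disappears and `aw e` becomes a diagonal coboundary. The injectivity
      -- already known for the quotient then makes `e` a total coboundary modulo `M`.
      · obtain ⟨u, hu⟩ := M.decExtra.diag_exact n _ haw
        obtain ⟨v, hv⟩ := (ih M.decQuot).2 _ hq ⟨M.toQuot.app _ _ u, by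
          rw [← Hom.app_bD, hu, hq']⟩
        choose v' hv' using fun p q => M.toQuot_surjective p q (v p q)
        obtain rfl : M.toQuot.fam v' = v := by funext p q; exact hv' p q
        -- Changing `e` by `D v'` leaves `D e` unchanged and moves `e` into `M`.
        have hc : ∀ p q, ∃ y, p + q = n + 1 →
            M.toDec.app p q y = (e - M.dec.totDiff v') p q := by
          intro p q
          by_cases hpq : p + q = n + 1
          · obtain ⟨y, hy⟩ := M.toQuot_eq_zero (x := (e - M.dec.totDiff v') p q) (by
              rw [Pi.sub_apply, Pi.sub_apply, map_sub, Hom.app_totDiff, hv p q hpq]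
              exact sub_self _)
            exact ⟨y, fun _ => hy⟩
          · exact ⟨0, fun h => absurd h hpq⟩
        choose c hc using hc
        refine ⟨c, fun p q hpq => M.toDec_injective p q ?_⟩
        rw [Hom.app_totDiff, M.dec.totDiff_congr (f := M.toDec.fam c) hc p q hpq, totDiff_sub,
          totDiff_totDiff, sub_zero, he p q hpq]
        rfl

end BiCosimplicial
end
end BialgebraCohomology

namespace BialgebraCohomology
noncomputable section
universe u v w

/-! ### Tensor powers: pure tensors, `cons` and `snoc` -/

section TensorTools

variable {k : Type u} [Field k] {M : Type v} [AddCommMonoid M] [Module k M]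

/-- `cons` as a bilinear map. -/
def consL (n : ℕ) : M →ₗ[k] ⨂[k]^n M →ₗ[k] ⨂[k]^(n + 1) M := TensorProduct.curry (cons k M n)

/-- `(m¹ ⊗ ⋯ ⊗ mⁿ, m) ↦ m¹ ⊗ ⋯ ⊗ mⁿ ⊗ m`. -/
def snocL (n : ℕ) : ⨂[k]^n M →ₗ[k] M →ₗ[k] ⨂[k]^(n + 1) M :=
  PiTensorProduct.lift
    (PiTensorProduct.tprod k : MultilinearMap k (fun _ : Fin (n + 1) => M) _).curryRight

/-- The pure tensor of the first `n` terms of a sequence. -/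
def pure (k : Type u) [Field k] {M : Type v} [AddCommMonoid M] [Module k M] (n : ℕ) (m : ℕ → M) :
    ⨂[k]^n M := PiTensorProduct.tprod k fun i : Fin n => m i

theorem cons_eq_consL (n : ℕ) (a : M) (s : ⨂[k]^n M) :
    cons k M n (a ⊗ₜ[k] s) = consL n a s := rfl

theorem snocL_tprod (n : ℕ) (m : Fin n → M) (a : M) :
    snocL n (PiTensorProduct.tprod k m) a =
      PiTensorProduct.tprod k (Fin.snoc m a : Fin (n + 1) → M) := by
  simp [snocL]

theorem consL_tprod (n : ℕ) (a : M) (m : Fin n → M) :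
    consL n a (PiTensorProduct.tprod k m) =
      PiTensorProduct.tprod k (Fin.cons a m : Fin (n + 1) → M) :=
  cons_tmul_tprod n a m

theorem pure_congr {n : ℕ} {m m' : ℕ → M} (h : ∀ l, l < n → m l = m' l) :
    pure k n m = pure k n m' := by
  unfold pure; congr 1; funext i; exact h i i.2

/-- With sequences indexed by all of `ℕ`, faces and degeneracies become arithmetic on indices with
no dependence on `n`. Entries beyond the length do not matter and are padded by `0`. -/
theorem tprod_eq_pure (n : ℕ) (m : Fin n → M) :
    PiTensorProduct.tprod k m = pure k n fun i => if h : i < n then m ⟨i, h⟩ else 0 := by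
  simp [pure]

theorem pure_induction {n : ℕ} {C : ⨂[k]^n M → Prop} (h : ∀ m, C (pure k n m))
    (hadd : ∀ x y, C x → C y → C (x + y)) (hsmul : ∀ (c : k) x, C x → C (c • x)) (t : ⨂[k]^n M) : C t := by
  refine PiTensorProduct.induction_on t (fun r f => hsmul _ _ ?_) fun x y => hadd x y
  rw [tprod_eq_pure]
  exact h _

theorem hom_ext_pure {n : ℕ} {W : Type w} [AddCommMonoid W] [Module k W]
    {f g : ⨂[k]^n M →ₗ[k] W} (h : ∀ m, f (pure k n m) = g (pure k n m)) : f = g := by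
  refine LinearMap.ext fun t => ?_
  induction t using pure_induction with
  | h m => exact h m
  | hadd x y hx hy => rw [map_add, map_add, hx, hy]
  | hsmul c x hx => rw [map_smul, map_smul, hx]

theorem consL_pure (n : ℕ) (a : M) (m : ℕ → M) :
    consL n a (pure k n m) = pure k (n + 1) fun i => Nat.casesOn i a m := by
  rw [pure, consL_tprod, pure]
  congr 1
  funext i
  refine Fin.cases rfl (fun i => rfl) i

theorem pure_succ (n : ℕ) (m : ℕ → M) :
    pure k (n + 1) m = consL n (m 0) (pure k n fun i => m (i + 1)) := by
  rw [consL_pure]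
  exact pure_congr fun l _ => by cases l <;> rfl

theorem pure_succ_last (n : ℕ) (m : ℕ → M) :
    pure k (n + 1) m = snocL n (pure k n m) (m n) := by
  rw [pure, pure, snocL_tprod]
  congr 1
  funext i
  refine Fin.lastCases ?_ (fun i => ?_) i <;> simp

theorem snocL_pure (n : ℕ) (m : ℕ → M) (a : M) :
    snocL n (pure k n m) a = pure k (n + 1) fun i => if i < n then m i else a := by
  rw [pure_succ_last, if_neg (lt_irrefl n)]
  congr 2
  exact pure_congr fun l hl => by rw [if_pos hl]

theorem pure_zero (m : ℕ → M) : pure k 0 m = PiTensorProduct.tprod k (Fin.elim0 : Fin 0 → M) := by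
  unfold pure; congr 1; funext i; exact i.elim0

@[simp]
theorem headSplit_consL (n : ℕ) (a : M) (s : ⨂[k]^n M) :
    headSplit k M n (consL n a s) = a ⊗ₜ[k] s := by
  induction s using pure_induction with
  | h m => rw [pure, consL_tprod, headSplit_tprod]; simp
  | hadd x y hx hy => rw [map_add, map_add, hx, hy, TensorProduct.tmul_add]
  | hsmul c x hx => rw [map_smul, map_smul, hx, TensorProduct.tmul_smul]

@[simp]
theorem lastSplit_snocL (n : ℕ) (a : M) (s : ⨂[k]^n M) :
    lastSplit k M n (snocL n s a) = s ⊗ₜ[k] a := by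
  induction s using pure_induction with
  | h m => rw [pure, snocL_tprod, lastSplit_tprod]; simp
  | hadd x y hx hy =>
    rw [map_add, LinearMap.add_apply, map_add, hx, hy, TensorProduct.add_tmul]
  | hsmul c x hx =>
    rw [map_smul, LinearMap.smul_apply, map_smul, hx, TensorProduct.smul_tmul']

theorem snocL_consL (n : ℕ) (a : M) (s : ⨂[k]^n M) (b : M) :
    snocL (n + 1) (consL n a s) b = consL (n + 1) a (snocL n s b) := by
  induction s using pure_induction with
  | h m =>
    rw [consL_pure, snocL_pure, snocL_pure, consL_pure]
    refine pure_congr fun l _ => ?_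
    cases l <;> simp
  | hadd x y hx hy => simp only [map_add, LinearMap.add_apply, hx, hy]
  | hsmul c x hx => simp only [map_smul, LinearMap.smul_apply, hx]

theorem hom_ext_consL {n : ℕ} {W : Type w} [AddCommMonoid W] [Module k W]
    {f g : ⨂[k]^(n + 1) M →ₗ[k] W} (h : ∀ a s, f (consL n a s) = g (consL n a s)) : f = g :=
  hom_ext_pure fun m => by rw [pure_succ]; exact h _ _

theorem hom_ext_snocL {n : ℕ} {W : Type w} [AddCommMonoid W] [Module k W]
    {f g : ⨂[k]^(n + 1) M →ₗ[k] W} (h : ∀ s a, f (snocL n s a) = g (snocL n s a)) : f = g :=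
  hom_ext_pure fun m => by rw [pure_succ_last]; exact h _ _

theorem consL_induction {n : ℕ} {C : ⨂[k]^(n + 1) M → Prop} (h : ∀ a s, C (consL n a s))
    (hadd : ∀ x y, C x → C y → C (x + y)) (hsmul : ∀ (c : k) x, C x → C (c • x))
    (t : ⨂[k]^(n + 1) M) : C t := by
  induction t using pure_induction with
  | h m => rw [pure_succ]; exact h _ _
  | hadd x y hx hy => exact hadd x y hx hy
  | hsmul c x hx => exact hsmul c x hx

/-- The inner face multiplying the entries `j` and `j + 1`; zero if the index is out of range. -/
def ctr (mul : M →ₗ[k] M →ₗ[k] M) (n j : ℕ) : ⨂[k]^(n + 1) M →ₗ[k] ⨂[k]^n M :=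
  if h : j < n then contract mul ⟨j, h⟩ else 0

/-- Insertion of `e` before the entry `j`; zero if the index is out of range. -/
def ins (e : M) : ∀ n : ℕ, ℕ → (⨂[k]^n M →ₗ[k] ⨂[k]^(n + 1) M)
  | n, 0 => consL n e
  | 0, _ + 1 => 0
  | n + 1, j + 1 => cons k M (n + 1) ∘ₗ (ins e n j).lTensor M ∘ₗ headSplit k M n

/-- The sequence with the entries `j` and `j + 1` multiplied. -/
def ctrSeq (mul : M →ₗ[k] M →ₗ[k] M) (j : ℕ) (m : ℕ → M) (l : ℕ) : M :=
  if l < j then m l else if l = j then mul (m l) (m (l + 1)) else m (l + 1)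

/-- The sequence with `e` inserted before the entry `j`. -/
def insSeq (e : M) (j : ℕ) (m : ℕ → M) (l : ℕ) : M :=
  if l < j then m l else if l = j then e else m (l - 1)

theorem ctr_pure (mul : M →ₗ[k] M →ₗ[k] M) {n j : ℕ} (h : j < n) (m : ℕ → M) :
    ctr mul n j (pure k (n + 1) m) = pure k n (ctrSeq mul j m) := by
  rw [ctr, dif_pos h, pure, contract_tprod, pure]
  rfl

theorem ins_pure (e : M) {n j : ℕ} (h : j ≤ n) (m : ℕ → M) :
    ins e n j (pure k n m) = pure k (n + 1) (insSeq e j m) := by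
  induction j generalizing n m with
  | zero =>
    cases n <;> (rw [ins, consL_pure]; refine pure_congr fun l _ => ?_; cases l <;> simp [insSeq])
  | succ j ih =>
    obtain ⟨n, rfl⟩ : ∃ n', n = n' + 1 := ⟨n - 1, by omega⟩
    rw [ins, pure_succ, LinearMap.comp_apply, LinearMap.comp_apply, headSplit_consL,
      LinearMap.lTensor_tmul, ih (by omega), cons_eq_consL, consL_pure]
    refine pure_congr fun l _ => ?_
    rcases l with _ | l
    · simp [insSeq]
    · simp only [insSeq, Nat.add_lt_add_iff_right, Nat.add_right_cancel_iff]
      rcases l with _ | l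
      · rcases j with _ | j <;> simp
      · simp

@[simp]
theorem ctr_zero_consL (mul : M →ₗ[k] M →ₗ[k] M) (n : ℕ) (a b : M) (s : ⨂[k]^n M) :
    ctr mul (n + 1) 0 (consL (n + 1) a (consL n b s)) = consL n (mul a b) s := by
  induction s using pure_induction with
  | h m =>
    rw [consL_pure, consL_pure, ctr_pure _ (by omega), consL_pure]
    exact pure_congr fun l _ => by cases l <;> simp [ctrSeq]
  | hadd x y hx hy => simp only [map_add, hx, hy]
  | hsmul c x hx => simp only [map_smul, hx]

@[simp]
theorem ctr_succ_consL (mul : M →ₗ[k] M →ₗ[k] M) (n j : ℕ) (a : M) (s : ⨂[k]^(n + 1) M) :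
    ctr mul (n + 1) (j + 1) (consL (n + 1) a s) = consL n a (ctr mul n j s) := by
  by_cases h : j < n
  · induction s using pure_induction with
    | h m =>
      rw [consL_pure, ctr_pure _ (by omega), ctr_pure _ h, consL_pure]
      exact pure_congr fun l _ => by cases l <;> simp [ctrSeq]
    | hadd x y hx hy => simp only [map_add, hx, hy]
    | hsmul c x hx => simp only [map_smul, hx]
  · simp [ctr, h]

@[simp]
theorem ins_zero (e : M) (n : ℕ) (s : ⨂[k]^n M) : ins e n 0 s = consL n e s := by cases n <;> rfl

@[simp]
theorem ins_succ_consL (e : M) (n j : ℕ) (a : M) (s : ⨂[k]^n M) :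
    ins e (n + 1) (j + 1) (consL n a s) = consL (n + 1) a (ins e n j s) := by
  simp [ins, cons_eq_consL]

end TensorTools

/-! ### Bar complexes -/

section Bar

variable {k : Type u} [Field k] {A : Type v} [AddCommMonoid A] [Module k A]
variable {V : Type w} [AddCommMonoid V] [Module k V]
variable {W : ℕ → Type w} [∀ n, AddCommMonoid (W n)] [∀ n, Module k (W n)]

/-- The sequence underlying the `i`-th face of a sequence: its first entry is dropped if `i = 0`, and
otherwise the entries `i - 1` and `i` are multiplied. -/
def faceSeq (mul : A →ₗ[k] A →ₗ[k] A) (i : ℕ) (m : ℕ → A) (l : ℕ) : A :=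
  if l + 1 < i then m l else if l + 1 = i then mul (m l) (m (l + 1)) else m (l + 1)

/-- The coefficient of the `i`-th face of `v ⊗ m⁰ ⊗ ⋯ ⊗ mⁿ`. -/
def faceCoeff (l r : A →ₗ[k] V →ₗ[k] V) (n i : ℕ) (m : ℕ → A) (v : V) : V :=
  if i = 0 then r (m 0) v else if i = n + 1 then l (m n) v else v

/-- `F` and `S` are the faces and degeneracies of the bar complex `W n = V ⊗ Aⁿ` of an algebra `A`
with coefficients in a bimodule `V`, with left action `l` and right action `r`. -/
structure IsBar (mul : A →ₗ[k] A →ₗ[k] A) (one : A) (l r : A →ₗ[k] V →ₗ[k] V)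
    (mk : ∀ n, V →ₗ[k] ⨂[k]^n A →ₗ[k] W n) (F : ∀ n, ℕ → (W (n + 1) →ₗ[k] W n))
    (S : ∀ n, ℕ → (W n →ₗ[k] W (n + 1))) : Prop where
  mul_assoc : ∀ a b c, mul (mul a b) c = mul a (mul b c)
  one_mul : ∀ a, mul one a = a
  mul_one : ∀ a, mul a one = a
  l_mul : ∀ a b v, l (mul a b) v = l a (l b v)
  r_mul : ∀ a b v, r (mul a b) v = r b (r a v)
  l_one : ∀ v, l one v = v
  r_one : ∀ v, r one v = v
  comm : ∀ a b v, l a (r b v) = r b (l a v)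
  span : ∀ {n n' : ℕ} {f g : W n →ₗ[k] W n'},
    (∀ v m, f (mk n v (pure k n m)) = g (mk n v (pure k n m))) → f = g
  face : ∀ n i v m, i ≤ n + 1 → F n i (mk (n + 1) v (pure k (n + 1) m)) =
    mk n (faceCoeff l r n i m v) (pure k n (faceSeq mul i m))
  degen : ∀ n j v m, j ≤ n →
    S n j (mk n v (pure k n m)) = mk (n + 1) v (pure k (n + 1) (insSeq one j m))

namespace IsBar

variable {mul : A →ₗ[k] A →ₗ[k] A} {one : A} {l r : A →ₗ[k] V →ₗ[k] V}
  {mk : ∀ n, V →ₗ[k] ⨂[k]^n A →ₗ[k] W n} {F : ∀ n, ℕ → (W (n + 1) →ₗ[k] W n)}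
  {S : ∀ n, ℕ → (W n →ₗ[k] W (n + 1))}

/-- Coefficients and sequences are compared separately. On the sequences this is associativity. On
the coefficients, `i = j = 0` is the right module law, `i = j` at the other end the left one, and
the two opposite ends together are the commutation of the actions. -/
theorem face_face (h : IsBar mul one l r mk F S) (n i j : ℕ) (hij : i ≤ j) (hj : j ≤ n + 1) :
    F n i ∘ₗ F (n + 1) (j + 1) = F n j ∘ₗ F (n + 1) i := by
  refine h.span fun v m => ?_
  simp only [LinearMap.comp_apply]
  rw [h.face _ _ _ _ (by omega), h.face _ _ _ _ (by omega), h.face _ _ _ _ (by omega),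
    h.face _ _ _ _ (by omega)]
  congr 1
  · congr 1
    rcases i with _ | i
    · rcases j with _ | j
      · simp [faceCoeff, faceSeq, h.r_mul]
      · by_cases hn : j = n
        · subst hn
          simp [faceCoeff, faceSeq, h.comm]
        · simp [faceCoeff, faceSeq, hn]
    · rcases j with _ | j
      · omega
      · by_cases hn : j = n
        · subst hn
          by_cases hi : i = j
          · subst hi
            simp [faceCoeff, faceSeq, h.l_mul]
          · have : ¬ (j + 1 < i + 1) := by omega
            have : ¬ (j = i) := by omega
            have : ¬ (i = j + 1) := by omega
            simp [faceCoeff, faceSeq, *]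
        · have : ¬ (i = n) := by omega
          have : ¬ (i = n + 1) := by omega
          simp [faceCoeff, *]
  · refine pure_congr fun t ht => ?_
    simp only [faceSeq]
    split_ifs <;> first | rfl | omega | rw [h.mul_assoc]

theorem face_degen_lt (h : IsBar mul one l r mk F S) (n i j : ℕ) (hij : i ≤ j) (hj : j ≤ n) :
    F (n + 1) i ∘ₗ S (n + 1) (j + 1) = S n j ∘ₗ F n i := by
  refine h.span fun v m => ?_
  simp only [LinearMap.comp_apply]
  rw [h.degen _ _ _ _ (by omega), h.face _ _ _ _ (by omega), h.face _ _ _ _ (by omega),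
    h.degen _ _ _ _ (by omega)]
  congr 1
  · congr 1
    have : ¬ (i = n + 1 + 1) := by omega
    have : ¬ (i = n + 1) := by omega
    simp [faceCoeff, insSeq, *]
  · refine pure_congr fun t ht => ?_
    simp only [faceSeq, insSeq]
    have : t ≠ 0 → t - 1 + 1 = t := by omega
    split_ifs <;> first | rfl | omega | exact congrArg m (by omega)

/-- The inserted unit is consumed by the right action if `j = 0`, and otherwise by the product with
its left neighbour. -/
theorem face_degen_self (h : IsBar mul one l r mk F S) (n j : ℕ) (hj : j ≤ n) :
    F n j ∘ₗ S n j = LinearMap.id := by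
  refine h.span fun v m => ?_
  simp only [LinearMap.comp_apply, LinearMap.id_apply]
  rw [h.degen _ _ _ _ (by omega), h.face _ _ _ _ (by omega)]
  congr 1
  · congr 1
    have : ¬ (j = n + 1) := by omega
    by_cases h0 : j = 0 <;> simp [faceCoeff, insSeq, h.r_one, *]
  · refine pure_congr fun t ht => ?_
    simp only [faceSeq, insSeq]
    split_ifs <;> first | rfl | omega | simp_all [h.mul_one]

theorem face_degen_succ (h : IsBar mul one l r mk F S) (n j : ℕ) (hj : j ≤ n) :
    F n (j + 1) ∘ₗ S n j = LinearMap.id := by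
  refine h.span fun v m => ?_
  simp only [LinearMap.comp_apply, LinearMap.id_apply]
  rw [h.degen _ _ _ _ (by omega), h.face _ _ _ _ (by omega)]
  congr 1
  · congr 1
    by_cases h0 : j = n <;> simp [faceCoeff, insSeq, h.l_one, *]
  · refine pure_congr fun t ht => ?_
    simp only [faceSeq, insSeq]
    split_ifs <;> first | rfl | omega | simp_all [h.one_mul]

theorem face_degen_gt (h : IsBar mul one l r mk F S) (n i j : ℕ) (hij : j < i) (hj : i ≤ n + 1) :
    F (n + 1) (i + 1) ∘ₗ S (n + 1) j = S n j ∘ₗ F n i := by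
  refine h.span fun v m => ?_
  simp only [LinearMap.comp_apply]
  rw [h.degen _ _ _ _ (by omega), h.face _ _ _ _ (by omega), h.face _ _ _ _ (by omega),
    h.degen _ _ _ _ (by omega)]
  congr 1
  · congr 1
    have : ¬ (i = 0) := by omega
    by_cases h0 : i = n + 1
    · have : ¬ (n + 1 < j) := by omega
      have : ¬ (n + 1 = j) := by omega
      simp [faceCoeff, insSeq, *]
    · simp [faceCoeff, *]
  · refine pure_congr fun t ht => ?_
    simp only [faceSeq, insSeq]
    have : t ≠ 0 → t - 1 + 1 = t := by omega
    split_ifs <;> first | rfl | omega | exact congrArg m (by omega) | simp_all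

end IsBar
end Bar
end
end BialgebraCohomology

namespace BialgebraCohomology
noncomputable section
universe u v w
set_option linter.unusedSectionVars false

/-! ### Sweedler sums -/

section Sweedler

variable {k : Type u} [Field k] {B : Type v} [AddCommGroup B] [Module k B] [Coalgebra k B]
variable {W : Type*} [AddCommMonoid W] [Module k W]
variable {W' : Type*} [AddCommMonoid W'] [Module k W']

/-- A linear function. -/
structure IsLin (k : Type u) [Field k] {B : Type*} [AddCommMonoid B] [Module k B] {W : Type*}
    [AddCommMonoid W] [Module k W] (f : B → W) : Prop where
  add : ∀ u u', f (u + u') = f u + f u'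
  smul : ∀ (c : k) u, f (c • u) = c • f u

/-- A bilinear function. -/
structure IsBilin (k : Type u) [Field k] {B : Type*} [AddCommMonoid B] [Module k B] {W : Type*}
    [AddCommMonoid W] [Module k W] (F : B → B → W) : Prop where
  left : ∀ v, IsLin k fun u => F u v
  right : ∀ u, IsLin k (F u)

/-- A trilinear function. -/
structure IsTrilin (k : Type u) [Field k] {B : Type*} [AddCommMonoid B] [Module k B] {W : Type*}
    [AddCommMonoid W] [Module k W] (F : B → B → B → W) : Prop where
  left : ∀ v w, IsLin k fun u => F u v w
  right : ∀ u, IsBilin k (F u)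

theorem IsTrilin.of {B : Type*} [AddCommMonoid B] [Module k B] {W : Type*} [AddCommMonoid W]
    [Module k W] {F : B → B → B → W} (h₁ : ∀ v w, IsLin k fun u => F u v w)
    (h₂ : ∀ u w, IsLin k fun v => F u v w) (h₃ : ∀ u v, IsLin k (F u v)) : IsTrilin k F :=
  ⟨h₁, fun u => ⟨h₂ u, h₃ u⟩⟩

/-- The linear map underlying a linear function. -/
def IsLin.toLin {f : B → W} (h : IsLin k f) : B →ₗ[k] W where
  toFun := f
  map_add' := h.add
  map_smul' := h.smul

/-- The bilinear map underlying a bilinear function. -/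
def IsBilin.toLin {F : B → B → W} (h : IsBilin k F) : B →ₗ[k] B →ₗ[k] W :=
  LinearMap.mk₂ k F (fun u u' v => (h.left v).add u u') (fun c u v => (h.left v).smul c u)
    (fun u => (h.right u).add) (fun c u => (h.right u).smul c)

/-- The trilinear map underlying a trilinear function. -/
def IsTrilin.toLin {F : B → B → B → W} (h : IsTrilin k F) : B →ₗ[k] B →ₗ[k] B →ₗ[k] W where
  toFun u := (h.right u).toLin
  map_add' u u' := by ext v w; exact (h.left v w).add u u'
  map_smul' c u := by ext v w; exact (h.left v w).smul c u

variable (k) in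
/-- The Sweedler sum `∑ F b₁ b₂`. -/
def sw (F : B → B → W) (b : B) : W :=
  ∑ i ∈ (Coalgebra.Repr.arbitrary k b).index,
    F ((Coalgebra.Repr.arbitrary k b).left i) ((Coalgebra.Repr.arbitrary k b).right i)

/-- `sw` sums over a chosen representative of the coproduct. For a bilinear summand the value does
not depend on the choice, and this is how every identity involving the coproduct enters. -/
theorem sw_eq_lift (F : B →ₗ[k] B →ₗ[k] W) (b : B) :
    sw k (fun u v => F u v) b = TensorProduct.lift F (Coalgebra.comul b) := by
  rw [← (Coalgebra.Repr.arbitrary k b).eq, map_sum]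
  rfl

theorem sw_eq {F : B → B → W} (h : IsBilin k F) (b : B) :
    sw k F b = TensorProduct.lift h.toLin (Coalgebra.comul b) := sw_eq_lift h.toLin b

theorem sw_isLin {F : B → B → W} (h : IsBilin k F) : IsLin k (sw k F) where
  add u u' := by simp only [sw_eq h, map_add]
  smul c u := by simp only [sw_eq h, map_smul]

@[simp]
theorem sw_add_fun (F G : B → B → W) (b : B) :
    sw k (fun u v => F u v + G u v) b = sw k F b + sw k G b := Finset.sum_add_distrib

@[simp]
theorem sw_smul_fun (c : k) (F : B → B → W) (b : B) :
    sw k (fun u v => c • F u v) b = c • sw k F b := Finset.smul_sum.symm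

theorem map_sw (L : W →ₗ[k] W') (F : B → B → W) (b : B) :
    L (sw k F b) = sw k (fun u v => L (F u v)) b := map_sum _ _ _

theorem sw_apply (F : B → B → W →ₗ[k] W') (b : B) (x : W) :
    sw k F b x = sw k (fun u v => F u v x) b := by simp [sw, LinearMap.sum_apply]

theorem sum_sw {ι : Type*} (s : Finset ι) (F : ι → B → B → W) (b : B) :
    ∑ i ∈ s, sw k (F i) b = sw k (fun u v => ∑ i ∈ s, F i u v) b := Finset.sum_comm

theorem sw_tmul (F : B → B → W) (b : B) (y : W') :
    sw k F b ⊗ₜ[k] y = sw k (fun u v => F u v ⊗ₜ[k] y) b := TensorProduct.sum_tmul _ _ _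

theorem tmul_sw (F : B → B → W) (b : B) (y : W') :
    y ⊗ₜ[k] sw k F b = sw k (fun u v => y ⊗ₜ[k] F u v) b := TensorProduct.tmul_sum _ _ _

theorem comul_eq_sw (b : B) : Coalgebra.comul b = sw k (fun u v => u ⊗ₜ[k] v) b :=
  (Coalgebra.Repr.arbitrary k b).eq.symm

/-- Two finite sums over representatives fixed in advance may be interchanged without any linearity.
-/
theorem sw_sw_comm {C : Type*} [AddCommGroup C] [Module k C] [Coalgebra k C]
    (F : B → B → C → C → W) (b : B) (c : C) :
    sw k (fun u v => sw k (fun p q => F u v p q) c) b =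
      sw k (fun p q => sw k (fun u v => F u v p q) b) c := Finset.sum_comm

/-- Coassociativity. Linearity in each argument is needed because the inner representative depends
on the outer one. -/
theorem sw_sw_left {F : B → B → B → W} (h : IsTrilin k F) (b : B) :
    sw k (fun u w => sw k (fun u v => F u v w) u) b =
      sw k (fun u v => sw k (fun v w => F u v w) v) b := by
  have e1 : ∀ u w, sw k (fun u v => F u v w) u =
      TensorProduct.lift (TensorProduct.lift h.toLin) (Coalgebra.comul u ⊗ₜ w) := fun u w => by
    rw [comul_eq_sw, TensorProduct.lift.tmul, map_sw, sw_apply]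
    rfl
  have e2 : ∀ u v, sw k (fun v w => F u v w) v = TensorProduct.lift (TensorProduct.lift h.toLin)
      ((TensorProduct.assoc k B B B).symm (u ⊗ₜ Coalgebra.comul v)) := fun u v => by
    rw [comul_eq_sw, tmul_sw, ← LinearEquiv.coe_coe, map_sw, map_sw]
    rfl
  simp only [e1, e2]
  have h1 := sw_eq_lift (TensorProduct.curry (TensorProduct.lift (TensorProduct.lift h.toLin) ∘ₗ
    (Coalgebra.comul (R := k) (A := B)).rTensor B)) b
  have h2 := sw_eq_lift (TensorProduct.curry (TensorProduct.lift (TensorProduct.lift h.toLin) ∘ₗ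
    (TensorProduct.assoc k B B B).symm.toLinearMap ∘ₗ
    (Coalgebra.comul (R := k) (A := B)).lTensor B)) b
  refine h1.trans (Eq.trans ?_ h2.symm)
  have hc : ∀ g : B ⊗[k] B →ₗ[k] W, TensorProduct.lift (TensorProduct.curry g) = g :=
    fun g => TensorProduct.ext rfl
  rw [hc, hc]
  simp only [LinearMap.comp_apply, LinearEquiv.coe_coe]
  rw [← Coalgebra.coassoc_apply, LinearEquiv.symm_apply_apply]

theorem sw_counit_left {f : B → W} (h : IsLin k f) (b : B) :
    sw k (fun u v => Coalgebra.counit (R := k) u • f v) b = f b := by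
  have := congrArg h.toLin (Coalgebra.sum_counit_smul (Coalgebra.Repr.arbitrary k b))
  rw [map_sum] at this
  simp only [map_smul] at this
  exact this

theorem sw_counit_right {f : B → W} (h : IsLin k f) (b : B) :
    sw k (fun u v => Coalgebra.counit (R := k) v • f u) b = f b := by
  have := congrArg (TensorProduct.lift ((LinearMap.lsmul k W).flip ∘ₗ h.toLin))
    (Coalgebra.lTensor_counit_comul (R := k) b)
  rw [comul_eq_sw, map_sw, map_sw] at this
  simpa [IsLin.toLin] using this

end Sweedler

/-! ### Sweedler sums in a Hopf algebra. -/

section SweedlerMul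

variable {k : Type u} [Field k] {B : Type v} [Ring B] [HopfAlgebra k B]
variable {W : Type*} [AddCommMonoid W] [Module k W]

theorem sw_one {F : B → B → W} (h : IsBilin k F) : sw k F (1 : B) = F 1 1 := by
  rw [sw_eq h, Bialgebra.comul_one]
  rfl

theorem sw_mul {F : B → B → W} (h : IsBilin k F) (a b : B) :
    sw k F (a * b) = sw k (fun u v => sw k (fun p q => F (u * p) (v * q)) b) a := by
  rw [sw_eq h, Bialgebra.comul_mul, comul_eq_sw a, comul_eq_sw b]
  simp only [sw, Finset.sum_mul_sum, Algebra.TensorProduct.tmul_mul_tmul, map_sum]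
  rfl

theorem sw_mul_antipode {f : B → W} (h : IsLin k f) (b : B) :
    sw k (fun u v => f (u * HopfAlgebra.antipode k v)) b = Coalgebra.counit (R := k) b • f 1 := by
  have := congrArg h.toLin
    (HopfAlgebra.sum_mul_antipode_eq_smul (Coalgebra.Repr.arbitrary k b))
  rw [map_sum, map_smul] at this
  exact this

theorem sw_antipode_mul {f : B → W} (h : IsLin k f) (b : B) :
    sw k (fun u v => f (HopfAlgebra.antipode k u * v)) b = Coalgebra.counit (R := k) b • f 1 := by
  have := congrArg h.toLin
    (HopfAlgebra.sum_antipode_mul_eq_smul (Coalgebra.Repr.arbitrary k b))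
  rw [map_sum, map_smul] at this
  exact this

end SweedlerMul

/-! ### Diagonal actions -/

section DiagAct

variable {k : Type u} [Field k] {B : Type v} [Ring B] [HopfAlgebra k B]
variable {M : Type w} [AddCommMonoid M] [Module k M]

theorem snocL_zero (t : ⨂[k]^0 M) (m : M) :
    snocL 0 t m = consL 0 m t := by
  induction t using pure_induction with
  | h t =>
    rw [snocL_pure, consL_pure]
    exact pure_congr fun l hl => by obtain rfl : l = 0 := by omega
                                    rfl
  | hadd a b ha hb => simp only [map_add, LinearMap.add_apply, ha, hb]
  | hsmul c a ha => simp only [map_smul, LinearMap.smul_apply, ha]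

theorem map₂_consL {act : B →ₗ[k] M →ₗ[k] M} (n : ℕ) (a : B) (z : ⨂[k]^n B) (m : M)
    (t : ⨂[k]^n M) :
    PiTensorProduct.map₂ (fun _ : Fin (n + 1) => act) (consL n a z) (consL n m t) =
      consL n (act a m) (PiTensorProduct.map₂ (fun _ : Fin n => act) z t) := by
  induction z using pure_induction with
  | h z =>
    induction t using pure_induction with
    | h t =>
      simp only [pure, consL_tprod, PiTensorProduct.map₂_tprod_tprod]
      congr 1
      funext i
      refine Fin.cases rfl (fun i => rfl) i
    | hadd x y hx hy => simp only [map_add, hx, hy]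
    | hsmul c x hx => simp only [map_smul, hx]
  | hadd x y hx hy => simp only [map_add, LinearMap.add_apply, hx, hy]
  | hsmul c x hx => simp only [map_smul, LinearMap.smul_apply, hx]

variable (act : B →ₗ[k] M →ₗ[k] M)

theorem diagAct_zero (b : B) (t : ⨂[k]^0 M) :
    diagAct k B act 0 b t = Coalgebra.counit (R := k) b • t := by
  induction t using pure_induction with
  | h t =>
    simp only [diagAct, iterComul, LinearMap.comp_apply, LinearMap.toSpanSingleton_apply, map_smul,
      LinearMap.smul_apply, pure, PiTensorProduct.map₂_tprod_tprod]
    congr 2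
    funext i
    exact i.elim0
  | hadd x y hx hy => simp only [map_add, hx, hy, smul_add]
  | hsmul c x hx => rw [map_smul, hx, smul_comm]

theorem diagAct_consL (n : ℕ) (b : B) (m : M) (t : ⨂[k]^n M) :
    diagAct k B act (n + 1) b (consL n m t) =
      sw k (fun u v => consL n (act u m) (diagAct k B act n v t)) b := by
  simp only [diagAct, iterComul, LinearMap.comp_apply, comul_eq_sw]
  rw [map_sw, map_sw, map_sw, sw_apply]
  simp only [LinearMap.lTensor_tmul, cons_eq_consL, map₂_consL]

/-- The iterated coproduct is built by splitting off factors on the left. Coassociativity lets the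
last factor be split off instead, as the last faces require. -/
theorem diagAct_snocL (n : ℕ) (b : B) (t : ⨂[k]^n M) (m : M) :
    diagAct k B act (n + 1) b (snocL n t m) =
      sw k (fun u v => snocL n (diagAct k B act n u t) (act v m)) b := by
  induction n generalizing b with
  | zero =>
    induction t using pure_induction with
    | h t =>
      have : snocL 0 (pure k 0 t) m = consL 0 m (pure k 0 t) := by
        rw [snocL_pure, consL_pure]
        exact pure_congr fun l hl => by obtain rfl : l = 0 := by omega
                                        rfl
      have h' : ∀ x, snocL 0 (pure k 0 t) x = consL 0 x (pure k 0 t) := fun x => by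
        rw [snocL_pure, consL_pure]
        exact pure_congr fun l hl => by obtain rfl : l = 0 := by omega
                                        rfl
      rw [h', diagAct_consL]
      simp only [diagAct_zero, map_smul, LinearMap.smul_apply, h']
      rw [sw_counit_right (f := fun u => consL 0 (act u m) (pure k 0 t))
        ⟨by simp, by simp⟩,
        sw_counit_left (f := fun u => consL 0 (act u m) (pure k 0 t))
        ⟨by simp, by simp⟩]
    | hadd x y hx hy => simp only [map_add, LinearMap.add_apply, hx, hy, sw_add_fun]
    | hsmul c x hx => simp only [map_smul, LinearMap.smul_apply, hx, sw_smul_fun]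
  | succ n ih =>
    induction t using consL_induction with
    | h a s =>
      rw [snocL_consL, diagAct_consL]
      simp only [ih, diagAct_consL, map_sw, sw_apply, snocL_consL]
      refine (sw_sw_left (F := fun u v w => consL (n + 1) (act u a)
        (snocL n (diagAct k B act n v s) (act w m))) ?_ b).symm
      exact .of (fun _ _ => ⟨by simp, by simp⟩) (fun _ _ => ⟨by simp, by simp⟩)
        (fun _ _ => ⟨by simp, by simp⟩)
    | hadd x y hx hy => simp only [map_add, LinearMap.add_apply, hx, hy, sw_add_fun]
    | hsmul c x hx => simp only [map_smul, LinearMap.smul_apply, hx, sw_smul_fun]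

variable {act}

theorem diagAct_mul (h : ∀ a b m, act (a * b) m = act a (act b m)) (n : ℕ) (a b : B)
    (t : ⨂[k]^n M) :
    diagAct k B act n (a * b) t = diagAct k B act n a (diagAct k B act n b t) := by
  induction n generalizing a b with
  | zero => simp only [diagAct_zero, Bialgebra.counit_mul, smul_smul]
  | succ n ih =>
    induction t using consL_induction with
    | h m s =>
      rw [diagAct_consL, diagAct_consL, sw_mul ⟨fun _ => ⟨by simp, by simp⟩,
        fun _ => ⟨by simp, by simp⟩⟩]
      simp only [h, ih, map_sw, diagAct_consL]
      exact sw_sw_comm _ _ _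
    | hadd x y hx hy => simp only [map_add, hx, hy]
    | hsmul c x hx => simp only [map_smul, hx]

theorem diagAct_mul_right (h : ∀ a b m, act (a * b) m = act b (act a m)) (n : ℕ) (a b : B)
    (t : ⨂[k]^n M) :
    diagAct k B act n (a * b) t = diagAct k B act n b (diagAct k B act n a t) := by
  induction n generalizing a b with
  | zero => simp only [diagAct_zero, Bialgebra.counit_mul, smul_smul, mul_comm]
  | succ n ih =>
    induction t using consL_induction with
    | h m s =>
      rw [diagAct_consL, diagAct_consL, sw_mul ⟨fun _ => ⟨by simp, by simp⟩,
        fun _ => ⟨by simp, by simp⟩⟩]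
      simp only [h, ih, map_sw, diagAct_consL]
    | hadd x y hx hy => simp only [map_add, hx, hy]
    | hsmul c x hx => simp only [map_smul, hx]

theorem diagAct_one (h : ∀ m, act 1 m = m) (n : ℕ) (t : ⨂[k]^n M) :
    diagAct k B act n 1 t = t := by
  induction n with
  | zero => simp only [diagAct_zero, Bialgebra.counit_one, one_smul]
  | succ n ih =>
    induction t using consL_induction with
    | h m s =>
      rw [diagAct_consL, sw_one ⟨fun _ => ⟨by simp, by simp⟩, fun _ => ⟨by simp, by simp⟩⟩, h, ih]
    | hadd x y hx hy => simp only [map_add, hx, hy]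
    | hsmul c x hx => simp only [map_smul, hx]

theorem diagAct_comm {act' : B →ₗ[k] M →ₗ[k] M} (h : ∀ a b m, act a (act' b m) = act' b (act a m))
    (n : ℕ) (a b : B) (t : ⨂[k]^n M) :
    diagAct k B act n a (diagAct k B act' n b t) =
      diagAct k B act' n b (diagAct k B act n a t) := by
  induction n generalizing a b with
  | zero => rw [diagAct_zero, diagAct_zero, diagAct_zero, diagAct_zero, smul_comm]
  | succ n ih =>
    induction t using consL_induction with
    | h m s =>
      simp only [h, ih, map_sw, diagAct_consL]
      exact sw_sw_comm _ _ _
    | hadd x y hx hy => simp only [map_add, hx, hy]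
    | hsmul c x hx => simp only [map_smul, hx]

/-- If the multiplication of `M` is equivariant for the diagonal action, inner faces are
equivariant. For the first two factors this is coassociativity, and the others follow by induction.
-/
theorem diagAct_ctr {mul : M →ₗ[k] M →ₗ[k] M}
    (h : ∀ a x y, act a (mul x y) = sw k (fun u v => mul (act u x) (act v y)) a) (n j : ℕ) (b : B)
    (t : ⨂[k]^(n + 1) M) :
    diagAct k B act n b (ctr mul n j t) = ctr mul n j (diagAct k B act (n + 1) b t) := by
  induction n generalizing j b with
  | zero => simp [ctr]
  | succ n ih =>
    induction t using consL_induction with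
    | h m s =>
      rcases j with _ | j
      · induction s using consL_induction with
        | h m' s =>
          simp only [ctr_zero_consL, diagAct_consL, h, map_sw, sw_apply]
          exact sw_sw_left (F := fun u v w => consL n (mul (act u m) (act v m'))
            (diagAct k B act n w s)) (.of (fun _ _ => ⟨by simp, by simp⟩)
            (fun _ _ => ⟨by simp, by simp⟩) (fun _ _ => ⟨by simp, by simp⟩)) b
        | hadd x y hx hy => simp only [map_add, hx, hy]
        | hsmul c x hx => simp only [map_smul, hx]
      · simp only [ctr_succ_consL, diagAct_consL, ih, map_sw]
    | hadd x y hx hy => simp only [map_add, hx, hy]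
    | hsmul c x hx => simp only [map_smul, hx]

theorem diagAct_ins {e : M} (h : ∀ a, act a e = Coalgebra.counit (R := k) a • e) (n j : ℕ) (b : B)
    (t : ⨂[k]^n M) :
    diagAct k B act (n + 1) b (ins e n j t) = ins e n j (diagAct k B act n b t) := by
  induction j generalizing n b with
  | zero =>
    simp only [ins_zero, diagAct_consL, h, map_smul, LinearMap.smul_apply]
    rw [sw_counit_left (f := fun v => consL n e (diagAct k B act n v t)) ⟨by simp, by simp⟩]
  | succ j ih =>
    rcases n with _ | n
    · simp [ins]
    · induction t using consL_induction with
      | h m s => simp only [ins_succ_consL, diagAct_consL, map_sw, ih]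
      | hadd x y hx hy => simp only [map_add, hx, hy]
      | hsmul c x hx => simp only [map_smul, hx]

end DiagAct

/-! ### The algebra `X` and its coactions -/

section XActions

variable {k : Type u} [Field k] {B : Type v} [Ring B] [HopfAlgebra k B]

@[simp] theorem actL_apply (a : B) (x : X k B) (b : B) : actL k B a x b = x (b * a) := rfl
@[simp] theorem actR_apply (a : B) (x : X k B) (b : B) : actR k B a x b = x (a * b) := rfl
theorem oneX_apply (b : B) : oneX k B b = Coalgebra.counit (R := k) b := rfl
theorem counitX_apply (x : X k B) : counitX k B x = x 1 := rfl

theorem mulX_apply (x y : X k B) (b : B) : mulX k B x y b = sw k (fun u v => x u * y v) b := by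
  change TensorProduct.dualDistrib k B B (x ⊗ₜ y) (Coalgebra.comul b) = _
  rw [comul_eq_sw, map_sw]
  simp

theorem sw_dual_apply (F : B → B → X k B) (b c : B) :
    sw k F b c = sw k (fun u v => F u v c) b := sw_apply F b c

theorem actL_mul (a b : B) (x : X k B) : actL k B (a * b) x = actL k B a (actL k B b x) := by
  ext c; simp [mul_assoc]

theorem actR_mul (a b : B) (x : X k B) : actR k B (a * b) x = actR k B b (actR k B a x) := by
  ext c; simp [mul_assoc]

theorem actL_one (x : X k B) : actL k B 1 x = x := by ext c; simp

theorem actR_one (x : X k B) : actR k B 1 x = x := by ext c; simp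

theorem actL_actR (a b : B) (x : X k B) :
    actL k B a (actR k B b x) = actR k B b (actL k B a x) := by
  ext c; simp [mul_assoc]

theorem isBilin_mul_apply (x y : X k B) : IsBilin k fun u v => x u * y v :=
  ⟨fun _ => ⟨by simp [add_mul], by simp [mul_assoc]⟩,
    fun _ => ⟨by simp [mul_add], by simp [mul_left_comm]⟩⟩

/-- The product of `X` is dual to the coproduct of `B`, which is multiplicative. Hence `X` is a
module algebra over `B`. -/
theorem actL_mulX (a : B) (x y : X k B) :
    actL k B a (mulX k B x y) = sw k (fun u v => mulX k B (actL k B u x) (actL k B v y)) a := by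
  ext c
  simp only [sw_dual_apply, actL_apply, mulX_apply]
  rw [sw_mul (isBilin_mul_apply x y)]
  exact sw_sw_comm _ _ _

theorem actR_mulX (a : B) (x y : X k B) :
    actR k B a (mulX k B x y) = sw k (fun u v => mulX k B (actR k B u x) (actR k B v y)) a := by
  ext c
  simp only [sw_dual_apply, actR_apply, mulX_apply]
  rw [sw_mul (isBilin_mul_apply x y)]

theorem actL_oneX (a : B) : actL k B a (oneX k B) = Coalgebra.counit (R := k) a • oneX k B := by
  ext c; simp [oneX, mul_comm]

theorem actR_oneX (a : B) : actR k B a (oneX k B) = Coalgebra.counit (R := k) a • oneX k B := by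
  ext c; simp [oneX]

theorem mulX_assoc (x y z : X k B) :
    mulX k B (mulX k B x y) z = mulX k B x (mulX k B y z) := by
  ext c
  simp only [mulX_apply]
  have h1 : ∀ u v, sw k (fun p q => x p * y q) u * z v = sw k (fun p q => x p * (y q * z v)) u :=
    fun u v => by simp [sw, Finset.sum_mul, mul_assoc]
  have h2 : ∀ u v, x u * sw k (fun p q => y p * z q) v = sw k (fun p q => x u * (y p * z q)) v :=
    fun u v => by simp [sw, Finset.mul_sum]
  simp only [h1, h2]
  exact sw_sw_left (F := fun u v w => x u * (y v * z w)) (.of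
    (fun _ _ => ⟨by simp [add_mul], by simp [mul_assoc]⟩)
    (fun _ _ => ⟨by simp [mul_add, add_mul], by simp [mul_left_comm, mul_assoc]⟩)
    (fun _ _ => ⟨by simp [mul_add], by simp [mul_left_comm]⟩)) c

theorem oneX_mulX (x : X k B) : mulX k B (oneX k B) x = x := by
  ext c
  simp only [mulX_apply, oneX_apply]
  exact sw_counit_left (f := x) ⟨x.map_add, x.map_smul⟩ c

theorem mulX_oneX (x : X k B) : mulX k B x (oneX k B) = x := by
  ext c
  simp only [mulX_apply, oneX_apply]
  simpa only [smul_eq_mul, mul_comm] using sw_counit_right (f := x) ⟨x.map_add, x.map_smul⟩ c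

/-! ### The coactions of `X` on tensor powers of `B`. -/

theorem hat_consL (n : ℕ) (a : B) (t : ⨂[k]^n B) :
    hat k B (n + 1) (consL n a t) = a * hat k B n t := by
  induction t using pure_induction with
  | h m => simp [hat, consL_tprod, pure, List.ofFn_succ]
  | hadd x y hx hy => simp only [map_add, hx, hy, mul_add]
  | hsmul c x hx => simp only [map_smul, hx, mul_smul_comm]

theorem comulPow_consL (n : ℕ) (a : B) (t : ⨂[k]^n B) :
    comulPow k B (n + 1) (consL n a t) = sw k (fun u v =>
      TensorProduct.map (consL n u) (consL n v) (comulPow k B n t)) a := by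
  rw [comulPow]
  simp only [LinearMap.comp_apply, headSplit_consL, TensorProduct.map_tmul, comul_eq_sw]
  rw [sw_tmul, LinearEquiv.coe_coe, ← LinearEquiv.coe_coe, map_sw, map_sw]
  congr 1
  funext u v
  generalize comulPow k B n t = z
  induction z using TensorProduct.induction_on with
  | zero => rw [TensorProduct.tmul_zero, LinearEquiv.coe_coe, LinearEquiv.map_zero, map_zero,
      map_zero]
  | tmul p q => simp [cons_eq_consL]
  | add p q hp hq => simp only [TensorProduct.tmul_add, map_add, hp, hq]

theorem coactR_eq (n : ℕ) (x : X k B) (t : ⨂[k]^n B) :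
    coactR k B n x t =
      TensorProduct.lid k _ ((x ∘ₗ hat k B n).rTensor _ (comulPow k B n t)) := rfl

theorem coactL_eq (n : ℕ) (x : X k B) (t : ⨂[k]^n B) :
    coactL k B n x t =
      TensorProduct.rid k _ ((x ∘ₗ hat k B n).lTensor _ (comulPow k B n t)) := rfl

theorem hat_zero (t : ℕ → B) : hat k B 0 (pure k 0 t) = 1 := by simp [hat, pure]

theorem comulPow_zero (t : ⨂[k]^0 B) (m : ℕ → B) :
    comulPow k B 0 t = t ⊗ₜ[k] pure k 0 m := by
  rw [pure_zero]; rfl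

theorem coactR_zero (x : X k B) (t : ⨂[k]^0 B) : coactR k B 0 x t = x 1 • t := by
  rw [coactR_eq]
  induction t using pure_induction with
  | h m => rw [comulPow_zero _ m]; simp [hat_zero]
  | hadd a b ha hb => simp only [map_add, smul_add, ha, hb]
  | hsmul c a ha => rw [map_smul, map_smul, map_smul, ha, smul_comm]

theorem coactL_zero (x : X k B) (t : ⨂[k]^0 B) : coactL k B 0 x t = x 1 • t := by
  rw [coactL_eq]
  induction t using pure_induction with
  | h m => rw [comulPow_zero _ m]; simp [hat_zero]
  | hadd a b ha hb => simp only [map_add, smul_add, ha, hb]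
  | hsmul c a ha => rw [map_smul, map_smul, map_smul, ha, smul_comm]

/-- Since `⟨x, a₁ t̂₁⟩ = ⟨x^{a₁}, t̂₁⟩`, the first entry of the tensor passes into `x`. This
recursion drives the inductions on tensor length. -/
theorem coactR_consL (n : ℕ) (x : X k B) (a : B) (t : ⨂[k]^n B) :
    coactR k B (n + 1) x (consL n a t) =
      sw k (fun u v => consL n v (coactR k B n (actR k B u x) t)) a := by
  rw [coactR_eq, comulPow_consL, map_sw, ← LinearEquiv.coe_coe, map_sw]
  simp only [coactR_eq]
  congr 1
  funext u v
  generalize comulPow k B n t = z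
  induction z using TensorProduct.induction_on with
  | zero => simp
  | tmul p q => simp [hat_consL]
  | add p q hp hq => simp only [map_add, hp, hq]

theorem coactL_consL (n : ℕ) (x : X k B) (a : B) (t : ⨂[k]^n B) :
    coactL k B (n + 1) x (consL n a t) =
      sw k (fun u v => consL n u (coactL k B n (actR k B v x) t)) a := by
  rw [coactL_eq, comulPow_consL, map_sw, ← LinearEquiv.coe_coe, map_sw]
  simp only [coactL_eq]
  congr 1
  funext u v
  generalize comulPow k B n t = z
  induction z using TensorProduct.induction_on with
  | zero => simp
  | tmul p q => simp [hat_consL]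
  | add p q hp hq => simp only [map_add, hp, hq]

/-- At the other end the last entry multiplies `t̂` on the right, hence acts on `x` from the left.
The induction works because the two actions on `X` commute. -/
theorem coactR_snocL (n : ℕ) (x : X k B) (t : ⨂[k]^n B) (a : B) :
    coactR k B (n + 1) x (snocL n t a) =
      sw k (fun u v => snocL n (coactR k B n (actL k B u x) t) v) a := by
  induction n generalizing x with
  | zero => simp [snocL_zero, coactR_consL, coactR_zero]
  | succ n ih =>
    induction t using consL_induction with
    | h c s =>
      simp only [snocL_consL, coactR_consL, ih, map_sw, sw_apply, actL_actR]
      exact sw_sw_comm _ _ _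
    | hadd x y hx hy => simp only [map_add, LinearMap.add_apply, hx, hy, sw_add_fun]
    | hsmul c x hx => simp only [map_smul, LinearMap.smul_apply, hx, sw_smul_fun]

theorem coactL_snocL (n : ℕ) (x : X k B) (t : ⨂[k]^n B) (a : B) :
    coactL k B (n + 1) x (snocL n t a) =
      sw k (fun u v => snocL n (coactL k B n (actL k B v x) t) u) a := by
  induction n generalizing x with
  | zero => simp [snocL_zero, coactL_consL, coactL_zero]
  | succ n ih =>
    induction t using consL_induction with
    | h c s =>
      simp only [snocL_consL, coactL_consL, ih, map_sw, sw_apply, actL_actR]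
      exact sw_sw_comm _ _ _
    | hadd x y hx hy => simp only [map_add, LinearMap.add_apply, hx, hy, sw_add_fun]
    | hsmul c x hx => simp only [map_smul, LinearMap.smul_apply, hx, sw_smul_fun]

/-- Coassociativity of `B`: applying `y` after `x` pairs `x` with the first and `y` with the second
of three coproduct factors. -/
theorem coactR_mulX (n : ℕ) (x y : X k B) (t : ⨂[k]^n B) :
    coactR k B n (mulX k B x y) t = coactR k B n y (coactR k B n x t) := by
  induction n generalizing x y with
  | zero =>
    rw [coactR_zero, coactR_zero, coactR_zero, mulX_apply, sw_one (isBilin_mul_apply x y), mul_comm,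
      smul_smul]
  | succ n ih =>
    induction t using consL_induction with
    | h a s =>
      simp only [coactR_consL, actR_mulX, map_sw, sw_apply, ih]
      exact sw_sw_left (F := fun u v w => consL n w
        (coactR k B n (actR k B v y) (coactR k B n (actR k B u x) s)))
        (.of (fun _ _ => ⟨by simp, by simp⟩) (fun _ _ => ⟨by simp, by simp⟩)
          (fun _ _ => ⟨by simp, by simp⟩)) a
    | hadd x y hx hy => simp only [map_add, hx, hy]
    | hsmul c x hx => simp only [map_smul, hx]

theorem coactL_mulX (n : ℕ) (x y : X k B) (t : ⨂[k]^n B) :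
    coactL k B n (mulX k B x y) t = coactL k B n x (coactL k B n y t) := by
  induction n generalizing x y with
  | zero =>
    rw [coactL_zero, coactL_zero, coactL_zero, mulX_apply, sw_one (isBilin_mul_apply x y), smul_smul]
  | succ n ih =>
    induction t using consL_induction with
    | h a s =>
      simp only [coactL_consL, actR_mulX, map_sw, sw_apply, ih]
      exact (sw_sw_left (F := fun u v w => consL n u
        (coactL k B n (actR k B v x) (coactL k B n (actR k B w y) s)))
        (.of (fun _ _ => ⟨by simp, by simp⟩) (fun _ _ => ⟨by simp, by simp⟩)
          (fun _ _ => ⟨by simp, by simp⟩)) a).symm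
    | hadd x y hx hy => simp only [map_add, hx, hy]
    | hsmul c x hx => simp only [map_smul, hx]

theorem coactL_coactR (n : ℕ) (x y : X k B) (t : ⨂[k]^n B) :
    coactL k B n x (coactR k B n y t) = coactR k B n y (coactL k B n x t) := by
  induction n generalizing x y with
  | zero => simp [coactL_zero, coactR_zero, smul_smul, mul_comm]
  | succ n ih =>
    induction t using consL_induction with
    | h a s =>
      simp only [coactL_consL, coactR_consL, map_sw, ih]
      exact (sw_sw_left (F := fun u v w => consL n v
        (coactR k B n (actR k B u y) (coactL k B n (actR k B w x) s)))
        (.of (fun _ _ => ⟨by simp, by simp⟩) (fun _ _ => ⟨by simp, by simp⟩)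
          (fun _ _ => ⟨by simp, by simp⟩)) a).symm
    | hadd x y hx hy => simp only [map_add, hx, hy]
    | hsmul c x hx => simp only [map_smul, hx]

theorem coactR_oneX (n : ℕ) (t : ⨂[k]^n B) : coactR k B n (oneX k B) t = t := by
  induction n with
  | zero => simp [coactR_zero, oneX_apply]
  | succ n ih =>
    induction t using consL_induction with
    | h a s =>
      simp only [coactR_consL, actR_oneX, map_smul, LinearMap.smul_apply, ih]
      exact sw_counit_left (f := fun v => consL n v s) ⟨by simp, by simp⟩ a
    | hadd x y hx hy => simp only [map_add, hx, hy]
    | hsmul c x hx => simp only [map_smul, hx]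

theorem coactL_oneX (n : ℕ) (t : ⨂[k]^n B) : coactL k B n (oneX k B) t = t := by
  induction n with
  | zero => simp [coactL_zero, oneX_apply]
  | succ n ih =>
    induction t using consL_induction with
    | h a s =>
      simp only [coactL_consL, actR_oneX, map_smul, LinearMap.smul_apply, ih]
      exact sw_counit_right (f := fun v => consL n v s) ⟨by simp, by simp⟩ a
    | hadd x y hx hy => simp only [map_add, hx, hy]
    | hsmul c x hx => simp only [map_smul, hx]

/-- The coproduct is multiplicative, so splitting a product `ab` gives `x^{a₁ b₁}`, which is the
action of `b₁` after that of `a₁`. -/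
theorem coactR_ctr (n j : ℕ) (x : X k B) (t : ⨂[k]^(n + 1) B) :
    coactR k B n x (ctr (LinearMap.mul k B) n j t) =
      ctr (LinearMap.mul k B) n j (coactR k B (n + 1) x t) := by
  induction n generalizing j x with
  | zero => simp [ctr]
  | succ n ih =>
    induction t using consL_induction with
    | h a s =>
      rcases j with _ | j
      · induction s using consL_induction with
        | h b s =>
          simp only [ctr_zero_consL, coactR_consL, map_sw, LinearMap.mul_apply']
          rw [sw_mul ⟨fun _ => ⟨by simp, by simp⟩, fun _ => ⟨by simp, by simp⟩⟩]
          simp only [actR_mul]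
        | hadd x y hx hy => simp only [map_add, hx, hy]
        | hsmul c x hx => simp only [map_smul, hx]
      · simp only [ctr_succ_consL, coactR_consL, ih, map_sw]
    | hadd x y hx hy => simp only [map_add, hx, hy]
    | hsmul c x hx => simp only [map_smul, hx]

theorem coactL_ctr (n j : ℕ) (x : X k B) (t : ⨂[k]^(n + 1) B) :
    coactL k B n x (ctr (LinearMap.mul k B) n j t) =
      ctr (LinearMap.mul k B) n j (coactL k B (n + 1) x t) := by
  induction n generalizing j x with
  | zero => simp [ctr]
  | succ n ih =>
    induction t using consL_induction with
    | h a s =>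
      rcases j with _ | j
      · induction s using consL_induction with
        | h b s =>
          simp only [ctr_zero_consL, coactL_consL, map_sw, LinearMap.mul_apply']
          rw [sw_mul ⟨fun _ => ⟨by simp, by simp⟩, fun _ => ⟨by simp, by simp⟩⟩]
          simp only [actR_mul]
        | hadd x y hx hy => simp only [map_add, hx, hy]
        | hsmul c x hx => simp only [map_smul, hx]
      · simp only [ctr_succ_consL, coactL_consL, ih, map_sw]
    | hadd x y hx hy => simp only [map_add, hx, hy]
    | hsmul c x hx => simp only [map_smul, hx]

theorem coactR_ins (n j : ℕ) (x : X k B) (t : ⨂[k]^n B) :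
    coactR k B (n + 1) x (ins 1 n j t) = ins 1 n j (coactR k B n x t) := by
  induction j generalizing n x with
  | zero =>
    simp only [ins_zero, coactR_consL]
    rw [sw_one ⟨fun _ => ⟨by simp, by simp⟩, fun _ => ⟨by simp, by simp⟩⟩, actR_one]
  | succ j ih =>
    rcases n with _ | n
    · simp [ins]
    · induction t using consL_induction with
      | h m s => simp only [ins_succ_consL, coactR_consL, map_sw, ih]
      | hadd x y hx hy => simp only [map_add, hx, hy]
      | hsmul c x hx => simp only [map_smul, hx]

theorem coactL_ins (n j : ℕ) (x : X k B) (t : ⨂[k]^n B) :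
    coactL k B (n + 1) x (ins 1 n j t) = ins 1 n j (coactL k B n x t) := by
  induction j generalizing n x with
  | zero =>
    simp only [ins_zero, coactL_consL]
    rw [sw_one ⟨fun _ => ⟨by simp, by simp⟩, fun _ => ⟨by simp, by simp⟩⟩, actR_one]
  | succ j ih =>
    rcases n with _ | n
    · simp [ins]
    · induction t using consL_induction with
      | h m s => simp only [ins_succ_consL, coactL_consL, map_sw, ih]
      | hadd x y hx hy => simp only [map_add, hx, hy]
      | hsmul c x hx => simp only [map_smul, hx]

end XActions


end
end BialgebraCohomology

namespace BialgebraCohomology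
noncomputable section
universe u v w
set_option linter.unusedSectionVars false

/-! ### The cosimplicial bicomplex -/

section Bicomplex

variable {k : Type u} [Field k] {B : Type v} [Ring B] [HopfAlgebra k B]

variable (k B) in
/-- The faces in the first direction, indexed by natural numbers; zero if out of range. -/
def fX (p q i : ℕ) : XB k B (p + 1) q →ₗ[k] XB k B p q :=
  if h : i < p + 2 then faceX k B p q ⟨i, h⟩ else 0

variable (k B) in
/-- The faces in the second direction, indexed by natural numbers; zero if out of range. -/
def fB (p q i : ℕ) : XB k B p (q + 1) →ₗ[k] XB k B p q :=
  if h : i < q + 2 then faceB k B p q ⟨i, h⟩ else 0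

variable (k B) in
/-- The degeneracies in the first direction. -/
def degX (p q j : ℕ) : XB k B p q →ₗ[k] XB k B (p + 1) q := (ins (oneX k B) p j).rTensor _

variable (k B) in
/-- The degeneracies in the second direction. -/
def degB (p q j : ℕ) : XB k B p q →ₗ[k] XB k B p (q + 1) := (ins 1 q j).lTensor _

theorem fX_consL (p q : ℕ) (x : X k B) (s : ⨂[k]^p (X k B)) (t : ⨂[k]^q B) :
    fX k B p q 0 (consL p x s ⊗ₜ t) = s ⊗ₜ coactR k B q x t := by
  rw [fX, dif_pos (by omega), faceX, dif_pos (by rfl)]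
  simp

theorem fX_snocL (p q : ℕ) (s : ⨂[k]^p (X k B)) (x : X k B) (t : ⨂[k]^q B) :
    fX k B p q (p + 1) (snocL p s x ⊗ₜ t) = s ⊗ₜ coactL k B q x t := by
  rw [fX, dif_pos (by omega), faceX, dif_neg (by simp), dif_pos (by rfl)]
  simp

theorem fX_ctr (p q j : ℕ) (h : j < p) (s : ⨂[k]^(p + 1) (X k B)) (t : ⨂[k]^q B) :
    fX k B p q (j + 1) (s ⊗ₜ t) = ctr (mulX k B) p j s ⊗ₜ t := by
  rw [fX, dif_pos (by omega), faceX, dif_neg (by simp), dif_neg (by simp [Fin.ext_iff]; omega),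
    ctr, dif_pos h]
  rfl

theorem fB_consL (p q : ℕ) (s : ⨂[k]^p (X k B)) (a : B) (t : ⨂[k]^q B) :
    fB k B p q 0 (s ⊗ₜ consL q a t) = diagR k B p a s ⊗ₜ t := by
  rw [fB, dif_pos (by omega), faceB, dif_pos (by rfl)]
  simp

theorem fB_snocL (p q : ℕ) (s : ⨂[k]^p (X k B)) (t : ⨂[k]^q B) (a : B) :
    fB k B p q (q + 1) (s ⊗ₜ snocL q t a) = diagL k B p a s ⊗ₜ t := by
  rw [fB, dif_pos (by omega), faceB, dif_neg (by simp), dif_pos (by rfl)]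
  simp

theorem fB_ctr (p q j : ℕ) (h : j < q) (s : ⨂[k]^p (X k B)) (t : ⨂[k]^(q + 1) B) :
    fB k B p q (j + 1) (s ⊗ₜ t) = s ⊗ₜ ctr (LinearMap.mul k B) q j t := by
  rw [fB, dif_pos (by omega), faceB, dif_neg (by simp), dif_neg (by simp [Fin.ext_iff]; omega),
    ctr, dif_pos h]
  rfl

theorem ctrSeq_eq_faceSeq {A : Type*} [AddCommMonoid A] [Module k A] (mul : A →ₗ[k] A →ₗ[k] A)
    (j : ℕ) (m : ℕ → A) : ctrSeq mul j m = faceSeq mul (j + 1) m := by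
  funext l; simp [ctrSeq, faceSeq]

theorem diagL_mul (n : ℕ) (a b : B) (s : ⨂[k]^n (X k B)) :
    diagL k B n (a * b) s = diagL k B n a (diagL k B n b s) := diagAct_mul actL_mul n a b s

theorem diagR_mul (n : ℕ) (a b : B) (s : ⨂[k]^n (X k B)) :
    diagR k B n (a * b) s = diagR k B n b (diagR k B n a s) := diagAct_mul_right actR_mul n a b s

theorem diagL_one (n : ℕ) (s : ⨂[k]^n (X k B)) : diagL k B n 1 s = s := diagAct_one actL_one n s

theorem diagR_one (n : ℕ) (s : ⨂[k]^n (X k B)) : diagR k B n 1 s = s := diagAct_one actR_one n s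

theorem diagL_diagR (n : ℕ) (a b : B) (s : ⨂[k]^n (X k B)) :
    diagL k B n a (diagR k B n b s) = diagR k B n b (diagL k B n a s) :=
  diagAct_comm actL_actR n a b s

theorem diagL_consL (n : ℕ) (b : B) (x : X k B) (s : ⨂[k]^n (X k B)) :
    diagL k B (n + 1) b (consL n x s) =
      sw k (fun u v => consL n (actL k B u x) (diagL k B n v s)) b := diagAct_consL _ n b x s

theorem diagR_consL (n : ℕ) (b : B) (x : X k B) (s : ⨂[k]^n (X k B)) :
    diagR k B (n + 1) b (consL n x s) =
      sw k (fun u v => consL n (actR k B u x) (diagR k B n v s)) b := diagAct_consL _ n b x s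

theorem diagL_snocL (n : ℕ) (b : B) (s : ⨂[k]^n (X k B)) (x : X k B) :
    diagL k B (n + 1) b (snocL n s x) =
      sw k (fun u v => snocL n (diagL k B n u s) (actL k B v x)) b := diagAct_snocL _ n b s x

theorem diagR_snocL (n : ℕ) (b : B) (s : ⨂[k]^n (X k B)) (x : X k B) :
    diagR k B (n + 1) b (snocL n s x) =
      sw k (fun u v => snocL n (diagR k B n u s) (actR k B v x)) b := diagAct_snocL _ n b s x

/-- For fixed `q`, the `X`-direction is the bar complex of `X` with coefficients in the bimodule
`B^q`. All cosimplicial identities in this direction come from the general ones. -/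
theorem isBar_X (q : ℕ) : IsBar (mulX k B) (oneX k B) (coactL k B q) (coactR k B q)
    (fun p => (TensorProduct.mk k (⨂[k]^p (X k B)) (⨂[k]^q B)).flip) (fun p => fX k B p q)
    (fun p => degX k B p q) where
  mul_assoc := mulX_assoc
  one_mul := oneX_mulX
  mul_one := mulX_oneX
  l_mul := coactL_mulX q
  r_mul := coactR_mulX q
  l_one := coactL_oneX q
  r_one := coactR_oneX q
  comm := coactL_coactR q
  span h := TensorProduct.ext (hom_ext_pure fun m => LinearMap.ext fun v => h v m)
  face n i v m hi := by
    simp only [LinearMap.flip_apply, TensorProduct.mk_apply]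
    rcases i with _ | i
    · rw [pure_succ, fX_consL]; rfl
    · rcases eq_or_lt_of_le hi with hi | hi
      · obtain rfl : i = n := by omega
        rw [pure_succ_last, fX_snocL]
        simp only [faceCoeff, Nat.add_eq_zero_iff, one_ne_zero, and_false, if_false, if_true]
        congr 1
        exact pure_congr fun l hl => by simp [faceSeq, hl]
      · rw [fX_ctr _ _ _ (by omega), ctr_pure _ (by omega), ctrSeq_eq_faceSeq]
        simp [faceCoeff, show i ≠ n by omega]
  degen n j v m hj := by simp [degX, ins_pure _ hj]

/-- For fixed `p`, the `B`-direction is the bar complex of `B` with coefficients in the bimodule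
`X^p`. -/
theorem isBar_B (p : ℕ) : IsBar (LinearMap.mul k B) (1 : B) (diagL k B p) (diagR k B p)
    (fun q => TensorProduct.mk k (⨂[k]^p (X k B)) (⨂[k]^q B)) (fB k B p) (degB k B p) where
  mul_assoc := by simp [mul_assoc]
  one_mul := by simp
  mul_one := by simp
  l_mul := diagL_mul p
  r_mul := diagR_mul p
  l_one := diagL_one p
  r_one := diagR_one p
  comm := diagL_diagR p
  span h := TensorProduct.ext (LinearMap.ext fun v => hom_ext_pure fun m => h v m)
  face n i v m hi := by
    simp only [TensorProduct.mk_apply]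
    rcases i with _ | i
    · rw [pure_succ, fB_consL]; rfl
    · rcases eq_or_lt_of_le hi with hi | hi
      · obtain rfl : i = n := by omega
        rw [pure_succ_last, fB_snocL]
        simp only [faceCoeff, Nat.add_eq_zero_iff, one_ne_zero, and_false, if_false, if_true]
        congr 1
        exact pure_congr fun l hl => by simp [faceSeq, hl]
      · rw [fB_ctr _ _ _ (by omega), ctr_pure _ (by omega), ctrSeq_eq_faceSeq]
        simp [faceCoeff, show i ≠ n by omega]
  degen n j v m hj := by simp [degB, ins_pure _ hj]

variable {W : Type*} [AddCommMonoid W] [Module k W]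

theorem consL_consL_ext {p q : ℕ} {f g : XB k B (p + 1) (q + 1) →ₗ[k] W}
    (h : ∀ x s a t, f (consL p x s ⊗ₜ consL q a t) = g (consL p x s ⊗ₜ consL q a t)) : f = g :=
  TensorProduct.ext (hom_ext_consL fun x s => hom_ext_consL fun a t => h x s a t)

theorem consL_snocL_ext {p q : ℕ} {f g : XB k B (p + 1) (q + 1) →ₗ[k] W}
    (h : ∀ x s t a, f (consL p x s ⊗ₜ snocL q t a) = g (consL p x s ⊗ₜ snocL q t a)) : f = g :=
  TensorProduct.ext (hom_ext_consL fun x s => hom_ext_snocL fun t a => h x s t a)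

theorem snocL_consL_ext {p q : ℕ} {f g : XB k B (p + 1) (q + 1) →ₗ[k] W}
    (h : ∀ s x a t, f (snocL p s x ⊗ₜ consL q a t) = g (snocL p s x ⊗ₜ consL q a t)) : f = g :=
  TensorProduct.ext (hom_ext_snocL fun s x => hom_ext_consL fun a t => h s x a t)

theorem snocL_snocL_ext {p q : ℕ} {f g : XB k B (p + 1) (q + 1) →ₗ[k] W}
    (h : ∀ s x t a, f (snocL p s x ⊗ₜ snocL q t a) = g (snocL p s x ⊗ₜ snocL q t a)) : f = g :=
  TensorProduct.ext (hom_ext_snocL fun s x => hom_ext_snocL fun t a => h s x t a)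

theorem consL_left_ext {p q : ℕ} {f g : XB k B (p + 1) q →ₗ[k] W}
    (h : ∀ x s t, f (consL p x s ⊗ₜ t) = g (consL p x s ⊗ₜ t)) : f = g :=
  TensorProduct.ext (hom_ext_consL fun x s => LinearMap.ext fun t => h x s t)

theorem snocL_left_ext {p q : ℕ} {f g : XB k B (p + 1) q →ₗ[k] W}
    (h : ∀ s x t, f (snocL p s x ⊗ₜ t) = g (snocL p s x ⊗ₜ t)) : f = g :=
  TensorProduct.ext (hom_ext_snocL fun s x => LinearMap.ext fun t => h s x t)

theorem consL_right_ext {p q : ℕ} {f g : XB k B p (q + 1) →ₗ[k] W}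
    (h : ∀ s a t, f (s ⊗ₜ consL q a t) = g (s ⊗ₜ consL q a t)) : f = g :=
  TensorProduct.ext (LinearMap.ext fun s => hom_ext_consL fun a t => h s a t)

theorem snocL_right_ext {p q : ℕ} {f g : XB k B p (q + 1) →ₗ[k] W}
    (h : ∀ s t a, f (s ⊗ₜ snocL q t a) = g (s ⊗ₜ snocL q t a)) : f = g :=
  TensorProduct.ext (LinearMap.ext fun s => hom_ext_snocL fun t a => h s t a)

theorem tmul_ext {p q : ℕ} {f g : XB k B p q →ₗ[k] W}
    (h : ∀ s t, f (s ⊗ₜ t) = g (s ⊗ₜ t)) : f = g := TensorProduct.ext' h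

theorem diagL_ctr (n j : ℕ) (b : B) (s : ⨂[k]^(n + 1) (X k B)) :
    diagL k B n b (ctr (mulX k B) n j s) = ctr (mulX k B) n j (diagL k B (n + 1) b s) :=
  diagAct_ctr actL_mulX n j b s

theorem diagR_ctr (n j : ℕ) (b : B) (s : ⨂[k]^(n + 1) (X k B)) :
    diagR k B n b (ctr (mulX k B) n j s) = ctr (mulX k B) n j (diagR k B (n + 1) b s) :=
  diagAct_ctr actR_mulX n j b s

theorem diagL_ins (n j : ℕ) (b : B) (s : ⨂[k]^n (X k B)) :
    diagL k B (n + 1) b (ins (oneX k B) n j s) = ins (oneX k B) n j (diagL k B n b s) :=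
  diagAct_ins actL_oneX n j b s

theorem diagR_ins (n j : ℕ) (b : B) (s : ⨂[k]^n (X k B)) :
    diagR k B (n + 1) b (ins (oneX k B) n j s) = ins (oneX k B) n j (diagR k B n b s) :=
  diagAct_ins actR_oneX n j b s

/-! ### Compatibility of the two directions. -/

theorem fX_fB (p q i j : ℕ) (hi : i ≤ p + 1) (hj : j ≤ q + 1) :
    fX k B p q i ∘ₗ fB k B (p + 1) q j = fB k B p q j ∘ₗ fX k B p (q + 1) i := by
  rcases i with _ | i <;> rcases j with _ | j
  · refine consL_consL_ext fun x s a t => ?_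
    simp only [LinearMap.comp_apply, fB_consL, fX_consL, diagR_consL, coactR_consL, sw_tmul,
      tmul_sw, map_sw]
  · rcases eq_or_lt_of_le hj with hj | hj
    · obtain rfl : j = q := by omega
      refine consL_snocL_ext fun x s t a => ?_
      simp only [LinearMap.comp_apply, fB_snocL, fX_consL, diagL_consL, coactR_snocL, sw_tmul,
        tmul_sw, map_sw]
    · refine consL_left_ext fun x s t => ?_
      simp only [LinearMap.comp_apply, fB_ctr _ _ _ (show j < q by omega), fX_consL, coactR_ctr]
  · rcases eq_or_lt_of_le hi with hi | hi
    · obtain rfl : i = p := by omega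
      refine snocL_consL_ext fun s x a t => ?_
      simp only [LinearMap.comp_apply, fB_consL, fX_snocL, diagR_snocL, coactL_consL, sw_tmul,
        tmul_sw, map_sw]
    · refine consL_right_ext fun s a t => ?_
      simp only [LinearMap.comp_apply, fX_ctr _ _ _ (show i < p by omega), fB_consL, diagR_ctr]
  · rcases eq_or_lt_of_le hi with hi | hi <;> rcases eq_or_lt_of_le hj with hj | hj
    · obtain rfl : i = p := by omega
      obtain rfl : j = q := by omega
      refine snocL_snocL_ext fun s x t a => ?_
      simp only [LinearMap.comp_apply, fB_snocL, fX_snocL, diagL_snocL, coactL_snocL, sw_tmul,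
        tmul_sw, map_sw]
    · obtain rfl : i = p := by omega
      refine snocL_left_ext fun s x t => ?_
      simp only [LinearMap.comp_apply, fB_ctr _ _ _ (show j < q by omega), fX_snocL, coactL_ctr]
    · obtain rfl : j = q := by omega
      refine snocL_right_ext fun s t a => ?_
      simp only [LinearMap.comp_apply, fX_ctr _ _ _ (show i < p by omega), fB_snocL, diagL_ctr]
    · refine tmul_ext fun s t => ?_
      simp only [LinearMap.comp_apply, fX_ctr _ _ _ (show i < p by omega),
        fB_ctr _ _ _ (show j < q by omega)]

/-- The unit of `X` is acted on through the counit, so inserting it commutes with both diagonal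
actions. -/
theorem fB_degX (p q i j : ℕ) (hj : j ≤ q + 1) :
    fB k B (p + 1) q j ∘ₗ degX k B p (q + 1) i = degX k B p q i ∘ₗ fB k B p q j := by
  rcases j with _ | j
  · refine consL_right_ext fun s a t => ?_
    simp only [LinearMap.comp_apply, degX, LinearMap.rTensor_tmul, fB_consL, diagR_ins]
  · rcases eq_or_lt_of_le hj with hj | hj
    · obtain rfl : j = q := by omega
      refine snocL_right_ext fun s t a => ?_
      simp only [LinearMap.comp_apply, degX, LinearMap.rTensor_tmul, fB_snocL, diagL_ins]
    · refine tmul_ext fun s t => ?_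
      simp only [LinearMap.comp_apply, degX, LinearMap.rTensor_tmul,
        fB_ctr _ _ _ (show j < q by omega)]

theorem fX_degB (p q i j : ℕ) (hi : i ≤ p + 1) :
    fX k B p (q + 1) i ∘ₗ degB k B (p + 1) q j = degB k B p q j ∘ₗ fX k B p q i := by
  rcases i with _ | i
  · refine consL_left_ext fun x s t => ?_
    simp only [LinearMap.comp_apply, degB, LinearMap.lTensor_tmul, fX_consL, coactR_ins]
  · rcases eq_or_lt_of_le hi with hi | hi
    · obtain rfl : i = p := by omega
      refine snocL_left_ext fun s x t => ?_
      simp only [LinearMap.comp_apply, degB, LinearMap.lTensor_tmul, fX_snocL, coactL_ins]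
    · refine tmul_ext fun s t => ?_
      simp only [LinearMap.comp_apply, degB, LinearMap.lTensor_tmul,
        fX_ctr _ _ _ (show i < p by omega)]

theorem fX_fX (p q i j : ℕ) (hij : i ≤ j) (hj : j ≤ p + 1) :
    fX k B p q i ∘ₗ fX k B (p + 1) q (j + 1) = fX k B p q j ∘ₗ fX k B (p + 1) q i :=
  (isBar_X q).face_face p i j hij hj

theorem fB_fB (p q i j : ℕ) (hij : i ≤ j) (hj : j ≤ q + 1) :
    fB k B p q i ∘ₗ fB k B p (q + 1) (j + 1) = fB k B p q j ∘ₗ fB k B p (q + 1) i :=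
  (isBar_B p).face_face q i j hij hj

variable (k B) in
/-- The cosimplicial bicomplex `𝐂`. -/
abbrev bicomplex : BiCosimplicial.{max u v} where
  obj p q := Module.Dual k (XB k B p q)
  dX p q i := (fX k B p q i).dualMap.toAddMonoidHom
  dB p q i := (fB k B p q i).dualMap.toAddMonoidHom
  sX p q i := (degX k B p q i).dualMap.toAddMonoidHom
  sB p q i := (degB k B p q i).dualMap.toAddMonoidHom
  dX_dX p q i j x hij hj :=
    LinearMap.ext fun y => congrArg x (LinearMap.congr_fun (fX_fX p q i j hij hj) y)
  dB_dB p q i j x hij hj :=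
    LinearMap.ext fun y => congrArg x (LinearMap.congr_fun (fB_fB p q i j hij hj) y)
  sX_dX_lt p q i j x hij hj :=
    LinearMap.ext fun y => congrArg x (LinearMap.congr_fun ((isBar_X q).face_degen_lt p i j hij hj) y)
  sX_dX_self p q j x hj :=
    LinearMap.ext fun y => congrArg x (LinearMap.congr_fun ((isBar_X q).face_degen_self p j hj) y)
  sX_dX_succ p q j x hj :=
    LinearMap.ext fun y => congrArg x (LinearMap.congr_fun ((isBar_X q).face_degen_succ p j hj) y)
  sX_dX_gt p q i j x hij hi :=
    LinearMap.ext fun y => congrArg x (LinearMap.congr_fun ((isBar_X q).face_degen_gt p i j hij hi) y)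
  sB_dB_lt p q i j x hij hj :=
    LinearMap.ext fun y => congrArg x (LinearMap.congr_fun ((isBar_B p).face_degen_lt q i j hij hj) y)
  sB_dB_self p q j x hj :=
    LinearMap.ext fun y => congrArg x (LinearMap.congr_fun ((isBar_B p).face_degen_self q j hj) y)
  sB_dB_succ p q j x hj :=
    LinearMap.ext fun y => congrArg x (LinearMap.congr_fun ((isBar_B p).face_degen_succ q j hj) y)
  sB_dB_gt p q i j x hij hi :=
    LinearMap.ext fun y => congrArg x (LinearMap.congr_fun ((isBar_B p).face_degen_gt q i j hij hi) y)
  dX_dB p q i j x hi hj :=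
    LinearMap.ext fun y => congrArg x (LinearMap.congr_fun (fX_fB p q i j hi hj).symm y)
  sX_dB p q i j x _ hj :=
    LinearMap.ext fun y => congrArg x (LinearMap.congr_fun (fB_degX p q i j hj) y)
  sB_dX p q i j x hi _ :=
    LinearMap.ext fun y => congrArg x (LinearMap.congr_fun (fX_degB p q i j hi) y)

end Bicomplex
end
end BialgebraCohomology

namespace BialgebraCohomology
noncomputable section
universe u v w
set_option linter.unusedSectionVars false

/-! ### Maps induced on cohomology -/

section Induced

variable {k : Type u} [Field k]
variable {C : ℕ → Type v} [∀ n, AddCommGroup (C n)] [∀ n, Module k (C n)]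
variable {C' : ℕ → Type w} [∀ n, AddCommGroup (C' n)] [∀ n, Module k (C' n)]
variable {d : ∀ n, C n →ₗ[k] C (n + 1)} {d' : ∀ n, C' n →ₗ[k] C' (n + 1)} {n : ℕ}

theorem cohomologyClass_surjective (d : ∀ n, C n →ₗ[k] C (n + 1)) (n : ℕ) :
    Function.Surjective (cohomologyClass d n) := Submodule.mkQ_surjective _

theorem cohomologyClass_eq_iff (z z' : cocycles d n) :
    cohomologyClass d n z = cohomologyClass d n z' ↔ (z : C n) - z' ∈ coboundaries d n := by
  rw [← sub_eq_zero, ← map_sub]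
  exact Submodule.Quotient.mk_eq_zero _

theorem cohomologyClass_eq_zero_iff (z : cocycles d n) :
    cohomologyClass d n z = 0 ↔ (z : C n) ∈ coboundaries d n :=
  Submodule.Quotient.mk_eq_zero _

theorem exists_isInducedBy (g : C n →ₗ[k] C' n) (hz : ∀ z ∈ cocycles d n, g z ∈ cocycles d' n)
    (hb : ∀ z ∈ coboundaries d n, g z ∈ coboundaries d' n) :
    ∃ h : Cohomology d n →ₗ[k] Cohomology d' n, IsInducedBy d d' n g h :=
  ⟨Submodule.mapQ _ _ (g.restrict hz) fun z h => hb z h, fun z => ⟨hz z z.2, rfl⟩⟩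

theorem IsInducedBy.bijective {g : C n →ₗ[k] C' n} {h : Cohomology d n →ₗ[k] Cohomology d' n}
    (hh : IsInducedBy d d' n g h)
    (hinj : ∀ z ∈ cocycles d n, g z ∈ coboundaries d' n → z ∈ coboundaries d n)
    (hsurj : ∀ z' ∈ cocycles d' n, ∃ z ∈ cocycles d n, z' - g z ∈ coboundaries d' n) :
    Function.Bijective h := by
  constructor
  · rw [injective_iff_map_eq_zero]
    intro c hc
    obtain ⟨z, rfl⟩ := cohomologyClass_surjective d n c
    obtain ⟨hz, e⟩ := hh z
    rw [e, cohomologyClass_eq_zero_iff] at hc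
    exact (cohomologyClass_eq_zero_iff z).mpr (hinj z z.2 hc)
  · intro c
    obtain ⟨z', rfl⟩ := cohomologyClass_surjective d' n c
    obtain ⟨z, hz, hb⟩ := hsurj z' z'.2
    refine ⟨cohomologyClass d n ⟨z, hz⟩, ?_⟩
    obtain ⟨hz', e⟩ := hh ⟨z, hz⟩
    rw [e, eq_comm, cohomologyClass_eq_iff]
    exact hb

theorem cocycles_of_comm {g : ∀ n, C n →ₗ[k] C' n} (h : ∀ n x, g (n + 1) (d n x) = d' n (g n x))
    (n : ℕ) (z : C n) (hz : z ∈ cocycles d n) : g n z ∈ cocycles d' n := by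
  rw [cocycles, LinearMap.mem_ker] at hz ⊢
  rw [← h, hz, map_zero]

theorem coboundaries_of_comm {g : ∀ n, C n →ₗ[k] C' n}
    (h : ∀ n x, g (n + 1) (d n x) = d' n (g n x)) (n : ℕ) (z : C n) (hz : z ∈ coboundaries d n) :
    g n z ∈ coboundaries d' n := by
  rcases n with _ | n
  · rw [coboundaries, Submodule.mem_bot] at hz
    rw [hz, map_zero]
    exact Submodule.zero_mem _
  · obtain ⟨y, rfl⟩ := hz
    exact ⟨g n y, (h n y).symm⟩

theorem exists_isInducedBy_of_comm {g : ∀ n, C n →ₗ[k] C' n}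
    (h : ∀ n x, g (n + 1) (d n x) = d' n (g n x)) (n : ℕ) :
    ∃ f : Cohomology d n →ₗ[k] Cohomology d' n, IsInducedBy d d' n (g n) f :=
  exists_isInducedBy _ (cocycles_of_comm h n) (coboundaries_of_comm h n)

theorem exists_equiv_isInducedBy {g : ∀ n, C n →ₗ[k] C' n}
    (h : ∀ n x, g (n + 1) (d n x) = d' n (g n x)) (n : ℕ)
    (hinj : ∀ z ∈ cocycles d n, g n z ∈ coboundaries d' n → z ∈ coboundaries d n)
    (hsurj : ∀ z' ∈ cocycles d' n, ∃ z ∈ cocycles d n, z' - g n z ∈ coboundaries d' n) :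
    ∃ f : Cohomology d n ≃ₗ[k] Cohomology d' n, IsInducedBy d d' n (g n) f.toLinearMap := by
  obtain ⟨f, hf⟩ := exists_isInducedBy_of_comm h n
  exact ⟨LinearEquiv.ofBijective f (hf.bijective hinj hsurj), hf⟩

/-- Only degreewise bijectivity is asked for; the inverse maps commute with the differentials
automatically. -/
theorem exists_equiv_isInducedBy_of_bijective {g : ∀ n, C n →ₗ[k] C' n}
    (h : ∀ n x, g (n + 1) (d n x) = d' n (g n x)) (hg : ∀ n, Function.Bijective (g n)) (n : ℕ) :
    ∃ f : Cohomology d n ≃ₗ[k] Cohomology d' n, IsInducedBy d d' n (g n) f.toLinearMap := by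
  refine exists_equiv_isInducedBy h n (fun z _ hb => ?_) (fun z' hz' => ?_)
  · rcases n with _ | n
    · exact (hg 0).1 (hb.trans (map_zero _).symm)
    · obtain ⟨y', hy'⟩ := hb
      obtain ⟨y, rfl⟩ := (hg n).2 y'
      exact ⟨y, (hg _).1 ((h n y).trans hy')⟩
  · obtain ⟨z, rfl⟩ := (hg n).2 z'
    refine ⟨z, (hg _).1 ?_, by rw [sub_self]; exact Submodule.zero_mem _⟩
    rw [h, map_zero]
    exact hz'

end Induced

/-! ### The total and the diagonal complexes of `𝐂` -/

section TotDiag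

variable {k : Type u} [Field k] {B : Type v} [Ring B] [HopfAlgebra k B]

theorem neg_one_pow_zsmul {V : Type*} [AddCommGroup V] [Module k V] (i : ℕ) (x : V) :
    (-1 : ℤ) ^ i • x = (-1 : k) ^ i • x := by
  rw [← Int.cast_smul_eq_zsmul k]
  simp

theorem bdryX_dualMap (p q : ℕ) (f : Module.Dual k (XB k B p q)) :
    (bdryX k B p q).dualMap f = (bicomplex k B).bX p q f := by
  rw [BiCosimplicial.bX_apply]
  refine LinearMap.ext fun y => ?_
  rw [Finset.sum_range]
  simp only [neg_one_pow_zsmul (k := k)]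
  rw [LinearMap.dualMap_apply, bdryX, LinearMap.sum_apply, map_sum]
  refine (Finset.sum_congr rfl fun i _ => ?_).trans (LinearMap.sum_apply _ _ _).symm
  rw [LinearMap.smul_apply, map_smul]
  change _ = (-1 : k) ^ (i : ℕ) • f (fX k B p q i y)
  rw [fX, dif_pos i.2]

theorem bdryB_dualMap (p q : ℕ) (f : Module.Dual k (XB k B p q)) :
    (bdryB k B p q).dualMap f = (bicomplex k B).bB p q f := by
  rw [BiCosimplicial.bB_apply]
  refine LinearMap.ext fun y => ?_
  rw [Finset.sum_range]
  simp only [neg_one_pow_zsmul (k := k)]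
  rw [LinearMap.dualMap_apply, bdryB, LinearMap.sum_apply, map_sum]
  refine (Finset.sum_congr rfl fun i _ => ?_).trans (LinearMap.sum_apply _ _ _).symm
  rw [LinearMap.smul_apply, map_smul]
  change _ = (-1 : k) ^ (i : ℕ) • f (fB k B p q i y)
  rw [fB, dif_pos i.2]

theorem diagD_eq (n : ℕ) (f : Module.Dual k (XB k B n n)) :
    diagD k B n f = (bicomplex k B).bD n f := by
  rw [BiCosimplicial.bD_apply]
  refine LinearMap.ext fun y => ?_
  rw [Finset.sum_range]
  simp only [neg_one_pow_zsmul (k := k)]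
  rw [diagD, LinearMap.dualMap_apply, LinearMap.sum_apply, map_sum]
  refine (Finset.sum_congr rfl fun i _ => ?_).trans (LinearMap.sum_apply _ _ _).symm
  rw [LinearMap.smul_apply, map_smul]
  change _ = (-1 : k) ^ (i : ℕ) • f (fX k B n n i (fB k B (n + 1) n i y))
  rw [fX, fB, dif_pos i.2, dif_pos i.2]
  rfl

/-- The family of components of a total cochain, extended by zero. -/
def famOf {n : ℕ} (f : Tot k B n) : (bicomplex k B).Fam :=
  fun p q => if h : p + q = n then totProj k B n p q h f else 0

/-- The total cochain formed by the components of a family. -/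
def totOf (n : ℕ) (f : (bicomplex k B).Fam) : Tot k B n := fun pq => f pq.1.1 pq.1.2

theorem famOf_apply {n p q : ℕ} (f : Tot k B n) (h : p + q = n) :
    famOf f p q = totProj k B n p q h f := dif_pos h

theorem famOf_totOf {n p q : ℕ} (f : (bicomplex k B).Fam) (h : p + q = n) :
    famOf (totOf n f) p q = f p q := dif_pos h

theorem tot_ext {n : ℕ} {f g : Tot k B n}
    (h : ∀ p q e, totProj k B n p q e f = totProj k B n p q e g) : f = g := by
  funext ⟨⟨p, q⟩, e⟩
  exact h p q (Finset.HasAntidiagonal.mem_antidiagonal.mp e)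

theorem totProj_totD (n p q : ℕ) (h : p + q = n + 1) (f : Tot k B n) :
    totProj k B (n + 1) p q h (totD k B n f) = (bicomplex k B).totDiff (famOf f) p q := by
  change totDX k B n p q h f + totDB k B n p q h f = _
  rw [BiCosimplicial.totDiff]
  congr 1
  · rcases p with _ | p
    · rfl
    · rw [BiCosimplicial.raiseX_succ, famOf_apply f (by omega), ← bdryX_dualMap]
      rfl
  · rcases q with _ | q
    · rw [BiCosimplicial.raiseB_zero, smul_zero]
      rfl
    · rw [BiCosimplicial.raiseB_succ, famOf_apply f (by omega), ← bdryB_dualMap]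
      exact (neg_one_pow_zsmul (k := k) p ((bdryB k B p q).dualMap (totProj k B n p q (by omega) f))).symm

theorem lastX_pow_apply (f : (bicomplex k B).Fam) (p q m : ℕ) :
    ((bicomplex k B).lastX ^ m) f (p + m) q = (iterLastX k B p q m).dualMap (f p q) := by
  induction m with
  | zero => rfl
  | succ m ih =>
    rw [pow_succ', BiCosimplicial.end_mul_apply]
    change (fX k B (p + m) q (p + m + 1)).dualMap (((bicomplex k B).lastX ^ m) f (p + m) q) = _
    rw [ih, fX, dif_pos (by omega)]
    rfl

theorem zeroB_pow_apply (f : (bicomplex k B).Fam) (p q m : ℕ) :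
    ((bicomplex k B).zeroB ^ m) f p (q + m) = (iterZeroB k B p q m).dualMap (f p q) := by
  induction m with
  | zero => rfl
  | succ m ih =>
    rw [pow_succ', BiCosimplicial.end_mul_apply]
    change (fB k B p (q + m) 0).dualMap (((bicomplex k B).zeroB ^ m) f p (q + m)) = _
    rw [ih, fB, dif_pos (by omega)]
    rfl

/-- The diagonal degree is `p + q`, while `p` zeroth faces starting from `B^q` end at `q + p`. This
accounts for the transport in `awFace`. -/
theorem zeroB_pow_apply_cast (f : (bicomplex k B).Fam) {p q m n : ℕ} (h : n = q + m) :
    ((bicomplex k B).zeroB ^ m) f p n = ((iterZeroB k B p q m) ∘ₗ TensorProduct.map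
      LinearMap.id (TensorPower.cast k B h).toLinearMap).dualMap (f p q) := by
  subst h
  rw [zeroB_pow_apply, TensorPower.cast_refl]
  refine LinearMap.ext fun y => ?_
  change _ = f p q (iterZeroB k B p q m (TensorProduct.map LinearMap.id LinearMap.id y))
  rw [TensorProduct.map_id]
  rfl

theorem alexanderWhitney_eq (n : ℕ) (f : Tot k B n) :
    alexanderWhitney k B n f = (bicomplex k B).aw n (famOf f) := by
  rw [alexanderWhitney, BiCosimplicial.aw, LinearMap.sum_apply]
  refine Eq.trans ?_ (Finset.sum_coe_sort _ _)
  refine Finset.sum_congr rfl ?_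
  rintro ⟨⟨p, q⟩, h⟩ -
  obtain rfl := Finset.HasAntidiagonal.mem_antidiagonal.mp h
  rw [BiCosimplicial.end_mul_apply, zeroB_pow_apply_cast _ (Nat.add_comm p q), lastX_pow_apply,
    famOf_apply f rfl]
  simp only [LinearMap.comp_apply, awFace]
  rw [TensorPower.cast_refl]
  rfl

theorem alexanderWhitney_totD (n : ℕ) (f : Tot k B n) :
    alexanderWhitney k B (n + 1) (totD k B n f) = diagD k B n (alexanderWhitney k B n f) := by
  rw [diagD_eq, alexanderWhitney_eq, alexanderWhitney_eq, BiCosimplicial.bD_aw]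
  refine BiCosimplicial.aw_congr _ fun p q h => ?_
  rw [famOf_apply _ h, totProj_totD]

theorem totProj_totD_totOf (n p q : ℕ) (h : p + q = n + 1) (f : (bicomplex k B).Fam) :
    totProj k B (n + 1) p q h (totD k B n (totOf n f)) = (bicomplex k B).totDiff f p q := by
  rw [totProj_totD]
  exact BiCosimplicial.totDiff_congr _ (fun p q h => famOf_totOf f h) p q h

theorem exists_equiv_alexanderWhitney (n : ℕ) :
    ∃ f : Cohomology (totD k B) n ≃ₗ[k] Cohomology (diagD k B) n,
      IsInducedBy (totD k B) (diagD k B) n (alexanderWhitney k B n) f.toLinearMap := by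
  obtain ⟨h₁, h₂⟩ := BiCosimplicial.aw_bijective n (bicomplex k B)
  have hbd : ∀ g : Module.Dual k (XB k B n n),
      (bicomplex k B).IsDiagBdry n g ↔ g ∈ coboundaries (diagD k B) n := by
    intro g
    rcases n with _ | n
    · exact (Submodule.mem_bot k).symm
    · exact exists_congr fun h => by rw [diagD_eq]
  refine exists_equiv_isInducedBy alexanderWhitney_totD n (fun z hz hb => ?_) (fun z' hz' => ?_)
  · have := h₂ (famOf z) (fun p q h => ?_) ((hbd _).mpr ?_)
    · rcases n with _ | n
      · refine (Submodule.mem_bot k).mpr (tot_ext fun p q e => ?_)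
        obtain ⟨rfl, rfl⟩ : p = 0 ∧ q = 0 := by omega
        exact (famOf_apply z e).symm.trans this
      · obtain ⟨y, hy⟩ := this
        refine ⟨totOf n y, tot_ext fun p q e => ?_⟩
        rw [totProj_totD_totOf, hy p q e, famOf_apply z e]
    · rw [← totProj_totD n p q h, hz, map_zero]
    · rw [← alexanderWhitney_eq]
      exact hb
  · obtain ⟨f, hf, hb⟩ := h₁ z' (by rw [← diagD_eq]; exact hz')
    refine ⟨totOf n f, tot_ext fun p q e => ?_, ?_⟩
    · rw [totProj_totD_totOf, hf p q e, map_zero]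
    · rw [← hbd, alexanderWhitney_eq,
        BiCosimplicial.aw_congr _ fun p q h => famOf_totOf f h]
      exact hb

end TotDiag
end
end BialgebraCohomology

namespace BialgebraCohomology
noncomputable section
universe u v w
set_option linter.unusedSectionVars false

/-! ### The antipode of a finite dimensional Hopf algebra is bijective -/

section Antipode

variable {k : Type u} [Field k] {B : Type v} [Ring B] [HopfAlgebra k B]
variable {W : Type*} [AddCommMonoid W] [Module k W]

open HopfAlgebra (antipode)

/-- In the convolution algebra of maps `B → B ⊗ B`, both `Δ ∘ S` and `h ↦ S(h₂) ⊗ S(h₁)` are inverse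
to `Δ`, the former on the right and the latter on the left. Hence they coincide. -/
theorem comul_antipode (h : B) :
    Coalgebra.comul (R := k) (antipode k h) =
      sw k (fun u v => antipode k v ⊗ₜ[k] antipode k u) h := by
  let G : B →ₗ[k] B ⊗[k] B := TensorProduct.map (antipode k) (antipode k) ∘ₗ
    (TensorProduct.comm k B B).toLinearMap ∘ₗ Coalgebra.comul
  have hG : ∀ h, G h = sw k (fun u v => antipode k v ⊗ₜ[k] antipode k u) h := fun h => by
    simp only [G, LinearMap.comp_apply, comul_eq_sw, map_sw]
    rfl
  have key : WithConv.toConv G * WithConv.toConv (Coalgebra.comul (R := k) (A := B)) = 1 := by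
    ext h
    rw [(Coalgebra.Repr.arbitrary k h).convMul_apply]
    change sw k (fun u v => G u * Coalgebra.comul (R := k) v) h = _
    have e : ∀ u v, G u * Coalgebra.comul (R := k) v =
        sw k (fun p q => (antipode k q ⊗ₜ[k] antipode k p) * Coalgebra.comul (R := k) v) u :=
      fun u v => by rw [hG]; exact Finset.sum_mul _ _ _
    simp only [e]
    rw [sw_sw_left (F := fun p q v : B =>
      (antipode k q ⊗ₜ[k] antipode k p) * Coalgebra.comul (R := k) v)
      (.of (fun _ _ => ⟨by simp [TensorProduct.tmul_add, add_mul], by simp⟩)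
        (fun _ _ => ⟨by simp [TensorProduct.add_tmul, add_mul], by simp [← TensorProduct.smul_tmul']⟩)
        (fun _ _ => ⟨by simp [mul_add], by simp⟩))]
    -- In `S(h₂)h₃ ⊗ S(h₁)h₄` the inner pair cancels, leaving `1 ⊗ S(h₁)h₂`, which cancels in turn.
    have e2 : ∀ p w : B, sw k (fun q v : B => (antipode k q ⊗ₜ[k] antipode k p) *
        Coalgebra.comul (R := k) v) w = 1 ⊗ₜ[k] (antipode k p * w) := fun p w => by
      have e3 : ∀ q v : B, (antipode k q ⊗ₜ[k] antipode k p) * Coalgebra.comul (R := k) v =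
          sw k (fun r s => (antipode k q * r) ⊗ₜ[k] (antipode k p * s)) v := fun q v => by
        rw [comul_eq_sw]
        simp only [sw, Finset.mul_sum, Algebra.TensorProduct.tmul_mul_tmul]
      simp only [e3]
      rw [← sw_sw_left (F := fun q r s : B => (antipode k q * r) ⊗ₜ[k] (antipode k p * s))
        (.of (fun _ _ => ⟨by simp [TensorProduct.add_tmul, add_mul],
            by simp [← TensorProduct.smul_tmul']⟩)
          (fun _ _ => ⟨by simp [TensorProduct.add_tmul, mul_add],
            by simp [← TensorProduct.smul_tmul']⟩)
          (fun _ _ => ⟨by simp [TensorProduct.tmul_add, mul_add], by simp⟩))]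
      have e4 : ∀ u s : B, sw k (fun q r => (antipode k q * r) ⊗ₜ[k] (antipode k p * s)) u =
          Coalgebra.counit (R := k) u • (1 : B) ⊗ₜ[k] (antipode k p * s) := fun u s =>
        sw_antipode_mul (f := fun z : B => z ⊗ₜ[k] (antipode k p * s))
          ⟨by simp [TensorProduct.add_tmul], by simp [← TensorProduct.smul_tmul']⟩ u
      simp only [e4]
      exact sw_counit_left (f := fun s : B => (1 : B) ⊗ₜ[k] (antipode k p * s))
        ⟨by simp [TensorProduct.tmul_add, mul_add], by simp⟩ w
    simp only [e2]
    rw [sw_antipode_mul (f := fun z : B => (1 : B) ⊗ₜ[k] z)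
      ⟨by simp [TensorProduct.tmul_add], by simp⟩ h]
    rw [LinearMap.convOne_apply]
    simp [Algebra.algebraMap_eq_smul_one, Algebra.TensorProduct.one_def]
  have := left_inv_eq_right_inv key LinearMap.comul_right_inv
  have := congrArg (fun f => f.ofConv h) this
  exact this.symm.trans (hG h)

theorem sw_antipode {F : B → B → W} (hF : IsBilin k F) (h : B) :
    sw k F (antipode k h) = sw k (fun u v => F (antipode k v) (antipode k u)) h := by
  rw [sw_eq hF, comul_antipode, map_sw]
  rfl

/-- The antipode applied to `∑ h₁ S(h₂) = ε(h)`. -/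
theorem sw_antipode_mul_antipode {f : B → W} (hf : IsLin k f) (h : B) :
    sw k (fun u v => f (antipode k (antipode k v) * antipode k u)) h =
      Coalgebra.counit (R := k) h • f 1 := by
  simp only [← HopfAlgebra.antipode_mul_antidistrib]
  have := sw_mul_antipode (k := k) (f := fun b : B => f (antipode k b))
    ⟨fun _ _ => by simp only [map_add, hf.add], fun _ _ => by simp only [map_smul, hf.smul]⟩ h
  rw [HopfAlgebra.antipode_one] at this
  exact this

theorem sw_antipode_mul_antipode' {f : B → W} (hf : IsLin k f) (h : B) :
    sw k (fun u v => f (antipode k v * antipode k (antipode k u))) h =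
      Coalgebra.counit (R := k) h • f 1 := by
  simp only [← HopfAlgebra.antipode_mul_antidistrib]
  have := sw_antipode_mul (k := k) (f := fun b : B => f (antipode k b))
    ⟨fun _ _ => by simp only [map_add, hf.add], fun _ _ => by simp only [map_smul, hf.smul]⟩ h
  rw [HopfAlgebra.antipode_one] at this
  exact this

/-- `x₁ φ(x₂ S(h)) = (x S(h₁))₁ φ((x S(h₁))₂) h₂`. -/
theorem sw_mul_antipode_shift (φ : Module.Dual k B) (x h : B) :
    sw k (fun u v => φ (v * antipode k h) • u) x =
      sw k (fun p q => sw k (fun u v => φ v • (u * q)) (x * antipode k p)) h := by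
  have hb : ∀ q, IsBilin k fun u v : B => φ v • (u * q) := fun q =>
    ⟨fun _ => ⟨by simp [add_mul], by simp [smul_smul, mul_comm]⟩,
      fun _ => ⟨by simp [add_smul], by simp [mul_smul]⟩⟩
  have hb' : ∀ a b q, IsBilin k fun u v : B => φ (b * v) • (a * u * q) := fun a b q =>
    ⟨fun _ => ⟨by simp [add_mul, mul_add], by simp [smul_smul, mul_comm]⟩,
      fun _ => ⟨by simp [add_smul, mul_add], by simp [mul_smul]⟩⟩
  simp only [sw_mul (hb _)]
  rw [sw_sw_comm]
  refine congrArg (fun F => sw k F x) (funext fun a => funext fun b => ?_)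
  simp only [sw_antipode (hb' _ _ _)]
  rw [sw_sw_left (F := fun p q r : B => φ (b * antipode k p) • (a * antipode k q * r))
    (.of (fun _ _ => ⟨by simp [add_smul, mul_add], by simp [mul_smul]⟩)
      (fun _ _ => ⟨by simp [mul_add, add_mul], by simp [smul_smul, mul_comm]⟩)
      (fun _ _ => ⟨by simp [mul_add], by simp [smul_smul, mul_comm]⟩))]
  -- As `Δ S(h₁)` reverses the order, the right-hand side is `φ(x₂ S(h₁)) x₁ S(h₂) h₃`, and `S(h₂)
  -- h₃` cancels.
  have e : ∀ p w : B, sw k (fun q r : B => φ (b * antipode k p) • (a * antipode k q * r)) w =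
      Coalgebra.counit (R := k) w • φ (b * antipode k p) • a := fun p w => by
    simp only [mul_assoc]
    rw [sw_antipode_mul (f := fun z : B => φ (b * antipode k p) • (a * z))
      ⟨by simp [mul_add], by simp [smul_smul, mul_comm]⟩, mul_one]
  simp only [e]
  exact (sw_counit_right (f := fun p : B => φ (b * antipode k p) • a)
    ⟨by simp [mul_add, add_smul], by simp [mul_smul]⟩ h).symm

/-! ### A nonzero integral obtained as a trace. -/

variable {ι : Type*} [Fintype ι] (b : Module.Basis ι k B)

theorem sum_coord_apply {f : B → W} (hf : IsLin k f) (z : B) :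
    ∑ i, b.coord i z • f (b i) = f z := by
  conv_rhs => rw [← b.sum_repr z]
  have := map_sum hf.toLin (fun i => b.repr z i • b i) Finset.univ
  simp only [map_smul] at this
  exact this.symm

/-- The functional `x ↦ ∑ᵢ eⁱ(x S²(eᵢ₁)) f(eᵢ₂)`. -/
def traceIntegral (f : Module.Dual k B) : Module.Dual k B :=
  ∑ i, sw k (fun u v => f v • actR k B 1 (actL k B (antipode k (antipode k u)) (b.coord i))) (b i)

theorem traceIntegral_apply (f : Module.Dual k B) (x : B) :
    traceIntegral b f x =
      ∑ i, sw k (fun u v => b.coord i (x * antipode k (antipode k u)) * f v) (b i) := by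
  simp only [traceIntegral, LinearMap.sum_apply, sw_dual_apply]
  simp [mul_comm]

theorem smul_sw (c : k) (F : B → B → W) (b : B) :
    c • sw k F b = sw k (fun u v => c • F u v) b := Finset.smul_sum

theorem sum_smul_sw {F : B → B → W} (hF : IsBilin k F) (z : B) :
    ∑ j, b.coord j z • sw k F (b j) = sw k F z := sum_coord_apply b (sw_isLin hF) z

theorem sum_sw_coord_smul {F : B → B → W} (hF : ∀ u, IsLin k (F u)) (z : B) :
    ∑ i, sw k (fun u v => b.coord i v • F u (b i)) z = sw k F z := by
  rw [sum_sw]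
  exact congrArg (fun F => sw k F z)
    (funext fun u => funext fun v => sum_coord_apply b (hF u) v)

theorem sw_sum {κ : Type*} (s : Finset κ) (F : κ → B → B → W) (b : B) :
    sw k (fun u v => ∑ i ∈ s, F i u v) b = ∑ i ∈ s, sw k (F i) b := (sum_sw s F b).symm

/-- The functional sends `x` to the trace of `y ↦ x S²(y₁) f(y₂)`. Coproduct factors of `x` can be
transferred to the basis vector by `sw_mul_antipode_shift`, and there they meet an antipode and
cancel. So the functional is an integral. -/
theorem traceIntegral_invariant (f : Module.Dual k B) (x : B) :
    sw k (fun u v => traceIntegral b f v • u) x = traceIntegral b f x • 1 := by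
  have hK : ∀ i y, IsBilin k fun u v : B => b.coord i v • (u * y) := fun i y =>
    ⟨fun _ => ⟨by simp [add_mul], by simp [smul_smul, mul_comm]⟩,
      fun _ => ⟨by simp [add_smul], by simp [mul_smul]⟩⟩
  -- The shift identity is applied to `S(p)`, whose coproduct is `S(p₂) ⊗ S(p₁)`. The element `x
  -- S²(p₂)` is then expanded in the basis `eⱼ`, so that the coproduct of `x` is replaced by that of
  -- `eⱼ`.
  have h1 : ∀ i p, sw k (fun u v => b.coord i (v * antipode k (antipode k p)) • u) x =
      ∑ j, sw k (fun u v => b.coord i v • sw k (fun p₁ p₂ =>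
        b.coord j (x * antipode k (antipode k p₂)) • (u * antipode k p₁)) p) (b j) := fun i p => by
    rw [sw_mul_antipode_shift, sw_antipode]
    · simp only [← sum_smul_sw b (hK i _) (x * _), smul_sw]
      rw [sw_sum]
      refine Finset.sum_congr rfl fun j _ => ?_
      rw [sw_sw_comm]
      simp only [smul_comm (b.coord i _)]
    · refine ⟨fun q => ⟨fun a c => ?_, fun c a => ?_⟩, fun p => ⟨fun a c => ?_, fun c a => ?_⟩⟩
      · rw [map_add, mul_add, (sw_isLin (hK i q)).add]
      · rw [map_smul, mul_smul_comm, (sw_isLin (hK i q)).smul]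
      · simp only [mul_add, smul_add, sw_add_fun]
      · simp only [mul_smul_comm, smul_comm _ c, sw_smul_fun]
  have hb : ∀ (j : ι) (u q : B), IsBilin k fun p₁ p₂ : B =>
      (b.coord j (x * antipode k (antipode k p₂)) * f q) • (u * antipode k p₁) := fun j u q =>
    ⟨fun _ => ⟨by simp [mul_add], by simp [smul_smul, mul_comm]⟩,
      fun _ => ⟨by simp [mul_add, add_mul, add_smul], by simp [mul_smul]⟩⟩
  have ht : ∀ (j : ι) (u : B), IsTrilin k fun p₁ p₂ q : B =>
      (b.coord j (x * antipode k (antipode k p₂)) * f q) • (u * antipode k p₁) := fun j u =>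
    .of (fun p₂ q => (hb j u q).left p₂) (fun p₁ q => (hb j u q).right p₁)
      (fun _ _ => ⟨by simp [mul_add, add_smul], by simp [smul_smul, mul_left_comm]⟩)
  have h2 : sw k (fun u v => traceIntegral b f v • u) x = ∑ j, ∑ i, sw k (fun u v =>
      b.coord i v • sw k (fun p q => sw k (fun p₁ p₂ =>
        (b.coord j (x * antipode k (antipode k p₂)) * f q) • (u * antipode k p₁)) p) (b i))
          (b j) := by
    simp only [traceIntegral_apply, Finset.sum_smul, sw_sum]
    rw [Finset.sum_comm]
    refine Finset.sum_congr rfl fun i _ => ?_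
    have e : ∀ u v : B, sw k (fun p q => b.coord i (v * antipode k (antipode k p)) * f q) (b i) • u
        = sw k (fun p q => f q • b.coord i (v * antipode k (antipode k p)) • u) (b i) := fun u v => by
      simp only [sw, Finset.sum_smul, smul_smul, mul_comm]
    simp only [e]
    rw [sw_sw_comm]
    simp only [← smul_sw, h1]
    simp only [Finset.smul_sum, smul_sw, sw_sum]
    refine Finset.sum_congr rfl fun j _ => ?_
    rw [sw_sw_comm]
    refine congrArg (fun F => sw k F (b j)) (funext fun u => funext fun v => ?_)
    refine congrArg (fun F => sw k F (b i)) (funext fun p => funext fun q => ?_)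
    refine congrArg (fun F => sw k F p) (funext fun p₁ => funext fun p₂ => ?_)
    simp only [smul_smul]
    congr 1
    ring
  rw [h2, traceIntegral_apply, Finset.sum_smul]
  refine Finset.sum_congr rfl fun j _ => ?_
  -- The sum over `i` has become a dual basis sum: it substitutes the second coproduct factor of
  -- `eⱼ` for `eᵢ`.
  rw [sum_sw_coord_smul b fun u => ?_]
  · have hg : IsBilin k fun p₂ q : B => b.coord j (x * antipode k (antipode k p₂)) * f q :=
      ⟨fun _ => ⟨by simp [mul_add, add_mul], by simp [mul_assoc]⟩,
        fun _ => ⟨by simp [mul_add], by simp [mul_left_comm]⟩⟩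
    have e : ∀ u v : B, sw k (fun p q => sw k (fun p₁ p₂ =>
        (b.coord j (x * antipode k (antipode k p₂)) * f q) • (u * antipode k p₁)) p) v =
        sw k (fun p₁ r => sw k (fun p₂ q => b.coord j (x * antipode k (antipode k p₂)) * f q) r •
          (u * antipode k p₁)) v := fun u v => by
      rw [sw_sw_left (ht j u) v]
      simp only [sw, Finset.sum_smul]
    refine (congrArg (fun F => sw k F (b j)) (funext fun u => funext fun v => e u v)).trans ?_
    -- The regrouping brings together the first coproduct factor of `eⱼ` and the antipode of the
    -- second. They cancel and leave the defining sum times `1`.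
    rw [← sw_sw_left (F := fun u p₁ r : B => sw k (fun p₂ q =>
      b.coord j (x * antipode k (antipode k p₂)) * f q) r • (u * antipode k p₁)) (.of
        (fun _ _ => ⟨by simp [add_mul], by simp [smul_smul, mul_comm]⟩)
        (fun _ _ => ⟨by simp [mul_add], by simp [smul_smul, mul_comm]⟩)
        (fun _ _ => ⟨fun _ _ => by rw [(sw_isLin hg).add, add_smul],
          fun _ _ => by rw [(sw_isLin hg).smul, smul_assoc]⟩))]
    have e' : ∀ t r : B, sw k (fun u p₁ => sw k (fun p₂ q =>
        b.coord j (x * antipode k (antipode k p₂)) * f q) r • (u * antipode k p₁)) t =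
        Coalgebra.counit (R := k) t • sw k (fun p₂ q =>
          b.coord j (x * antipode k (antipode k p₂)) * f q) r • (1 : B) := fun t r =>
      sw_mul_antipode (f := fun z : B => sw k (fun p₂ q =>
        b.coord j (x * antipode k (antipode k p₂)) * f q) r • z)
        ⟨by simp, by simp [smul_smul, mul_comm]⟩ t
    simp only [e']
    exact sw_counit_left (f := fun r : B => sw k (fun p₂ q =>
        b.coord j (x * antipode k (antipode k p₂)) * f q) r • (1 : B))
      ⟨fun _ _ => by rw [(sw_isLin hg).add, add_smul],
        fun _ _ => by rw [(sw_isLin hg).smul, smul_assoc]⟩ _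
  · exact sw_isLin ⟨fun q => sw_isLin (hb j u q), fun p => ⟨fun _ _ => by
      simp only [map_add, mul_add, add_smul, sw_add_fun], fun c _ => by
      simp only [map_smul, smul_eq_mul, mul_left_comm _ c, mul_smul, sw_smul_fun]⟩⟩

/-- The functionals `traceIntegral b f` do not all vanish. -/
theorem exists_traceIntegral_ne_zero : ∃ f, traceIntegral b f ≠ 0 := by
  by_contra! h
  have key : ∀ f : Module.Dual k B, f 1 = 0 := fun f => by
    -- This combination of values of the functionals is chosen to equal `f(1)`: the sum over `j`
    -- replaces `eⱼ` by a coproduct factor of `eᵢ`, giving `∑ eⁱ(S(eᵢ₂) S²(eᵢ₁)) f(eᵢ₃)`.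
    have h0 : ∑ j, sw k (fun u v => traceIntegral b (b.coord j) (antipode k u) * f v) (b j) = 0 := by
      simp [h, sw]
    have e : ∀ (i j : ι), sw k (fun u v => sw k (fun p q =>
        b.coord i (antipode k u * antipode k (antipode k p)) * b.coord j q) (b i) * f v) (b j) =
        sw k (fun p q => b.coord j q • sw k (fun u v =>
          b.coord i (antipode k u * antipode k (antipode k p)) * f v) (b j)) (b i) := fun i j => by
      simp only [sw, Finset.sum_mul, Finset.smul_sum]
      rw [Finset.sum_comm]
      simp only [smul_eq_mul, mul_comm, mul_left_comm]
    have hb : ∀ (i : ι) (p : B), IsBilin k fun u v : B =>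
        b.coord i (antipode k u * antipode k (antipode k p)) * f v := fun i p =>
      ⟨fun _ => ⟨by simp [add_mul], by simp [mul_assoc]⟩,
        fun _ => ⟨by simp [mul_add], by simp [mul_left_comm]⟩⟩
    simp only [traceIntegral_apply, Finset.sum_mul, sw_sum, e] at h0
    rw [Finset.sum_comm] at h0
    rw [← sum_coord_apply b (f := f) ⟨f.map_add, f.map_smul⟩ 1, ← h0]
    refine Finset.sum_congr rfl fun i _ => ?_
    rw [← sw_sum]
    have e1 : ∀ p q : B, ∑ j, b.coord j q • sw k (fun u v =>
        b.coord i (antipode k u * antipode k (antipode k p)) * f v) (b j) =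
        sw k (fun u v => b.coord i (antipode k u * antipode k (antipode k p)) * f v) q :=
      fun p q => sum_smul_sw b (hb i p) q
    simp only [e1]
    rw [← sw_sw_left (F := fun p u v : B =>
      b.coord i (antipode k u * antipode k (antipode k p)) * f v)
      (.of (fun _ _ => ⟨by simp [mul_add, add_mul], by simp [mul_assoc]⟩)
        (fun p v => (hb i p).left v) (fun p u => (hb i p).right u))]
    -- The argument of `eⁱ` collapses to `1`, so the total is `∑ eⁱ(1) f(eᵢ) = f(1)`.
    have e2 : ∀ t v : B, sw k (fun p u => b.coord i (antipode k u * antipode k (antipode k p)) * f v)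
        t = Coalgebra.counit (R := k) t • (b.coord i 1 * f v) := fun t v =>
      sw_antipode_mul_antipode' (f := fun z : B => b.coord i z * f v)
        ⟨by simp [add_mul], by simp [mul_assoc]⟩ t
    simp only [e2]
    exact (sw_counit_left (f := fun v : B => b.coord i 1 * f v)
      ⟨by simp [mul_add], by simp [mul_left_comm]⟩ _).symm
  have := key Coalgebra.counit
  simp at this

/-- Let `φ` be a nonzero integral. By the shift identity `∑ φ(y S(h₁)) h₂` depends on `h` only
through `S(h)`, so it vanishes when `S(h) = 0`. With `y` replaced by `x S²(h₂)` and the remaining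
factor renamed, `∑ φ(x S²(h₂) S(h₁)) h₃ = φ(x) h`, and hence `h = 0`. -/
theorem antipode_injective [FiniteDimensional k B] : Function.Injective (antipode k (A := B)) := by
  obtain ⟨f, hf⟩ := exists_traceIntegral_ne_zero (Module.finBasis k B)
  have hinv := traceIntegral_invariant (Module.finBasis k B) f
  generalize traceIntegral (Module.finBasis k B) f = φ at hf hinv
  obtain ⟨x, hx⟩ : ∃ x, φ x ≠ 0 := by
    by_contra! h
    exact hf (LinearMap.ext h)
  rw [injective_iff_map_eq_zero]
  intro h hh
  have h1 : ∀ y, sw k (fun p q => φ (y * antipode k p) • q) h = 0 := fun y => by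
    have e := sw_mul_antipode_shift φ y h
    have e' : ∀ z q : B, sw k (fun u v => φ v • (u * q)) z = φ z • q := fun z q => by
      have := congrArg (· * q) (hinv z)
      simp only [sw, Finset.sum_mul, smul_mul_assoc, one_mul] at this
      exact this
    simp only [e', hh, mul_zero, map_zero, zero_smul] at e
    rw [← e]
    simp [sw]
  have hL : ∀ j, IsBilin k fun q w : B => (Module.finBasis k B).coord j q • w := fun j =>
    ⟨fun _ => ⟨by simp [add_smul], by simp [mul_smul]⟩,
      fun _ => ⟨by simp, by simp [smul_smul, mul_comm]⟩⟩
  have h2 : ∀ j y, sw k (fun p r => φ (y * antipode k p) • sw k (fun q w =>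
      (Module.finBasis k B).coord j q • w) r) h = 0 := fun j y => by
    have := congrArg (sw_isLin (hL j)).toLin (h1 y)
    rw [map_sw, map_zero] at this
    simp only [map_smul] at this
    exact this
  -- The element put in place of `y` involves a coproduct factor of `h`. Expanding that factor in a
  -- basis reduces to the constant elements for which the vanishing is known.
  have h3 : ∀ p r : B, sw k (fun q w => φ (x * (antipode k (antipode k q) * antipode k p)) • w) r =
      ∑ j, φ (x * antipode k (antipode k (Module.finBasis k B j)) * antipode k p) •
        sw k (fun q w => (Module.finBasis k B).coord j q • w) r := fun p r => by
    simp only [smul_sw, sum_sw]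
    refine congrArg (fun F => sw k F r) (funext fun q => funext fun w => ?_)
    have := sum_coord_apply (Module.finBasis k B) (W := B)
      (f := fun q => φ (x * (antipode k (antipode k q) * antipode k p)) • w)
      ⟨by simp [add_mul, mul_add, add_smul], by simp [mul_smul]⟩ q
    rw [← this]
    exact Finset.sum_congr rfl fun j _ => by rw [smul_comm, mul_assoc]
  have h4 : φ x • h = 0 := by
    rw [← sw_counit_left (k := k) (f := fun w : B => φ x • w)
      ⟨by simp, by simp [smul_smul, mul_comm]⟩ h]
    have e : ∀ t w : B, Coalgebra.counit (R := k) t • φ x • w = sw k (fun p q =>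
        φ (x * (antipode k (antipode k q) * antipode k p)) • w) t := fun t w => by
      have := sw_antipode_mul_antipode (k := k) (f := fun z : B => φ (x * z) • w)
        ⟨by simp [mul_add, add_smul], by simp [mul_smul]⟩ t
      rw [this, mul_one]
    simp only [e]
    rw [sw_sw_left (F := fun p q w : B =>
      φ (x * (antipode k (antipode k q) * antipode k p)) • w)
      (.of (fun _ _ => ⟨by simp [mul_add, add_smul], by simp [mul_smul]⟩)
        (fun _ _ => ⟨by simp [mul_add, add_mul, add_smul], by simp [mul_smul]⟩)
        (fun _ _ => ⟨by simp, by simp [smul_smul, mul_comm]⟩))]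
    simp only [h3, sw_sum, h2, Finset.sum_const_zero]
  exact (smul_eq_zero.mp h4).resolve_left hx

theorem antipode_bijective [FiniteDimensional k B] : Function.Bijective (antipode k (A := B)) :=
  ⟨antipode_injective, LinearMap.injective_iff_surjective.mp antipode_injective⟩

theorem antipode_antipodeInv [FiniteDimensional k B] (b : B) :
    antipode k (antipodeInv k B b) = b := by
  rw [antipodeInv, dif_pos antipode_bijective]
  exact (LinearEquiv.ofBijective (antipode k (A := B)) antipode_bijective).apply_symm_apply b

theorem antipodeInv_antipode [FiniteDimensional k B] (b : B) :
    antipodeInv k B (antipode k b) = b :=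
  antipode_injective (antipode_antipodeInv _)

end Antipode

end
end BialgebraCohomology

namespace BialgebraCohomology
noncomputable section
universe u v w
set_option linter.unusedSectionVars false

/-! ### The Drinfeld double -/

section Double

variable {k : Type u} [Field k] {B : Type v} [Ring B] [HopfAlgebra k B]
variable {W : Type*} [AddCommMonoid W] [Module k W]

open HopfAlgebra (antipode)

theorem antipodeInv_one [FiniteDimensional k B] : antipodeInv k B 1 = 1 := by
  have := antipodeInv_antipode (k := k) (1 : B)
  rwa [HopfAlgebra.antipode_one] at this

/-- The inverse antipode is antimultiplicative; applied to `∑ S(h₁) h₂ = ε(h)` it gives this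
identity. -/
theorem sw_antipodeInv_mul [FiniteDimensional k B] {f : B → W} (hf : IsLin k f) (h : B) :
    sw k (fun u v => f (antipodeInv k B v * u)) h = Coalgebra.counit (R := k) h • f 1 := by
  have := sw_antipode_mul (k := k) (f := fun b : B => f (antipodeInv k B b))
    ⟨fun _ _ => by simp only [map_add, hf.add], fun _ _ => by simp only [map_smul, hf.smul]⟩ h
  rw [antipodeInv_one] at this
  rw [← this]
  refine congrArg (fun F => sw k F h) (funext fun u => funext fun v => congrArg f ?_)
  rw [← antipodeInv_antipode (k := k) (antipodeInv k B v * u),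
    HopfAlgebra.antipode_mul_antidistrib, antipode_antipodeInv]

theorem sw_mul_antipodeInv [FiniteDimensional k B] {f : B → W} (hf : IsLin k f) (h : B) :
    sw k (fun u v => f (v * antipodeInv k B u)) h = Coalgebra.counit (R := k) h • f 1 := by
  have := sw_mul_antipode (k := k) (f := fun b : B => f (antipodeInv k B b))
    ⟨fun _ _ => by simp only [map_add, hf.add], fun _ _ => by simp only [map_smul, hf.smul]⟩ h
  rw [antipodeInv_one] at this
  rw [← this]
  refine congrArg (fun F => sw k F h) (funext fun u => funext fun v => congrArg f ?_)
  rw [← antipodeInv_antipode (k := k) (v * antipodeInv k B u),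
    HopfAlgebra.antipode_mul_antidistrib, antipode_antipodeInv]

theorem antipodeInv_mul [FiniteDimensional k B] (a b : B) :
    antipodeInv k B (a * b) = antipodeInv k B b * antipodeInv k B a :=
  antipode_injective (k := k) (by simp [HopfAlgebra.antipode_mul_antidistrib, antipode_antipodeInv])

theorem flipMap_tmul (n : ℕ) (a : B) (s : ⨂[k]^n (X k B)) :
    flipMap k B n (a ⊗ₜ s) = sw k (fun p c => sw k (fun u v =>
      diagL k B n u (diagR k B n (antipodeInv k B c) s) ⊗ₜ[k] v) p) a := by
  simp only [flipMap, LinearMap.comp_apply, LinearMap.rTensor_tmul, comul_eq_sw, map_sw, sw_tmul,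
    LinearEquiv.coe_coe]
  simp only [← LinearEquiv.coe_coe]
  rfl

theorem actL_diag_one (a : B) (x : X k B) :
    diagL k B 1 a (PiTensorProduct.tprod k fun _ => x) =
      PiTensorProduct.tprod k fun _ => actL k B a x := by
  have h : ∀ y : X k B, (PiTensorProduct.tprod k fun _ : Fin 1 => y) =
      consL 0 y (pure k 0 fun _ => 0) := fun y => by
    rw [consL_pure]
    exact congrArg _ (funext fun i => by fin_cases i; rfl)
  rw [h, h, diagL_consL]
  simp only [diagL, diagAct_zero, map_smul]
  exact sw_counit_right (f := fun u => consL 0 (actL k B u x) (pure k 0 fun _ => 0))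
    ⟨by simp, by simp⟩ a

theorem actR_diag_one (a : B) (x : X k B) :
    diagR k B 1 a (PiTensorProduct.tprod k fun _ => x) =
      PiTensorProduct.tprod k fun _ => actR k B a x := by
  have h : ∀ y : X k B, (PiTensorProduct.tprod k fun _ : Fin 1 => y) =
      consL 0 y (pure k 0 fun _ => 0) := fun y => by
    rw [consL_pure]
    exact congrArg _ (funext fun i => by fin_cases i; rfl)
  rw [h, h, diagR_consL]
  simp only [diagR, diagAct_zero, map_smul]
  exact sw_counit_right (f := fun u => consL 0 (actR k B u x) (pure k 0 fun _ => 0))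
    ⟨by simp, by simp⟩ a

theorem flipMapOne_tmul (a : B) (x : X k B) :
    flipMapOne k B (a ⊗ₜ x) = sw k (fun p c => sw k (fun u v =>
      actL k B u (actR k B (antipodeInv k B c) x) ⊗ₜ[k] v) p) a := by
  simp only [flipMapOne, LinearMap.comp_apply, LinearMap.lTensor_tmul, LinearEquiv.coe_coe,
    PiTensorProduct.subsingletonEquiv_symm_apply', flipMap_tmul, map_sw, actL_diag_one,
    actR_diag_one, LinearMap.rTensor_tmul, PiTensorProduct.subsingletonEquiv_apply_tprod]

theorem mulDouble_tmul (x y : X k B) (a b : B) :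
    mulDouble k B (x ⊗ₜ a) (y ⊗ₜ b) = sw k (fun p c => sw k (fun u v =>
      mulX k B x (actL k B u (actR k B (antipodeInv k B c) y)) ⊗ₜ[k] (v * b)) p) a := by
  simp only [mulDouble, TensorProduct.curry_apply, LinearMap.comp_apply, LinearEquiv.coe_coe,
    TensorProduct.assoc_tmul, LinearMap.lTensor_tmul, TensorProduct.assoc_symm_tmul,
    LinearMap.rTensor_tmul, flipMapOne_tmul, sw_tmul]
  simp only [← LinearEquiv.coe_coe, map_sw, tmul_sw]
  rfl

/-- `∑ (x ⋈ a₁)(y^{a₂} ⋈ b) = ∑ x ^{a₁}y ⋈ a₂ b`. -/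
theorem sw_mulDouble [FiniteDimensional k B] (x y : X k B) (a b : B) :
    sw k (fun u v => mulDouble k B (x ⊗ₜ u) (actR k B v y ⊗ₜ b)) a =
      sw k (fun u v => mulX k B x (actL k B u y) ⊗ₜ[k] (v * b)) a := by
  simp only [mulDouble_tmul, ← actR_mul]
  have hb : ∀ z : B, IsBilin k fun q w : B => mulX k B x (actL k B q (actR k B z y)) ⊗ₜ[k] (w * b) :=
    fun z => ⟨fun _ => ⟨by simp [TensorProduct.add_tmul], by simp [← TensorProduct.smul_tmul']⟩,
      fun _ => ⟨by simp [TensorProduct.tmul_add, add_mul], by simp⟩⟩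
  have hz : ∀ p : B, IsLin k fun z : B => sw k (fun q w : B =>
      mulX k B x (actL k B q (actR k B z y)) ⊗ₜ[k] (w * b)) p := fun p =>
    ⟨by simp [TensorProduct.add_tmul], by simp [← TensorProduct.smul_tmul']⟩
  -- The regrouping makes `a₄ S⁻¹(a₃)` act on `y` as one element, and its sum is the counit.
  rw [sw_sw_left (F := fun p c v : B => sw k (fun q w : B =>
    mulX k B x (actL k B q (actR k B (v * antipodeInv k B c) y)) ⊗ₜ[k] (w * b)) p)
    (.of (fun _ _ => sw_isLin (hb _))
      (fun p _ => ⟨fun _ _ => by rw [map_add, mul_add, (hz p).add],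
        fun _ _ => by rw [map_smul, mul_smul_comm, (hz p).smul]⟩)
      (fun p _ => ⟨fun _ _ => by rw [add_mul, (hz p).add],
        fun _ _ => by rw [smul_mul_assoc, (hz p).smul]⟩))]
  simp only [sw_mul_antipodeInv (hz _)]
  rw [sw_counit_right (f := fun p : B => sw k (fun q w : B =>
    mulX k B x (actL k B q (actR k B 1 y)) ⊗ₜ[k] (w * b)) p) (sw_isLin (hb 1))]
  simp only [actR_one]

/-! ### The canonical element of `X ⊗ B`. -/

variable {ι : Type*} [Fintype ι] (b : Module.Basis ι k B)

theorem coord_expand (x : X k B) : ∑ i, x (b i) • b.coord i = x := by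
  refine b.ext fun j => ?_
  simp

/-- The canonical element of `X ⊗ B` intertwines a map and its transpose. -/
theorem sum_coord_comp {F : X k B → B → W} (h₁ : ∀ c, IsLin k fun x => F x c)
    (h₂ : ∀ x, IsLin k (F x)) (T : B →ₗ[k] B) :
    ∑ i, F (b.coord i ∘ₗ T) (b i) = ∑ i, F (b.coord i) (T (b i)) := by
  have e1 : ∀ i, F (b.coord i ∘ₗ T) (b i) = ∑ j, b.coord i (T (b j)) • F (b.coord j) (b i) := by
    intro i
    conv_lhs => rw [← coord_expand b (b.coord i ∘ₗ T)]
    have := map_sum (h₁ (b i)).toLin (fun j => (b.coord i ∘ₗ T) (b j) • b.coord j) Finset.univ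
    simp only [map_smul] at this
    exact this
  simp only [e1]
  rw [Finset.sum_comm]
  exact Finset.sum_congr rfl fun j _ => sum_coord_apply b (h₂ _) _

theorem sum_actR_coord {F : X k B → B → W} (h₁ : ∀ c, IsLin k fun x => F x c)
    (h₂ : ∀ x, IsLin k (F x)) (a : B) :
    ∑ i, F (actR k B a (b.coord i)) (b i) = ∑ i, F (b.coord i) (a * b i) :=
  sum_coord_comp b h₁ h₂ (LinearMap.mulLeft k a)

theorem sum_actL_coord {F : X k B → B → W} (h₁ : ∀ c, IsLin k fun x => F x c)
    (h₂ : ∀ x, IsLin k (F x)) (a : B) :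
    ∑ i, F (actL k B a (b.coord i)) (b i) = ∑ i, F (b.coord i) (b i * a) :=
  sum_coord_comp b h₁ h₂ (LinearMap.mulRight k a)

/-- The canonical element of `X ⊗ B` intertwines multiplication and comultiplication. -/
theorem sum_mulX_coord {F : X k B → B → B → W} (h₁ : ∀ c d, IsLin k fun x => F x c d)
    (h₂ : ∀ x, IsBilin k (F x)) :
    ∑ i, ∑ j, F (mulX k B (b.coord i) (b.coord j)) (b i) (b j) =
      ∑ l, sw k (F (b.coord l)) (b l) := by
  have e1 : ∀ i j, F (mulX k B (b.coord i) (b.coord j)) (b i) (b j) =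
      ∑ l, sw k (fun u v => b.coord i u • b.coord j v • F (b.coord l) (b i) (b j)) (b l) := by
    intro i j
    conv_lhs => rw [← coord_expand b (mulX k B (b.coord i) (b.coord j))]
    have := map_sum (h₁ (b i) (b j)).toLin
      (fun l => mulX k B (b.coord i) (b.coord j) (b l) • b.coord l) Finset.univ
    simp only [map_smul] at this
    refine this.trans (Finset.sum_congr rfl fun l _ => ?_)
    rw [mulX_apply]
    simp only [sw, Finset.sum_smul, mul_smul]
    rfl
  simp only [e1]
  rw [Finset.sum_comm_cycle]
  refine Finset.sum_congr rfl fun l _ => ?_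
  simp only [sum_sw]
  refine congrArg (fun F => sw k F (b l)) (funext fun u => funext fun v => ?_)
  simp only [← Finset.smul_sum, sum_coord_apply b ((h₂ _).right _)]
  exact sum_coord_apply b ((h₂ _).left v) u

end Double
end
end BialgebraCohomology

namespace BialgebraCohomology
noncomputable section
universe u v w
set_option linter.unusedSectionVars false

/-! ### Fourfold Sweedler sums -/

section FourFold

variable {k : Type u} [Field k] {B : Type v} [Ring B] [HopfAlgebra k B]
variable {W : Type*} [AddCommMonoid W] [Module k W]
variable {W' : Type*} [AddCommMonoid W'] [Module k W']

/-- A quadrilinear function. -/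
structure IsQuad (k : Type u) [Field k] {B : Type*} [AddCommMonoid B] [Module k B] {W : Type*}
    [AddCommMonoid W] [Module k W] (F : B → B → B → B → W) : Prop where
  one : ∀ v w c, IsLin k fun u => F u v w c
  two : ∀ u w c, IsLin k fun v => F u v w c
  three : ∀ u v c, IsLin k fun w => F u v w c
  four : ∀ u v w, IsLin k fun c => F u v w c

variable (k) in
/-- The Sweedler sum `∑ F a₁ a₂ a₃ a₄`. -/
def sw4 (F : B → B → B → B → W) (a : B) : W :=
  sw k (fun u r => sw k (fun t c => sw k (fun v w => F u v w c) t) r) a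

theorem isLin_sw {V : Type*} [AddCommMonoid V] [Module k V] {F : V → B → B → W}
    (h : ∀ u v, IsLin k fun x => F x u v) (a : B) : IsLin k fun x => sw k (F x) a :=
  ⟨fun x y => (Finset.sum_congr rfl fun _ _ => (h _ _).add x y).trans (sw_add_fun _ _ a),
    fun c x => (Finset.sum_congr rfl fun _ _ => (h _ _).smul c x).trans (sw_smul_fun c _ a)⟩

/-- Sums with four coproduct factors occur with several bracketings; `sw4` is the common normal form
to which they are reduced. -/
theorem sw4_left {F : B → B → B → B → W} (h : IsQuad k F) (a : B) :
    sw k (fun p c => sw k (fun u w => sw k (fun u v => F u v w c) u) p) a = sw4 k F a := by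
  have e : ∀ p c, sw k (fun u w => sw k (fun u v => F u v w c) u) p =
      sw k (fun u m => sw k (fun v w => F u v w c) m) p := fun p c =>
    sw_sw_left (F := fun u v w => F u v w c)
      (.of (fun v w => h.one v w c) (fun u w => h.two u w c) (fun u v => h.three u v c)) p
  simp only [e]
  exact sw_sw_left (F := fun u m c => sw k (fun v w => F u v w c) m)
    (.of (fun m c => isLin_sw (fun v w => h.one v w c) m)
      (fun u c => sw_isLin ⟨fun w => h.two u w c, fun v => h.three u v c⟩)
      (fun u m => isLin_sw (fun v w => h.four u v w) m)) a

theorem sw4_balanced {F : B → B → B → B → W} (h : IsQuad k F) (a : B) :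
    sw k (fun p r => sw k (fun u v => sw k (fun w c => F u v w c) r) p) a = sw4 k F a := by
  rw [sw_sw_left (F := fun u v r => sw k (fun w c => F u v w c) r)
    (.of (fun v r => isLin_sw (fun w c => h.one v w c) r)
      (fun u r => isLin_sw (fun w c => h.two u w c) r)
      (fun u v => sw_isLin ⟨fun c => h.three u v c, fun w => h.four u v w⟩))]
  refine congrArg (fun F => sw k F a) (funext fun u => funext fun r => ?_)
  exact (sw_sw_left (F := fun v w c => F u v w c)
    (.of (fun w c => h.two u w c) (fun v c => h.three u v c) (fun v w => h.four u v w)) r).symm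

theorem sw4_mul {F : B → B → B → B → W} (h : IsQuad k F) (a b : B) :
    sw4 k F (a * b) = sw4 k (fun u v w c => sw4 k (fun u' v' w' c' =>
      F (u * u') (v * v') (w * w') (c * c')) b) a := by
  have h1 : ∀ u c, IsBilin k fun v w => F u v w c := fun u c =>
    ⟨fun w => h.two u w c, fun v => h.three u v c⟩
  have h2 : ∀ u, IsBilin k fun t c => sw k (fun v w => F u v w c) t := fun u =>
    ⟨fun c => sw_isLin (h1 u c), fun t => isLin_sw (fun v w => h.four u v w) t⟩
  have h3 : IsBilin k fun u r => sw k (fun t c => sw k (fun v w => F u v w c) t) r :=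
    ⟨fun r => isLin_sw (fun t c => isLin_sw (fun v w => h.one v w c) t) r, fun u => sw_isLin (h2 u)⟩
  simp only [sw4]
  rw [sw_mul h3]
  simp only [sw_mul (h2 _), sw_mul (h1 _ _)]
  refine congrArg (fun F => sw k F a) (funext fun u => funext fun r => ?_)
  rw [sw_sw_comm]
  refine congrArg (fun F => sw k F r) (funext fun t => funext fun c => ?_)
  exact Eq.trans (congrArg (fun F => sw k F b) (funext fun u' => funext fun r' =>
    sw_sw_comm _ _ _)) (sw_sw_comm _ _ _)

theorem isLin_sw4 {V : Type*} [AddCommMonoid V] [Module k V] {F : V → B → B → B → B → W}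
    (h : ∀ p q r s, IsLin k fun x => F x p q r s) (a : B) : IsLin k fun x => sw4 k (F x) a :=
  isLin_sw (fun _ _ => isLin_sw (fun _ _ => isLin_sw (fun _ _ => h _ _ _ _) _) _) _

theorem isLin_sum {V : Type*} [AddCommMonoid V] [Module k V] {κ : Type*} {s : Finset κ}
    {F : V → κ → W} (h : ∀ i, IsLin k fun x => F x i) : IsLin k fun x => ∑ i ∈ s, F x i :=
  ⟨fun x y => (Finset.sum_congr rfl fun i _ => (h i).add x y).trans Finset.sum_add_distrib,
    fun c x => (Finset.sum_congr rfl fun i _ => (h i).smul c x).trans Finset.smul_sum.symm⟩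

/-- Only the joint sum over the two middle factors has to agree. In this form an identity about the
coproduct of a single element can be applied inside a fourfold sum. -/
theorem sw4_congr {F F' : B → B → B → B → W}
    (h : ∀ u c t, sw k (fun v w => F u v w c) t = sw k (fun v w => F' u v w c) t) (a : B) :
    sw4 k F a = sw4 k F' a := by simp only [sw4, h]

theorem sw4_sum {κ : Type*} (s : Finset κ) (F : κ → B → B → B → B → W) (a : B) :
    sw4 k (fun u v w c => ∑ i ∈ s, F i u v w c) a = ∑ i ∈ s, sw4 k (F i) a := by
  simp only [sw4, sw_sum]

theorem sw_sw4_comm (F : B → B → B → B → B → B → W) (a b : B) :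
    sw k (fun u v => sw4 k (F u v) b) a =
      sw4 k (fun p q r s => sw k (fun u v => F u v p q r s) a) b := by
  simp only [sw4]
  rw [sw_sw_comm]
  refine congrArg (fun F => sw k F b) (funext fun u' => funext fun r' => ?_)
  rw [sw_sw_comm]
  refine congrArg (fun F => sw k F r') (funext fun t' => funext fun c' => ?_)
  rw [sw_sw_comm]

end FourFold

/-! ### The inverse of `(φ c̃)` -/

section Theta

variable {k : Type u} [Field k] {B : Type v} [Ring B] [HopfAlgebra k B]
variable {W : Type*} [AddCommMonoid W] [Module k W]
variable {W' : Type*} [AddCommMonoid W'] [Module k W']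
variable {ι : Type*} [Fintype ι] (b : Module.Basis ι k B)

/-- A trilinear map from a function linear in each argument. -/
def trilin {V₁ V₂ V₃ : Type*} [AddCommMonoid V₁] [Module k V₁] [AddCommMonoid V₂] [Module k V₂]
    [AddCommMonoid V₃] [Module k V₃] (F : V₁ → V₂ → V₃ → W)
    (h₁ : ∀ y z, IsLin k fun x => F x y z) (h₂ : ∀ x z, IsLin k fun y => F x y z)
    (h₃ : ∀ x y, IsLin k fun z => F x y z) : V₁ →ₗ[k] V₂ →ₗ[k] V₃ →ₗ[k] W where
  toFun x := LinearMap.mk₂ k (F x) (fun _ _ z => (h₂ x z).add _ _) (fun _ _ z => (h₂ x z).smul _ _)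
    (fun y => (h₃ x y).add) (fun _ y => (h₃ x y).smul _)
  map_add' x x' := by ext y z; exact (h₁ y z).add x x'
  map_smul' c x := by ext y z; exact (h₁ y z).smul c x

/-- `∑ᵢ ∑ K (eⁱ ⋈ a₂) (x^{eᵢ a₁}) a₃`, for a basis `eᵢ` with dual basis `eⁱ`. -/
def thetaStep (K : Double k B →ₗ[k] X k B →ₗ[k] B →ₗ[k] W) (x : X k B) (a : B) : W :=
  ∑ i, sw k (fun p c => sw k (fun u v =>
    K (b.coord i ⊗ₜ v) (actR k B (b i * u) x) c) p) a

variable (K : Double k B →ₗ[k] X k B →ₗ[k] B →ₗ[k] W)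

theorem thetaStep_isLin_left (a : B) : IsLin k fun x => thetaStep b K x a :=
  ⟨fun x y => by simp [thetaStep, Finset.sum_add_distrib], fun c x => by
    simp [thetaStep, Finset.smul_sum]⟩

theorem isBilin_thetaStep (x y : X k B) (a c : B) :
    IsBilin k fun u v : B => K (x ⊗ₜ v) (actR k B (a * u) y) c :=
  ⟨fun _ => ⟨by simp [mul_add], by simp⟩,
    fun _ => ⟨by simp [TensorProduct.tmul_add], by simp⟩⟩

theorem thetaStep_isLin_right (x : X k B) : IsLin k fun a => thetaStep b K x a := by
  have : ∀ i, IsBilin k fun p c => sw k (fun u v =>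
      K (b.coord i ⊗ₜ v) (actR k B (b i * u) x) c) p := fun i =>
    ⟨fun c => sw_isLin (isBilin_thetaStep K _ _ _ _), fun p => ⟨by simp, by simp⟩⟩
  exact ⟨fun u v => by simp only [thetaStep, (sw_isLin (this _)).add, Finset.sum_add_distrib],
    fun c u => by simp only [thetaStep, (sw_isLin (this _)).smul, Finset.smul_sum]⟩

/-- The counit of `eⁱ ⋈ v` is `eⁱ(1) ε(v)`. Summing over `i` replaces `eᵢ` by `1`, and `ε(v)`
removes the middle coproduct factor. -/
theorem thetaStep_counit (G : X k B →ₗ[k] B →ₗ[k] W) (x : X k B) (a : B) :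
    ∑ i, sw k (fun p c => sw k (fun u v => counitDouble k B (b.coord i ⊗ₜ[k] v) •
      G (actR k B (b i * u) x) c) p) a = sw k (fun u c => G (actR k B u x) c) a := by
  have e : ∀ i (v : B), counitDouble k B (b.coord i ⊗ₜ[k] v) =
      b.coord i 1 * Coalgebra.counit (R := k) v := fun i v => rfl
  simp only [e, sum_sw, mul_smul]
  refine congrArg (fun F => sw k F a) (funext fun p => funext fun c => ?_)
  have e' : ∀ u v : B, ∑ i, b.coord i 1 • Coalgebra.counit (R := k) v • G (actR k B (b i * u) x) c =
      Coalgebra.counit (R := k) v • G (actR k B u x) c := fun u v => by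
    rw [sum_coord_apply b (f := fun e => Coalgebra.counit (R := k) v • G (actR k B (e * u) x) c)
      ⟨by simp [add_mul], by simp [smul_smul, mul_comm]⟩, one_mul]
  simp only [e']
  exact sw_counit_right (f := fun u => G (actR k B u x) c) ⟨by simp, by simp⟩ p

/-- Multiplicativity of `thetaStep`. -/
theorem thetaStep_mul [FiniteDimensional k B] (x y : X k B) (a a' : B) :
    ∑ i, sw k (fun p r => sw k (fun u v => sw k (fun w c => sw k (fun u' r' =>
      ∑ j, sw k (fun t' c' => sw k (fun v' w' =>
        K (mulDouble k B (b.coord i ⊗ₜ v) (b.coord j ⊗ₜ w'))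
          (mulX k B (actR k B u' (actR k B (b i * u) x)) (actR k B (b j * v') (actR k B w y)))
          (c * c')) t') r') a') r) p) a = thetaStep b K (mulX k B x y) (a * a') := by
  -- Rebracketing only: four coproduct factors of `a` and four of `a'`, each in normal form.
  have h1 : ∀ i, sw k (fun p r => sw k (fun u v => sw k (fun w c => sw k (fun u' r' =>
      ∑ j, sw k (fun t' c' => sw k (fun v' w' =>
        K (mulDouble k B (b.coord i ⊗ₜ v) (b.coord j ⊗ₜ w'))
          (mulX k B (actR k B u' (actR k B (b i * u) x)) (actR k B (b j * v') (actR k B w y)))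
          (c * c')) t') r') a') r) p) a =
      sw4 k (fun u v w c => sw4 k (fun u' v' w' c' => ∑ j,
        K (mulDouble k B (b.coord i ⊗ₜ v) (b.coord j ⊗ₜ w'))
          (mulX k B (actR k B (b i * u * u') x) (actR k B (w * (b j * v')) y)) (c * c')) a') a := by
    intro i
    rw [← sw4_balanced]
    · simp only [sw4, sw_sum, actR_mul]
    · exact ⟨fun _ _ _ => isLin_sw4 (fun _ _ _ _ => isLin_sum fun j =>
          ⟨by simp [mul_add, add_mul], by simp⟩) a',
        fun _ _ _ => isLin_sw4 (fun _ _ _ _ => isLin_sum fun j =>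
          ⟨by simp [TensorProduct.tmul_add], by simp⟩) a',
        fun _ _ _ => isLin_sw4 (fun _ _ _ _ => isLin_sum fun j =>
          ⟨by simp [add_mul], by simp⟩) a',
        fun _ _ _ => isLin_sw4 (fun _ _ _ _ => isLin_sum fun j =>
          ⟨by simp [add_mul], by simp⟩) a'⟩
  -- The factor `w` multiplying `eⱼ` on the left is moved onto `eʲ` as a right action. Then
  -- `sw_mulDouble` removes the inverse antipode from the product in `D(B)`, producing `^v(eʲ)`, and
  -- the left action by `v` is moved back to `eⱼ`.
  have h2 : ∀ i, sw4 k (fun u v w c => sw4 k (fun u' v' w' c' => ∑ j,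
        K (mulDouble k B (b.coord i ⊗ₜ v) (b.coord j ⊗ₜ w'))
          (mulX k B (actR k B (b i * u * u') x) (actR k B (w * (b j * v')) y)) (c * c')) a') a =
      sw4 k (fun u v w c => sw4 k (fun u' v' w' c' => ∑ j,
        K (mulX k B (b.coord i) (b.coord j) ⊗ₜ (w * w'))
          (mulX k B (actR k B (b i * (u * u')) x) (actR k B (b j * (v * v')) y)) (c * c')) a') a := by
    intro i
    refine sw4_congr (fun u c t => ?_) a
    rw [sw_sw4_comm, sw_sw4_comm]
    refine congrArg (fun F => sw4 k F a') ?_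
    funext u' v' w' c'
    have e1 : ∀ v w : B, ∑ j, K (mulDouble k B (b.coord i ⊗ₜ v) (b.coord j ⊗ₜ w'))
          (mulX k B (actR k B (b i * u * u') x) (actR k B (w * (b j * v')) y)) (c * c') =
        ∑ j, K (mulDouble k B (b.coord i ⊗ₜ v) (actR k B w (b.coord j) ⊗ₜ w'))
          (mulX k B (actR k B (b i * u * u') x) (actR k B (b j * v') y)) (c * c') := fun v w => by
      rw [sum_actR_coord b (F := fun z e => K (mulDouble k B (b.coord i ⊗ₜ v) (z ⊗ₜ w'))
          (mulX k B (actR k B (b i * u * u') x) (actR k B (e * v') y)) (c * c'))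
        (fun _ => ⟨by simp [TensorProduct.add_tmul], by simp [← TensorProduct.smul_tmul']⟩)
        (fun _ => ⟨by simp [add_mul], by simp⟩)]
      simp only [mul_assoc]
    have e2 : ∀ v w : B, ∑ j, K (mulX k B (b.coord i) (b.coord j) ⊗ₜ (w * w'))
          (mulX k B (actR k B (b i * (u * u')) x) (actR k B (b j * (v * v')) y)) (c * c') =
        ∑ j, K (mulX k B (b.coord i) (actL k B v (b.coord j)) ⊗ₜ (w * w'))
          (mulX k B (actR k B (b i * u * u') x) (actR k B (b j * v') y)) (c * c') := fun v w => by
      rw [sum_actL_coord b (F := fun z e => K (mulX k B (b.coord i) z ⊗ₜ (w * w'))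
          (mulX k B (actR k B (b i * u * u') x) (actR k B (e * v') y)) (c * c'))
        (fun _ => ⟨by simp [TensorProduct.add_tmul], by simp [← TensorProduct.smul_tmul']⟩)
        (fun _ => ⟨by simp [add_mul], by simp⟩)]
      simp only [mul_assoc]
    simp only [e1, e2, sw_sum]
    refine Finset.sum_congr rfl fun j _ => ?_
    have := congrArg (fun d => K d (mulX k B (actR k B (b i * u * u') x) (actR k B (b j * v') y))
      (c * c')) (sw_mulDouble (b.coord i) (b.coord j) t w')
    simp only [map_sw, sw_apply] at this
    exact this
  -- On the other side, `B` acts on `xy` by its coproduct, and the coproduct of `e_l a₁ a'₁` is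
  -- multiplicative.
  have h3 : ∀ l, sw k (fun p c => sw k (fun u v =>
      K (b.coord l ⊗ₜ v) (actR k B (b l * u) (mulX k B x y)) c) p) (a * a') =
      sw4 k (fun u v w c => sw4 k (fun u' v' w' c' => sw k (fun e e' =>
        K (b.coord l ⊗ₜ (w * w'))
          (mulX k B (actR k B (e * (u * u')) x) (actR k B (e' * (v * v')) y)) (c * c')) (b l))
            a') a := by
    intro l
    have hq : IsQuad k fun u v w c : B => sw k (fun e e' : B => K (b.coord l ⊗ₜ w)
        (mulX k B (actR k B (e * u) x) (actR k B (e' * v) y)) c) (b l) :=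
      ⟨fun _ _ _ => isLin_sw (fun _ _ => ⟨by simp [mul_add], by simp⟩) _,
        fun _ _ _ => isLin_sw (fun _ _ => ⟨by simp [mul_add], by simp⟩) _,
        fun _ _ _ => isLin_sw (fun _ _ => ⟨by simp [TensorProduct.tmul_add], by simp⟩) _,
        fun _ _ _ => isLin_sw (fun _ _ => ⟨by simp, by simp⟩) _⟩
    rw [← sw4_mul (F := fun u v w c => sw k (fun e e' =>
      K (b.coord l ⊗ₜ w) (mulX k B (actR k B (e * u) x) (actR k B (e' * v) y)) c) (b l)),
      ← sw4_left hq]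
    · refine congrArg (fun F => sw k F (a * a')) (funext fun p => funext fun c => ?_)
      refine congrArg (fun F => sw k F p) (funext fun u => funext fun w => ?_)
      rw [actR_mulX, sw_mul ⟨fun _ => ⟨by simp, by simp⟩, fun _ => ⟨by simp, by simp⟩⟩]
      simp only [map_sw, sw_apply]
      exact sw_sw_comm _ _ _
    · exact hq
  simp only [h1, h2]
  rw [thetaStep]
  simp only [h3, ← sw4_sum]
  refine congrArg (fun F => sw4 k F a) ?_
  funext u v w c
  refine congrArg (fun F => sw4 k F a') ?_
  funext u' v' w' c'
  -- The remaining discrepancy is the product `eⁱeʲ` against the coproduct of `e_l`; these are dual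
  -- to each other.
  exact sum_mulX_coord b (F := fun z e e' => K (z ⊗ₜ (w * w'))
    (mulX k B (actR k B (e * (u * u')) x) (actR k B (e' * (v * v')) y)) (c * c'))
    (fun _ _ => ⟨by simp [TensorProduct.add_tmul], by simp [← TensorProduct.smul_tmul']⟩)
    (fun _ => ⟨fun _ => ⟨by simp [add_mul], by simp⟩, fun _ => ⟨by simp [add_mul], by simp⟩⟩)

end Theta
end
end BialgebraCohomology

namespace BialgebraCohomology
noncomputable section
universe u v w
set_option linter.unusedSectionVars false

/-! ### The faces of the standard complex of an augmented algebra -/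

section HochschildFaces

variable {k : Type u} [Field k] {A : Type v} [AddCommMonoid A] [Module k A]

/-- The faces of the standard complex, indexed by natural numbers; zero if out of range. -/
def hFace (mul : A →ₗ[k] A →ₗ[k] A) (ε : A →ₗ[k] k) (n i : ℕ) : ⨂[k]^(n + 1) A →ₗ[k] ⨂[k]^n A :=
  if h : i < n + 2 then hochschildFace mul ε n ⟨i, h⟩ else 0

variable (mul : A →ₗ[k] A →ₗ[k] A) (ε : A →ₗ[k] k)

theorem hFace_consL (n : ℕ) (a : A) (t : ⨂[k]^n A) :
    hFace mul ε n 0 (consL n a t) = ε a • t := by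
  rw [hFace, dif_pos (by omega), hochschildFace, dif_pos (by rfl)]
  simp

theorem hFace_snocL (n : ℕ) (t : ⨂[k]^n A) (a : A) :
    hFace mul ε n (n + 1) (snocL n t a) = ε a • t := by
  rw [hFace, dif_pos (by omega), hochschildFace, dif_neg (by simp), dif_pos (by rfl)]
  simp

theorem hFace_ctr (n j : ℕ) (h : j < n) : hFace mul ε n (j + 1) = ctr mul n j := by
  rw [hFace, dif_pos (by omega), hochschildFace, dif_neg (by simp),
    dif_neg (by simp [Fin.ext_iff]; omega), ctr, dif_pos h]
  rfl

/-- Faces of index at least `2` leave the first factor alone. This reduces them to the tail in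
inductions on the number of factors. -/
theorem hFace_succ_consL (n i : ℕ) (hi : i ≤ n) (a : A) (t : ⨂[k]^(n + 1) A) :
    hFace mul ε (n + 1) (i + 2) (consL (n + 1) a t) = consL n a (hFace mul ε n (i + 1) t) := by
  rcases eq_or_lt_of_le hi with rfl | hi
  · induction t using pure_induction with
    | h m =>
      rw [pure_succ_last, ← snocL_consL, hFace_snocL, hFace_snocL, map_smul]
    | hadd x y hx hy => simp only [map_add, hx, hy]
    | hsmul c x hx => simp only [map_smul, hx]
  · rw [hFace_ctr _ _ _ _ (by omega), hFace_ctr _ _ _ _ hi, ctr_succ_consL]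

end HochschildFaces

/-! ### The map `Θ` and its compatibility with the faces. -/

section ThetaMap

variable {k : Type u} [Field k] {B : Type v} [Ring B] [HopfAlgebra k B]
variable {ι : Type*} [Fintype ι] (b : Module.Basis ι k B)

/-- A linear map on a fourfold tensor product from a function linear in each argument. -/
def quadTensor {V₁ V₂ V₃ V₄ W : Type*} [AddCommMonoid V₁] [Module k V₁] [AddCommMonoid V₂] [Module k V₂]
    [AddCommMonoid V₃] [Module k V₃] [AddCommMonoid V₄] [Module k V₄] [AddCommMonoid W] [Module k W]
    (F : V₁ → V₂ → V₃ → V₄ → W)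
    (h₁ : ∀ s a t, IsLin k fun x => F x s a t) (h₂ : ∀ x a t, IsLin k fun s => F x s a t)
    (h₃ : ∀ x s t, IsLin k fun a => F x s a t) (h₄ : ∀ x s a, IsLin k fun t => F x s a t) :
    (V₁ ⊗[k] V₂) ⊗[k] (V₃ ⊗[k] V₄) →ₗ[k] W :=
  TensorProduct.lift (TensorProduct.lift (LinearMap.mk₂ k
    (fun x s => TensorProduct.lift (LinearMap.mk₂ k (F x s) (fun _ _ t => (h₃ x s t).add _ _)
      (fun _ _ t => (h₃ x s t).smul _ _) (fun a => (h₄ x s a).add) (fun _ a => (h₄ x s a).smul _)))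
    (fun x x' s => TensorProduct.ext' fun a t => (h₁ s a t).add x x')
    (fun c x s => TensorProduct.ext' fun a t => (h₁ s a t).smul c x)
    (fun x s s' => TensorProduct.ext' fun a t => (h₂ x a t).add s s')
    (fun c x s => TensorProduct.ext' fun a t => (h₂ x a t).smul c s)))

/-- The trilinear map `(d, z, c) ↦ d ⊗ T (𝐱^c ⊗ 𝐚^z)`. -/
def thetaKernel (n : ℕ) (T : XB k B n n →ₗ[k] ⨂[k]^n (Double k B)) (s : ⨂[k]^n (X k B))
    (t : ⨂[k]^n B) : Double k B →ₗ[k] X k B →ₗ[k] B →ₗ[k] ⨂[k]^(n + 1) (Double k B) :=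
  trilin (fun d z c => consL n d (T (diagR k B n c s ⊗ₜ coactR k B n z t)))
    (fun _ _ => ⟨by simp, by simp⟩)
    (fun _ _ => ⟨by simp [TensorProduct.tmul_add], by simp⟩)
    (fun _ _ => ⟨by simp [TensorProduct.add_tmul], by simp [← TensorProduct.smul_tmul']⟩)

theorem thetaKernel_apply (n : ℕ) (T : XB k B n n →ₗ[k] ⨂[k]^n (Double k B)) (s : ⨂[k]^n (X k B))
    (t : ⨂[k]^n B) (d : Double k B) (z : X k B) (c : B) :
    thetaKernel n T s t d z c = consL n d (T (diagR k B n c s ⊗ₜ coactR k B n z t)) := rfl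

/-- The inverse `Xⁿ ⊗ Bⁿ → D(B)ⁿ` of `φₙ c̃ₙ`. -/
def theta : ∀ n, XB k B n n →ₗ[k] ⨂[k]^n (Double k B)
  | 0 => LinearMap.toSpanSingleton k (⨂[k]^0 (Double k B)) (PiTensorProduct.tprod k Fin.elim0) ∘ₗ
      (TensorProduct.lid k k).toLinearMap ∘ₗ TensorProduct.map
        (PiTensorProduct.isEmptyEquiv (R := k) (s := fun _ => X k B) (Fin 0)).toLinearMap
        (PiTensorProduct.isEmptyEquiv (R := k) (s := fun _ => B) (Fin 0)).toLinearMap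
  | n + 1 => quadTensor (fun x s a t => thetaStep b (thetaKernel n (theta n) s t) x a)
      (fun s a t => thetaStep_isLin_left b _ a)
      (fun x a t => isLin_sum fun i => isLin_sw (fun _ _ => isLin_sw (fun _ _ =>
        ⟨by simp [thetaKernel_apply, TensorProduct.add_tmul],
          by simp [thetaKernel_apply, ← TensorProduct.smul_tmul']⟩) _) _)
      (fun x s t => thetaStep_isLin_right b _ x)
      (fun x s a => isLin_sum fun i => isLin_sw (fun _ _ => isLin_sw (fun _ _ =>
        ⟨by simp [thetaKernel_apply, TensorProduct.tmul_add],
          by simp [thetaKernel_apply]⟩) _) _) ∘ₗ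
      TensorProduct.map (headSplit k (X k B) n) (headSplit k B n)

theorem theta_consL (n : ℕ) (x : X k B) (s : ⨂[k]^n (X k B)) (a : B) (t : ⨂[k]^n B) :
    theta b (n + 1) (consL n x s ⊗ₜ consL n a t) = ∑ i, sw k (fun p c => sw k (fun u v =>
      consL n (b.coord i ⊗ₜ v) (theta b n (diagR k B n c s ⊗ₜ
        coactR k B n (actR k B (b i * u) x) t))) p) a := by
  rw [theta, LinearMap.comp_apply, TensorProduct.map_tmul, headSplit_consL, headSplit_consL]
  rfl

theorem theta_zero (m : ℕ → X k B) (m' : ℕ → B) (m'' : ℕ → Double k B) :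
    theta b 0 (pure k 0 m ⊗ₜ pure k 0 m') = pure k 0 m'' := by
  rw [pure_zero, pure_zero, pure_zero, theta]
  simp

/-- `(z, c) ↦ Θₙ(𝐱^c ⊗ 𝐚^z)`. -/
def thetaAct (n : ℕ) (s : ⨂[k]^n (X k B)) (t : ⨂[k]^n B) :
    X k B →ₗ[k] B →ₗ[k] ⨂[k]^n (Double k B) :=
  LinearMap.mk₂ k (fun z c => theta b n (diagR k B n c s ⊗ₜ coactR k B n z t))
    (by simp [TensorProduct.tmul_add]) (by simp) (by simp [TensorProduct.add_tmul])
    (by simp [← TensorProduct.smul_tmul'])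

variable (k B) in
/-- The faces of the standard complex of `D(B)`. -/
abbrev faceD (n i : ℕ) : ⨂[k]^(n + 1) (Double k B) →ₗ[k] ⨂[k]^n (Double k B) :=
  hFace (mulDouble k B) (counitDouble k B) n i

theorem counit_theta (n : ℕ) (x : X k B) (s : ⨂[k]^n (X k B)) (a : B) (t : ⨂[k]^n B) :
    ∑ i, sw k (fun p c => sw k (fun u v => counitDouble k B (b.coord i ⊗ₜ[k] v) •
      theta b n (diagR k B n c s ⊗ₜ coactR k B n (actR k B (b i * u) x) t)) p) a =
      sw k (fun u c => theta b n (diagR k B n c s ⊗ₜ coactR k B n (actR k B u x) t)) a :=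
  thetaStep_counit b (thetaAct b n s t) x a

theorem faceD_zero_theta (n : ℕ) (x : X k B) (s : ⨂[k]^n (X k B)) (a : B) (t : ⨂[k]^n B) :
    faceD k B n 0 (theta b (n + 1) (consL n x s ⊗ₜ consL n a t)) =
      theta b n (fX k B n n 0 (fB k B (n + 1) n 0 (consL n x s ⊗ₜ consL n a t))) := by
  rw [theta_consL]
  simp only [map_sum, map_sw, hFace_consL]
  rw [counit_theta, fB_consL, diagR_consL, sw_tmul]
  simp only [map_sw, fX_consL]

/-- On a single factor the face of index `1` is the last one and not a product. Both sides amount to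
`⟨x, a⟩ Θ₀`. -/
theorem faceD_one_theta_zero (x : X k B) (s : ⨂[k]^0 (X k B)) (a : B) (t : ⨂[k]^0 B) :
    faceD k B 0 1 (theta b 1 (consL 0 x s ⊗ₜ consL 0 a t)) =
      theta b 0 (fX k B 0 0 1 (fB k B 1 0 1 (consL 0 x s ⊗ₜ consL 0 a t))) := by
  have hs : ∀ (z : ⨂[k]^0 (Double k B)) d, faceD k B 0 1 (consL 0 d z) = counitDouble k B d • z :=
    fun z d => by rw [← snocL_zero, hFace_snocL]
  rw [theta_consL]
  simp only [map_sum, map_sw, hs]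
  rw [counit_theta, ← snocL_zero t a, fB_snocL, diagL_consL]
  have e : ∀ u v : B, consL 0 (actL k B u x) (diagL k B 0 v s) =
      Coalgebra.counit (R := k) v • consL 0 (actL k B u x) s := fun u v => by
    rw [diagL, diagAct_zero, map_smul]
  simp only [e]
  rw [sw_counit_right (f := fun u : B => consL 0 (actL k B u x) s) ⟨by simp, by simp⟩,
    ← snocL_zero, fX_snocL, coactL_zero]
  simp only [diagR, diagAct_zero, coactR_zero, TensorProduct.tmul_smul, ← TensorProduct.smul_tmul',
    map_smul]
  have := sw_counit_right (k := k) (f := fun u : B => (actR k B u x 1) • theta b 0 (s ⊗ₜ t))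
    ⟨by simp [add_smul], by simp [mul_smul]⟩ a
  simp only [actL_apply, actR_apply, one_mul, mul_one] at this ⊢
  rw [← this]
  exact congrArg (fun F => sw k F a) (funext fun u => funext fun v => smul_comm _ _ _)

/-- Unfolding `Θ` twice, the product of the first two factors in `D(B)` is exactly the sum evaluated
by `thetaStep_mul`. -/
theorem faceD_one_theta [FiniteDimensional k B] (n : ℕ) (x y : X k B) (s : ⨂[k]^n (X k B)) (a c : B)
    (t : ⨂[k]^n B) :
    faceD k B (n + 1) 1 (theta b (n + 2)
      (consL (n + 1) x (consL n y s) ⊗ₜ consL (n + 1) a (consL n c t))) =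
      theta b (n + 1) (fX k B (n + 1) (n + 1) 1 (fB k B (n + 2) (n + 1) 1
        (consL (n + 1) x (consL n y s) ⊗ₜ consL (n + 1) a (consL n c t)))) := by
  rw [fB_ctr _ _ _ (by omega), fX_ctr _ _ _ (by omega), ctr_zero_consL, ctr_zero_consL,
    theta_consL b (n + 1), theta_consL b n]
  refine Eq.trans ?_ (thetaStep_mul b (thetaKernel n (theta b n) s t) x y a c)
  simp only [map_sum, map_sw, faceD, hFace_ctr _ _ _ _ (Nat.succ_pos n), diagR_consL, coactR_consL,
    sw_tmul, tmul_sw]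
  refine Finset.sum_congr rfl fun i _ => ?_
  refine congrArg (fun F => sw k F a) (funext fun p => funext fun r => ?_)
  refine congrArg (fun F => sw k F p) (funext fun u => funext fun v => ?_)
  refine (sw_sw_comm _ _ _).trans ?_
  refine congrArg (fun F => sw k F r) (funext fun w => funext fun c' => ?_)
  refine congrArg (fun F => sw k F c) (funext fun u' => funext fun r' => ?_)
  rw [theta_consL]
  simp only [map_sum, map_sw, ctr_zero_consL]
  refine Finset.sum_congr rfl fun j _ => ?_
  refine congrArg (fun F => sw k F r') (funext fun t' => funext fun c'' => ?_)
  refine congrArg (fun F => sw k F t') (funext fun v' => funext fun w' => ?_)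
  rw [thetaKernel_apply, diagR_mul, coactR_mulX]

variable (k) in
/-- The Sweedler sum `∑ F a₁ a₂ a₃`. -/
def sw3 {W : Type*} [AddCommMonoid W] (F : B → B → B → W) (a : B) : W :=
  sw k (fun u r => sw k (fun v w => F u v w) r) a

theorem sw_sw3_comm {W : Type*} [AddCommMonoid W] [Module k W] (F : B → B → B → B → B → W)
    (a c : B) :
    sw k (fun u v => sw3 k (F u v) c) a =
      sw3 k (fun p q r => sw k (fun u v => F u v p q r) a) c := by
  simp only [sw3]
  rw [sw_sw_comm]
  refine congrArg (fun F => sw k F c) (funext fun u' => funext fun r' => ?_)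
  rw [sw_sw_comm]

theorem fX_fB_snocL_snocL (n : ℕ) (s : ⨂[k]^n (X k B)) (x : X k B) (t : ⨂[k]^n B) (a : B) :
    fX k B n n (n + 1) (fB k B (n + 1) n (n + 1) (snocL n s x ⊗ₜ snocL n t a)) =
      sw k (fun u v => diagL k B n u s ⊗ₜ coactL k B n (actL k B v x) t) a := by
  rw [fB_snocL, diagL_snocL, sw_tmul, map_sw]
  simp only [fX_snocL]

/-- The diagonal side of the last face, written with the recursion for `Θ` unfolded, in the shape
produced by applying the last face to the tail. -/
theorem fX_fB_last (n : ℕ) (x : X k B) (s : ⨂[k]^n (X k B)) (x' : X k B) (a : B) (t : ⨂[k]^n B)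
    (a' : B) :
    theta b (n + 1) (fX k B (n + 1) (n + 1) (n + 2) (fB k B (n + 2) (n + 1) (n + 2)
      (consL (n + 1) x (snocL n s x') ⊗ₜ consL (n + 1) a (snocL n t a')))) =
    ∑ i, sw3 k (fun b₁ b₂ b₃ => sw k (fun q d => sw k (fun p c => sw k (fun u v =>
      consL n (b.coord i ⊗ₜ v) (theta b n (diagR k B n c (diagL k B n b₂ s) ⊗ₜ
        coactR k B n (actR k B (b i * u) (actL k B b₁ x)) (coactL k B n (actR k B d (actL k B b₃ x')) t))))
          p) q) a) a' := by
  rw [← snocL_consL, ← snocL_consL, fX_fB_snocL_snocL]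
  simp only [diagL_consL, coactL_consL, sw_tmul, tmul_sw, map_sw, theta_consL]
  simp only [sw_sum]
  refine Finset.sum_congr rfl fun i _ => ?_
  rw [sw3, ← sw_sw_left]
  · exact congrArg (fun F => sw k F a') (funext fun u => funext fun v => sw_sw_comm _ _ _)
  · exact .of
      (fun _ _ => isLin_sw (fun _ _ => isLin_sw (fun _ _ => isLin_sw (fun _ _ =>
        ⟨by simp [TensorProduct.tmul_add], by simp⟩) _) _) _)
      (fun _ _ => isLin_sw (fun _ _ => isLin_sw (fun _ _ => isLin_sw (fun _ _ =>
        ⟨by simp [TensorProduct.add_tmul], by simp [← TensorProduct.smul_tmul']⟩) _) _) _)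
      (fun _ _ => isLin_sw (fun _ _ => isLin_sw (fun _ _ => isLin_sw (fun _ _ =>
        ⟨by simp [TensorProduct.tmul_add], by simp⟩) _) _) _)

theorem sw_sw_left_sw {W : Type*} [AddCommMonoid W] [Module k W] {G : B → B → B → B → W}
    (h₁ : ∀ v c d, IsLin k fun u => G u v c d) (h₂ : ∀ u c d, IsLin k fun v => G u v c d)
    (h₃ : ∀ u v d, IsLin k fun c => G u v c d) (h₄ : ∀ u v c, IsLin k (G u v c)) (a : B) :
    sw k (fun q d => sw k (fun p c => sw k (fun u v => G u v c d) p) q) a =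
      sw k (fun p r => sw k (fun u v => sw k (fun c d => G u v c d) r) p) a := by
  rw [sw_sw_left (F := fun p c d => sw k (fun u v => G u v c d) p) (.of
    (fun c d => sw_isLin ⟨fun v => h₁ v c d, fun u => h₂ u c d⟩)
    (fun _ d => isLin_sw (fun u v => h₃ u v d) _) (fun _ c => isLin_sw (fun u v => h₄ u v c) _))]
  exact congrArg (fun F => sw k F a) (funext fun p => funext fun r => (sw_sw_comm _ _ _).symm)

theorem isLin_sw3 {V W : Type*} [AddCommMonoid V] [Module k V] [AddCommMonoid W] [Module k W]
    {F : V → B → B → B → W} (h : ∀ u v w, IsLin k fun x => F x u v w) (a : B) :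
    IsLin k fun x => sw3 k (F x) a :=
  isLin_sw (fun _ _ => isLin_sw (fun _ _ => h _ _ _) _) _

/-- The summand in the last face of `Θ`. -/
def thetaLast (n : ℕ) (x : X k B) (s : ⨂[k]^n (X k B)) (x' : X k B) (t : ⨂[k]^n B) (i : ι)
    (b₁ b₂ b₃ u v c d : B) : ⨂[k]^(n + 1) (Double k B) :=
  consL n (b.coord i ⊗ₜ v) (theta b n (diagR k B n c (diagL k B n b₂ s) ⊗ₜ
    coactR k B n (actR k B (b i * u) (actL k B b₁ x)) (coactL k B n (actR k B d (actL k B b₃ x')) t)))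

theorem thetaLast_isLin (n : ℕ) (x : X k B) (s : ⨂[k]^n (X k B)) (x' : X k B) (t : ⨂[k]^n B) (i : ι)
    (b₁ b₂ b₃ : B) :
    IsQuad k fun u v c d => thetaLast b n x s x' t i b₁ b₂ b₃ u v c d where
  one _ _ _ := ⟨fun _ _ => by
    simp only [thetaLast, mul_add, map_add, LinearMap.add_apply, TensorProduct.tmul_add], fun _ _ => by
    simp only [thetaLast, mul_smul_comm, map_smul, LinearMap.smul_apply, TensorProduct.tmul_smul]⟩
  two _ _ _ := ⟨fun _ _ => by
    simp only [thetaLast, map_add, LinearMap.add_apply, TensorProduct.tmul_add], fun _ _ => by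
    simp only [thetaLast, map_smul, LinearMap.smul_apply, TensorProduct.tmul_smul]⟩
  three _ _ _ := ⟨fun _ _ => by
    simp only [thetaLast, map_add, LinearMap.add_apply, TensorProduct.add_tmul], fun _ _ => by
    simp only [thetaLast, map_smul, LinearMap.smul_apply, ← TensorProduct.smul_tmul']⟩
  four _ _ _ := ⟨fun _ _ => by
    simp only [thetaLast, map_add, LinearMap.add_apply, TensorProduct.tmul_add], fun _ _ => by
    simp only [thetaLast, map_smul, LinearMap.smul_apply, TensorProduct.tmul_smul]⟩

theorem sw_sw3_left {W : Type*} [AddCommMonoid W] [Module k W] {G : B → B → B → B → B → B → B → W}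
    (h : ∀ b₁ b₂ b₃, IsQuad k (G b₁ b₂ b₃)) (a a' : B) :
    sw k (fun q d => sw k (fun p c => sw k (fun u v =>
      sw3 k (fun b₁ b₂ b₃ => G b₁ b₂ b₃ u v c d) a') p) q) a =
    sw k (fun p r => sw k (fun u v => sw k (fun c d =>
      sw3 k (fun b₁ b₂ b₃ => G b₁ b₂ b₃ u v c d) a') r) p) a :=
  sw_sw_left_sw (G := fun u v c d => sw3 k (fun b₁ b₂ b₃ => G b₁ b₂ b₃ u v c d) a')
    (fun v c d => isLin_sw3 (fun b₁ b₂ b₃ => (h b₁ b₂ b₃).one v c d) a')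
    (fun u c d => isLin_sw3 (fun b₁ b₂ b₃ => (h b₁ b₂ b₃).two u c d) a')
    (fun u v d => isLin_sw3 (fun b₁ b₂ b₃ => (h b₁ b₂ b₃).three u v d) a')
    (fun u v c => isLin_sw3 (fun b₁ b₂ b₃ => (h b₁ b₂ b₃).four u v c) a')
    a


/-- The last face touches only the tail, where it is known. The operations introduced by the
recursion act from the right and those of the last face from the left, and the two commute. -/
theorem faceD_last_theta (n : ℕ) (ih : ∀ y, faceD k B n (n + 1) (theta b (n + 1) y) =
      theta b n (fX k B n n (n + 1) (fB k B (n + 1) n (n + 1) y)))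
    (x : X k B) (s : ⨂[k]^n (X k B)) (x' : X k B) (a : B) (t : ⨂[k]^n B) (a' : B) :
    faceD k B (n + 1) (n + 2) (theta b (n + 2)
      (consL (n + 1) x (snocL n s x') ⊗ₜ consL (n + 1) a (snocL n t a'))) =
    theta b (n + 1) (fX k B (n + 1) (n + 1) (n + 2) (fB k B (n + 2) (n + 1) (n + 2)
      (consL (n + 1) x (snocL n s x') ⊗ₜ consL (n + 1) a (snocL n t a')))) := by
  rw [fX_fB_last, theta_consL]
  simp only [map_sum, map_sw, faceD, hFace_succ_consL _ _ _ _ le_rfl]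
  refine Finset.sum_congr rfl fun i _ => ?_
  simp only [diagR_snocL, coactR_snocL, sw_tmul, tmul_sw, map_sw, ih, fX_fB_snocL_snocL]
  simp only [← sw_sw3_comm]
  refine Eq.trans ?_ (sw_sw3_left (thetaLast_isLin b n x s x' t i) a a').symm
  refine congrArg (fun F => sw k F a) (funext fun p => funext fun r => ?_)
  refine congrArg (fun F => sw k F p) (funext fun u => funext fun v => ?_)
  refine (sw_sw_comm _ _ _).trans ?_
  simp only [sw3, thetaLast, diagL_diagR, actL_actR, coactL_coactR]

/-- Face `0` is the counit computation and face `1` the multiplicativity of `thetaStep` (or a counit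
computation on one factor). Every higher face reduces to the tail and follows by induction on `n`.
-/
theorem faceD_theta [FiniteDimensional k B] (n : ℕ) : ∀ i, i ≤ n + 1 →
    faceD k B n i ∘ₗ theta b (n + 1) = theta b n ∘ₗ fX k B n n i ∘ₗ fB k B (n + 1) n i := by
  induction n with
  | zero =>
    intro i hi
    refine consL_consL_ext fun x s a t => ?_
    rcases i with _ | _ | i
    · exact faceD_zero_theta b 0 x s a t
    · exact faceD_one_theta_zero b x s a t
    · omega
  | succ n ih =>
    intro i hi
    rcases i with _ | _ | i
    · exact consL_consL_ext fun x s a t => faceD_zero_theta b (n + 1) x s a t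
    · refine TensorProduct.ext (hom_ext_consL fun x s => hom_ext_consL fun a t => ?_)
      induction s using consL_induction with
      | h y s =>
        induction t using consL_induction with
        | h c t => exact faceD_one_theta b n x y s a c t
        | hadd u v hu hv => simp only [map_add, hu, hv]
        | hsmul c u hu => simp only [map_smul, hu]
      | hadd u v hu hv => simp only [map_add, LinearMap.add_apply, hu, hv]
      | hsmul c u hu => simp only [map_smul, LinearMap.smul_apply, hu]
    · rcases eq_or_lt_of_le hi with hi | hi
      · obtain rfl : i = n := by omega
        refine TensorProduct.ext (hom_ext_consL fun x s => hom_ext_consL fun a t => ?_)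
        induction s using pure_induction with
        | h m =>
          induction t using pure_induction with
          | h m' =>
            rw [pure_succ_last, pure_succ_last]
            exact faceD_last_theta b i (fun y => LinearMap.congr_fun (ih (i + 1) le_rfl) y) _ _ _ _ _ _
          | hadd u v hu hv => simp only [map_add, hu, hv]
          | hsmul c u hu => simp only [map_smul, hu]
        | hadd u v hu hv => simp only [map_add, LinearMap.add_apply, hu, hv]
        | hsmul c u hu => simp only [map_smul, LinearMap.smul_apply, hu]
      · refine consL_consL_ext fun x s a t => ?_
        have hi' : i < n := by omega
        have ih' := fun y => LinearMap.congr_fun (ih (i + 1) (by omega)) y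
        simp only [LinearMap.comp_apply] at ih' ⊢
        rw [fB_ctr _ _ _ (by omega), fX_ctr _ _ _ (by omega), ctr_succ_consL, ctr_succ_consL,
          theta_consL, theta_consL]
        simp only [map_sum, map_sw, faceD, hFace_succ_consL _ _ _ _ hi'.le]
        simp only [faceD] at ih'
        simp only [ih', fB_ctr _ _ _ hi', fX_ctr _ _ _ hi', diagR_ctr, coactR_ctr]

end ThetaMap
end
end BialgebraCohomology

namespace BialgebraCohomology
noncomputable section
universe u v w
set_option linter.unusedSectionVars false

/-! ### The isomorphism of the diagonal complex with the standard complex of `D(B)` -/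

section HatAct

variable {k : Type u} [Field k] {B : Type v} [Ring B] [HopfAlgebra k B]
variable {V : Type w} [AddCommMonoid V] [Module k V]

/-- The map `x ⊗ 𝐚 ↦ T(â₁) x ⊗ 𝐚₂`. -/
def hatAct (T : B →ₗ[k] V →ₗ[k] V) (n : ℕ) : V ⊗[k] ⨂[k]^n B →ₗ[k] V ⊗[k] ⨂[k]^n B :=
  (TensorProduct.lift (T ∘ₗ hat k B n).flip).rTensor (⨂[k]^n B) ∘ₗ
    (TensorProduct.assoc k V (⨂[k]^n B) (⨂[k]^n B)).symm.toLinearMap ∘ₗ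
    (comulPow k B n).lTensor V

theorem hatAct_zero (T : B →ₗ[k] V →ₗ[k] V) (h : ∀ s, T 1 s = s) (y : V ⊗[k] ⨂[k]^0 B) :
    hatAct T 0 y = y := by
  induction y using TensorProduct.induction_on with
  | zero => simp
  | add y y' hy hy' => rw [map_add, hy, hy']
  | tmul s t =>
    induction t using pure_induction with
    | h m =>
      rw [hatAct, LinearMap.comp_apply, LinearMap.comp_apply, LinearMap.lTensor_tmul,
        comulPow_zero _ m]
      simp [hat_zero, h]
    | hadd t t' ht ht' => rw [TensorProduct.tmul_add, map_add, ht, ht']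
    | hsmul c t ht => rw [TensorProduct.tmul_smul, map_smul, ht]

/-- No multiplicativity of `T` is assumed, so the first entry stays inside as a left multiplication.
The formula thus covers `S⁻¹` followed by an action, which is antimultiplicative. -/
theorem hatAct_consL (T : B →ₗ[k] V →ₗ[k] V) (n : ℕ) (s : V) (a : B) (t : ⨂[k]^n B) :
    hatAct T (n + 1) (s ⊗ₜ consL n a t) = sw k (fun u v =>
      TensorProduct.map LinearMap.id (consL n v) (hatAct (T ∘ₗ LinearMap.mulLeft k u) n (s ⊗ₜ t))) a := by
  rw [hatAct, LinearMap.comp_apply, LinearMap.comp_apply, LinearMap.lTensor_tmul, comulPow_consL,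
    tmul_sw, map_sw, map_sw]
  refine congrArg (fun F => sw k F a) (funext fun u => funext fun v => ?_)
  simp only [hatAct, LinearMap.comp_apply, LinearMap.lTensor_tmul]
  induction comulPow k B n t using TensorProduct.induction_on with
  | zero => simp
  | add y y' hy hy' => simp only [map_add, TensorProduct.tmul_add, hy, hy']
  | tmul t₁ t₂ => simp [hat_consL]

/-- Naturality in the coefficients, with different maps before and after. This is what lets an
operator `T u` be taken out of `hatAct` or pushed into it. -/
theorem hatAct_map {V' : Type*} [AddCommMonoid V'] [Module k V'] (T : B →ₗ[k] V →ₗ[k] V)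
    (T' : B →ₗ[k] V' →ₗ[k] V') (f g : V →ₗ[k] V')
    (h : ∀ a s, T' a (f s) = g (T a s)) (n : ℕ) (y : V ⊗[k] ⨂[k]^n B) :
    hatAct T' n (TensorProduct.map f LinearMap.id y) =
      TensorProduct.map g LinearMap.id (hatAct T n y) := by
  induction y using TensorProduct.induction_on with
  | zero => simp
  | add y y' hy hy' => simp only [map_add, hy, hy']
  | tmul s t =>
    simp only [hatAct, LinearMap.comp_apply, LinearMap.lTensor_tmul, TensorProduct.map_tmul]
    induction comulPow k B n t using TensorProduct.induction_on with
    | zero => simp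
    | add y y' hy hy' => simp only [map_add, TensorProduct.tmul_add, hy, hy']
    | tmul t₁ t₂ => simp [h]

theorem hatAct_map_consL (T : B →ₗ[k] V →ₗ[k] V) (n : ℕ) (f : V →ₗ[k] V) (a : B)
    (y : V ⊗[k] ⨂[k]^n B) :
    hatAct T (n + 1) (TensorProduct.map f (consL n a) y) = sw k (fun u v =>
      TensorProduct.map LinearMap.id (consL n v)
        (hatAct (T ∘ₗ LinearMap.mulLeft k u) n (TensorProduct.map f LinearMap.id y))) a := by
  induction y using TensorProduct.induction_on with
  | zero => simp [sw]
  | add y y' hy hy' => simp only [map_add, hy, hy', sw_add_fun]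
  | tmul s t => simp only [TensorProduct.map_tmul, hatAct_consL, LinearMap.id_apply]

theorem hatAct_consL_of_mul {T : B →ₗ[k] V →ₗ[k] V} (h : ∀ a c s, T (a * c) s = T a (T c s)) (n : ℕ)
    (s : V) (a : B) (t : ⨂[k]^n B) :
    hatAct T (n + 1) (s ⊗ₜ consL n a t) = sw k (fun u v =>
      TensorProduct.map (T u) (consL n v) (hatAct T n (s ⊗ₜ t))) a := by
  rw [hatAct_consL]
  refine congrArg (fun F => sw k F a) (funext fun u => funext fun v => ?_)
  have := hatAct_map T (T ∘ₗ LinearMap.mulLeft k u) LinearMap.id (T u) (fun a s => h u a s) n (s ⊗ₜ t)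
  rw [TensorProduct.map_id, LinearMap.id_apply] at this
  rw [this, ← LinearMap.comp_apply, ← TensorProduct.map_comp]
  rfl

/-- The maps `x ⊗ 𝐚 ↦ â₁ x ⊗ 𝐚₂` and `x ⊗ 𝐚 ↦ S⁻¹(â₁) x ⊗ 𝐚₂` are inverse to each other. -/
theorem hatAct_antipodeInv_hatAct [FiniteDimensional k B] {T : B →ₗ[k] V →ₗ[k] V}
    (h : ∀ a c s, T (a * c) s = T a (T c s)) (h1 : ∀ s, T 1 s = s) (n : ℕ) (y : V ⊗[k] ⨂[k]^n B) :
    hatAct (T ∘ₗ antipodeInv k B) n (hatAct T n y) = y := by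
  induction n with
  | zero => rw [hatAct_zero T h1, hatAct_zero _ fun s => by simp [antipodeInv_one, h1]]
  | succ n ih =>
    induction y using TensorProduct.induction_on with
    | zero => simp
    | add y y' hy hy' => rw [map_add, map_add, hy, hy']
    | tmul s t =>
      induction t using consL_induction with
      | hadd t t' ht ht' => rw [TensorProduct.tmul_add, map_add, map_add, ht, ht']
      | hsmul c t ht => rw [TensorProduct.tmul_smul, map_smul, map_smul, ht]
      | h a t =>
        have hlin : ∀ f : ⨂[k]^n B →ₗ[k] ⨂[k]^(n + 1) B, ∀ z, IsLin k fun c : B =>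
            TensorProduct.map LinearMap.id f (hatAct (T ∘ₗ antipodeInv k B) n
              (TensorProduct.map (T c) LinearMap.id z)) := fun f z =>
          ⟨by simp [TensorProduct.map_add_left], by simp [TensorProduct.map_smul_left]⟩
        -- As `S⁻¹(p c) = S⁻¹(c) S⁻¹(p)`, the factor `S⁻¹(p)` acts first and meets `T u` directly.
        have e : ∀ u p, ∀ z : V ⊗[k] ⨂[k]^n B,
            hatAct ((T ∘ₗ antipodeInv k B) ∘ₗ LinearMap.mulLeft k p) n
              (TensorProduct.map (T u) LinearMap.id z) =
            hatAct (T ∘ₗ antipodeInv k B) n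
              (TensorProduct.map (T (antipodeInv k B p * u)) LinearMap.id z) := fun u p z => by
          have := hatAct_map ((T ∘ₗ antipodeInv k B) ∘ₗ LinearMap.mulLeft k p) (T ∘ₗ antipodeInv k B)
            (T (antipodeInv k B p)) LinearMap.id (fun c s => by
              simp [antipodeInv_mul, h]) n (TensorProduct.map (T u) LinearMap.id z)
          rw [TensorProduct.map_id, LinearMap.id_apply] at this
          rw [← this, ← LinearMap.comp_apply (TensorProduct.map _ _), ← TensorProduct.map_comp,
            LinearMap.id_comp]
          congr 3
          exact LinearMap.ext fun s => (h _ _ s).symm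
        rw [hatAct_consL_of_mul h, map_sw]
        simp only [hatAct_map_consL, e]
        rw [← sw_sw_left (F := fun u p q => TensorProduct.map LinearMap.id (consL n q)
          (hatAct (T ∘ₗ antipodeInv k B) n (TensorProduct.map (T (antipodeInv k B p * u))
            LinearMap.id (hatAct T n (s ⊗ₜ t)))))
          (.of (fun p q => ⟨fun _ _ => by rw [mul_add, (hlin _ _).add],
              fun _ _ => by rw [mul_smul_comm, (hlin _ _).smul]⟩)
            (fun u q => ⟨fun _ _ => by rw [map_add, add_mul, (hlin _ _).add],
              fun _ _ => by rw [map_smul, smul_mul_assoc, (hlin _ _).smul]⟩)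
            (fun u p => ⟨by simp [TensorProduct.map_add_right], by simp [TensorProduct.map_smul_right]⟩))]
        -- `S⁻¹(a₂) a₁` collapses to the counit, after which the two maps on the tail are adjacent
        -- and the induction hypothesis applies.
        simp only [sw_antipodeInv_mul (hlin _ _)]
        have hT : T 1 = LinearMap.id := LinearMap.ext h1
        simp only [hT, TensorProduct.map_id, LinearMap.id_apply, ih, TensorProduct.map_tmul]
        exact sw_counit_left (f := fun q => s ⊗ₜ consL n q t)
          ⟨by simp [TensorProduct.tmul_add], by simp⟩ a

end HatAct

/-! ### The composite of `c̃` with `Θ`. -/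

section FlipTheta

variable {k : Type u} [Field k] {B : Type v} [Ring B] [HopfAlgebra k B]
variable {ι : Type*} [Fintype ι] (b : Module.Basis ι k B)

theorem flipAll_consL (n : ℕ) (x : X k B) (a : B) (z : ⨂[k]^n (Double k B)) :
    flipAll k B (n + 1) (consL n (x ⊗ₜ a) z) = sw k (fun p c => sw k (fun u v =>
      TensorProduct.map (consL n x ∘ₗ diagL k B n u ∘ₗ diagR k B n (antipodeInv k B c)) (consL n v)
        (flipAll k B n z)) p) a := by
  rw [flipAll]
  simp only [LinearMap.comp_apply, headSplit_consL, LinearMap.lTensor_tmul, LinearEquiv.coe_coe,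
    TensorProduct.assoc_tmul]
  induction flipAll k B n z using TensorProduct.induction_on with
  | zero => simp [sw]
  | add y y' hy hy' => simp only [map_add, TensorProduct.tmul_add, sw_add_fun, hy, hy']
  | tmul s t =>
    simp only [TensorProduct.assoc_symm_tmul, LinearMap.rTensor_tmul, flipMap_tmul, sw_tmul]
    simp only [← LinearEquiv.coe_coe, map_sw, tmul_sw]
    rfl

theorem map_diagL_consL (n m : ℕ) (x : X k B) (u : B) (g : ⨂[k]^m B →ₗ[k] ⨂[k]^(m + 1) B)
    (z : XB k B n m) :
    TensorProduct.map (diagL k B (n + 1) u) g (TensorProduct.map (consL n x) LinearMap.id z) =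
      sw k (fun u v => TensorProduct.map (consL n (actL k B u x) ∘ₗ diagL k B n v) g z) u := by
  induction z using TensorProduct.induction_on with
  | zero => simp [sw]
  | add y y' hy hy' => simp only [map_add, sw_add_fun, hy, hy']
  | tmul s t =>
    simp only [TensorProduct.map_tmul, LinearMap.id_apply, diagL_consL, sw_tmul, LinearMap.comp_apply]

theorem map_consL_map (n m : ℕ) (x : X k B) (f : ⨂[k]^n (X k B) →ₗ[k] ⨂[k]^n (X k B))
    (g : ⨂[k]^m B →ₗ[k] ⨂[k]^(m + 1) B) (z : XB k B n m) :
    TensorProduct.map (consL n x) LinearMap.id (TensorProduct.map f g z) =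
      TensorProduct.map (consL n x ∘ₗ f) g z := by
  rw [← LinearMap.comp_apply, ← TensorProduct.map_comp, LinearMap.id_comp]

/-- `x, u, v, c ↦ (x ⊗ -)u ⊗ (v ⊗ -)` applied to `^{𝐭̂₁}𝐬 ⊗ 𝐭₂`, where `𝐭` is acted upon by `ᶜy`. -/
def lamStep (n m : ℕ) (s : ⨂[k]^n (X k B)) (t : ⨂[k]^m B) (y x : X k B) (u v c : B) :
    XB k B (n + 1) (m + 1) :=
  TensorProduct.map (consL n x ∘ₗ diagL k B n u) (consL m v)
    (hatAct (diagL k B n) m (s ⊗ₜ coactR k B m (actR k B c y) t))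

theorem lamStep_isLin₀ (n m : ℕ) (s : ⨂[k]^n (X k B)) (t : ⨂[k]^m B) (y : X k B) (u v c : B) :
    IsLin k fun x => lamStep n m s t y x u v c :=
  ⟨by simp [lamStep, LinearMap.add_comp, TensorProduct.map_add_left],
    by simp [lamStep, LinearMap.smul_comp, TensorProduct.map_smul_left]⟩

theorem lamStep_isLin₁ (n m : ℕ) (s : ⨂[k]^n (X k B)) (t : ⨂[k]^m B) (y x : X k B) (v c : B) :
    IsLin k fun u => lamStep n m s t y x u v c :=
  ⟨by simp [lamStep, LinearMap.comp_add, TensorProduct.map_add_left],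
    by simp [lamStep, LinearMap.comp_smul, TensorProduct.map_smul_left]⟩

theorem lamStep_isLin₂ (n m : ℕ) (s : ⨂[k]^n (X k B)) (t : ⨂[k]^m B) (y x : X k B) (u c : B) :
    IsLin k fun v => lamStep n m s t y x u v c :=
  ⟨by simp [lamStep, TensorProduct.map_add_right], by simp [lamStep, TensorProduct.map_smul_right]⟩

theorem lamStep_isLin₃ (n m : ℕ) (s : ⨂[k]^n (X k B)) (t : ⨂[k]^m B) (y x : X k B) (u v : B) :
    IsLin k fun c => lamStep n m s t y x u v c :=
  ⟨by simp [lamStep, TensorProduct.tmul_add], by simp [lamStep]⟩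

/-- By `^c x = ∑ ⟨x, eᵢ c⟩ eⁱ`, the action on the first factor becomes a scalar pairing of `x^{eᵢ}`
with a coproduct factor of `t̂`. That pairing is a coaction on the tensor in `B`, which is the shape
of the recursion for `Θ`. -/
theorem hatAct_diagL_consL (n m : ℕ) (x : X k B) (s : ⨂[k]^n (X k B)) (t : ⨂[k]^m B) :
    hatAct (diagL k B (n + 1)) m (consL n x s ⊗ₜ t) = ∑ i,
      TensorProduct.map (consL n (b.coord i)) LinearMap.id
        (hatAct (diagL k B n) m (s ⊗ₜ coactR k B m (actR k B (b i) x) t)) := by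
  induction m generalizing x with
  | zero =>
    simp only [hatAct_zero _ (diagL_one _), coactR_zero, actR_apply, mul_one,
      TensorProduct.tmul_smul, map_smul, TensorProduct.map_tmul, LinearMap.id_apply]
    conv_lhs => rw [← coord_expand b x]
    simp only [map_sum, map_smul, LinearMap.sum_apply, LinearMap.smul_apply, TensorProduct.sum_tmul,
      TensorProduct.smul_tmul']
  | succ m ih =>
    induction t using consL_induction with
    | hadd t t' ht ht' =>
      simp only [TensorProduct.tmul_add, map_add, ht, ht', Finset.sum_add_distrib]
    | hsmul c t ht => simp only [TensorProduct.tmul_smul, map_smul, ht, Finset.smul_sum]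
    | h a t =>
      have hm : ∀ n, ∀ a c : B, ∀ s, diagL k B n (a * c) s = diagL k B n a (diagL k B n c s) :=
        diagL_mul
      rw [hatAct_consL_of_mul (hm _)]
      simp only [ih, coactR_consL, tmul_sw, map_sw, hatAct_consL_of_mul (hm _), map_sum,
        map_diagL_consL, map_consL_map, ← actR_mul]
      rw [sw_sum]
      change ∑ i, sw k (fun p v => sw k (fun u₁ u₂ =>
          lamStep n m s t x (actL k B u₁ (b.coord i)) u₂ v (b i)) p) a =
        ∑ i, sw k (fun p r => sw k (fun u v => lamStep n m s t x (b.coord i) u v (b i * p)) r) a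
      have e : ∀ i, sw k (fun p v => sw k (fun u₁ u₂ =>
          lamStep n m s t x (actL k B u₁ (b.coord i)) u₂ v (b i)) p) a = sw k (fun p r =>
          sw k (fun u v => lamStep n m s t x (actL k B p (b.coord i)) u v (b i)) r) a := fun i =>
        sw_sw_left (F := fun u₁ u₂ v => lamStep n m s t x (actL k B u₁ (b.coord i)) u₂ v (b i))
          (.of (fun v w => ⟨fun _ _ => by rw [map_add, LinearMap.add_apply, (lamStep_isLin₀ ..).add],
              fun _ _ => by rw [map_smul, LinearMap.smul_apply, (lamStep_isLin₀ ..).smul]⟩)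
            (fun _ _ => lamStep_isLin₁ ..) (fun _ _ => lamStep_isLin₂ ..)) a
      simp only [e]
      rw [← sw_sum, ← sw_sum]
      refine congrArg (fun F => sw k F a) (funext fun p => funext fun r => ?_)
      rw [← sw_sum, ← sw_sum]
      refine congrArg (fun F => sw k F r) (funext fun u => funext fun v => ?_)
      -- The two sides differ by an action of `p` on `eⁱ` against a multiplication of `eᵢ` by `p`.
      exact sum_actL_coord b (F := fun y c => lamStep n m s t x y u v c)
        (fun c => lamStep_isLin₀ ..) (fun _ => lamStep_isLin₃ ..) p

end FlipTheta
end
end BialgebraCohomology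

namespace BialgebraCohomology
noncomputable section
universe u v w
set_option linter.unusedSectionVars false

section FlipTheta

variable {k : Type u} [Field k] {B : Type v} [Ring B] [HopfAlgebra k B]
variable {ι : Type*} [Fintype ι] (b : Module.Basis ι k B)

theorem map_map_id {V₁ V₂ V₃ V₄ V₅ : Type*} [AddCommMonoid V₁] [Module k V₁] [AddCommMonoid V₂]
    [Module k V₂] [AddCommMonoid V₃] [Module k V₃] [AddCommMonoid V₄] [Module k V₄]
    [AddCommMonoid V₅] [Module k V₅] (f : V₂ →ₗ[k] V₃) (f' : V₁ →ₗ[k] V₂) (g : V₄ →ₗ[k] V₅)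
    (z : V₁ ⊗[k] V₄) :
    TensorProduct.map f g (TensorProduct.map f' LinearMap.id z) = TensorProduct.map (f ∘ₗ f') g z := by
  rw [← LinearMap.comp_apply, ← TensorProduct.map_comp, LinearMap.comp_id]

/-- The right action of `a₃` built into `Θ` is there to be cancelled by the inverse antipode of the
flip: the two combine to `c₂ S⁻¹(c₁)`, whose sum is the counit. -/
theorem flipStep [FiniteDimensional k B] (n m : ℕ) (s : ⨂[k]^n (X k B)) (t : ⨂[k]^m B)
    (y x : X k B) (a : B) (i : ι) :
    sw k (fun p c => sw k (fun u v => sw k (fun p' c' => sw k (fun u' v' =>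
      TensorProduct.map (consL n x ∘ₗ diagL k B n u' ∘ₗ diagR k B n (antipodeInv k B c')) (consL m v')
        (hatAct (diagL k B n) m (diagR k B n c s ⊗ₜ coactR k B m (actR k B (b i * u) y) t))) p') v) p)
          a =
      sw k (fun u r => sw k (fun u' v' => lamStep n m s t y x u' v' (b i * u)) r) a := by
  have e : ∀ c c' u u' v', TensorProduct.map
        (consL n x ∘ₗ diagL k B n u' ∘ₗ diagR k B n (antipodeInv k B c')) (consL m v')
        (hatAct (diagL k B n) m (diagR k B n c s ⊗ₜ coactR k B m (actR k B (b i * u) y) t)) =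
      lamStep n m (diagR k B n (c * antipodeInv k B c') s) t y x u' v' (b i * u) := by
    intro c c' u u' v'
    have h1 : ∀ d, hatAct (diagL k B n) m (diagR k B n d s ⊗ₜ coactR k B m (actR k B (b i * u) y) t) =
        TensorProduct.map (diagR k B n d) LinearMap.id
          (hatAct (diagL k B n) m (s ⊗ₜ coactR k B m (actR k B (b i * u) y) t)) := fun d =>
      hatAct_map (diagL k B n) (diagL k B n) (diagR k B n d) (diagR k B n d)
        (fun a s => diagL_diagR n a d s) m (s ⊗ₜ coactR k B m (actR k B (b i * u) y) t)
    rw [lamStep, h1, h1, map_map_id, map_map_id]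
    congr 2
    exact LinearMap.ext fun z => by simp [diagR_mul]
  simp only [e]
  have hs : ∀ u u' v', IsLin k fun d : B => lamStep n m (diagR k B n d s) t y x u' v' (b i * u) :=
    fun u u' v' => ⟨by simp [lamStep, TensorProduct.add_tmul],
      by simp [lamStep, ← TensorProduct.smul_tmul']⟩
  have hp : ∀ d, ∀ u : B, IsBilin k fun u' v' : B =>
      lamStep n m (diagR k B n d s) t y x u' v' (b i * u) := fun d u =>
    ⟨fun v' => lamStep_isLin₁ .., fun u' => lamStep_isLin₂ ..⟩
  have hu : ∀ d, ∀ u' v' : B, IsLin k fun u => lamStep n m (diagR k B n d s) t y x u' v' (b i * u) :=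
    fun d u' v' => ⟨fun _ _ => by rw [mul_add, (lamStep_isLin₃ ..).add],
      fun _ _ => by rw [mul_smul_comm, (lamStep_isLin₃ ..).smul]⟩
  have hq : IsQuad k fun u p' c' c : B => sw k (fun u' v' =>
      lamStep n m (diagR k B n (c * antipodeInv k B c') s) t y x u' v' (b i * u)) p' :=
    ⟨fun p' c' c => isLin_sw (fun u' v' => hu _ u' v') p', fun u c' c => sw_isLin (hp _ u),
      fun u p' c => isLin_sw (fun u' v' => ⟨fun _ _ => by rw [map_add, mul_add, (hs u u' v').add],
        fun _ _ => by rw [map_smul, mul_smul_comm, (hs u u' v').smul]⟩) p',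
      fun u p' c' => isLin_sw (fun u' v' => ⟨fun _ _ => by rw [add_mul, (hs u u' v').add],
        fun _ _ => by rw [smul_mul_assoc, (hs u u' v').smul]⟩) p'⟩
  rw [sw_sw_left (F := fun u v c => sw k (fun p' c' => sw k (fun u' v' =>
      lamStep n m (diagR k B n (c * antipodeInv k B c') s) t y x u' v' (b i * u)) p') v)
    (.of (fun v c => isLin_sw (fun p' c' => hq.one p' c' c) v)
      (fun u c => sw_isLin ⟨fun c' => hq.two u c' c, fun p' => hq.three u p' c⟩)
      (fun u v => isLin_sw (fun p' c' => hq.four u p' c') v))]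
  refine (sw4_balanced hq a).symm.trans ?_
  have e2 : ∀ u p' r : B, sw k (fun c' c => sw k (fun u' v' =>
      lamStep n m (diagR k B n (c * antipodeInv k B c') s) t y x u' v' (b i * u)) p') r =
      Coalgebra.counit (R := k) r • sw k (fun u' v' => lamStep n m s t y x u' v' (b i * u)) p' := by
    intro u p' r
    rw [sw_mul_antipodeInv (f := fun d => sw k (fun u' v' =>
      lamStep n m (diagR k B n d s) t y x u' v' (b i * u)) p') (isLin_sw (fun u' v' => hs u u' v') p')]
    simp only [diagR_one]
  simp only [e2, sw_smul_fun]
  have hl := hp 1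
  have hl' := hu 1
  simp only [diagR_one] at hl hl'
  exact sw_counit_right (f := fun p : B => sw k (fun u p' : B => sw k (fun u' v' =>
      lamStep n m s t y x u' v' (b i * u)) p') p)
    (sw_isLin ⟨fun p' => isLin_sw (fun u' v' => hl' u' v') p', fun u => sw_isLin (hl u)⟩) a

/-- Moving the factors of `X` to the left after `Θ` leaves only the twist `𝐱 ⊗ 𝐚 ↦ ^{â₁}𝐱 ⊗ 𝐚₂`,
which is the one that `φ` inverts. -/
theorem flipAll_theta [FiniteDimensional k B] (n : ℕ) (y : XB k B n n) :
    flipAll k B n (theta b n y) = hatAct (diagL k B n) n y := by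
  suffices flipAll k B n ∘ₗ theta b n = hatAct (diagL k B n) n from LinearMap.congr_fun this y
  clear y
  induction n with
  | zero =>
    refine TensorProduct.ext (hom_ext_pure fun m => hom_ext_pure fun m' => ?_)
    simp only [LinearMap.compr₂ₛₗ_apply, LinearMap.comp_apply, TensorProduct.mk_apply]
    rw [theta_zero b m m' 0, hatAct_zero _ (diagL_one _)]
    simp [flipAll, pure_zero]
  | succ n ih =>
    refine consL_consL_ext fun x s a t => ?_
    have ih' := fun z => LinearMap.congr_fun ih z
    simp only [LinearMap.comp_apply] at ih' ⊢
    rw [theta_consL, hatAct_diagL_consL b]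
    simp only [map_sum, map_sw, flipAll_consL, ih', flipStep]
    refine Finset.sum_congr rfl fun i _ => ?_
    simp only [coactR_consL, ← actR_mul, tmul_sw, map_sw, hatAct_consL_of_mul (T := diagL k B n)
      (diagL_mul n), map_consL_map]
    rfl

theorem phi_eq (n : ℕ) : phi k B n = hatAct (diagL k B n ∘ₗ antipodeInv k B) n := rfl

theorem phi_flipAll_theta [FiniteDimensional k B] (n : ℕ) (y : XB k B n n) :
    phi k B n (flipAll k B n (theta b n y)) = y := by
  rw [flipAll_theta, phi_eq, hatAct_antipodeInv_hatAct (diagL_mul n) (diagL_one n)]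

/-! ### Bijectivity by dimension count, and the isomorphism of complexes. -/

theorem finrank_tensorPower {V : Type*} [AddCommMonoid V] [Module k V] {κ : Type*} [Fintype κ]
    (b : Module.Basis κ k V) (n : ℕ) : Module.finrank k (⨂[k]^n V) = Fintype.card κ ^ n := by
  classical
  rw [Module.finrank_eq_card_basis (Basis.piTensorProduct fun _ : Fin n => b)]
  simp

theorem comp_eq_id_of_finrank_eq {V V' : Type*} [AddCommMonoid V] [Module k V] [AddCommMonoid V']
    [Module k V'] [Module.Finite k V] [Module.Finite k V']
    (h : Module.finrank k V = Module.finrank k V') (f : V →ₗ[k] V') (g : V' →ₗ[k] V)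
    (hgf : g ∘ₗ f = LinearMap.id) : f ∘ₗ g = LinearMap.id := by
  -- Modules over a field have negatives; the dimension argument is about vector spaces as groups.
  let _ := Module.addCommMonoidToAddCommGroup k (M := V)
  let _ := Module.addCommMonoidToAddCommGroup k (M := V')
  have hf : Function.Injective f := fun x y e => by
    rw [← LinearMap.id_apply (R := k) x, ← LinearMap.id_apply (R := k) y, ← hgf,
      LinearMap.comp_apply, LinearMap.comp_apply, e]
  have hs := (LinearMap.injective_iff_surjective_of_finrank_eq_finrank h).mp hf
  refine LinearMap.ext fun y => ?_
  obtain ⟨x, rfl⟩ := hs y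
  exact congrArg f (LinearMap.congr_fun hgf x)

/-- `Θ` has a left inverse, and source and target both have dimension `(dim B)^{2n}`. -/
theorem theta_phi_flipAll [FiniteDimensional k B] (n : ℕ) (z : ⨂[k]^n (Double k B)) :
    theta b n (phi k B n (flipAll k B n z)) = z := by
  classical
  have hX := Basis.piTensorProduct fun _ : Fin n => b.dualBasis
  have hB := Basis.piTensorProduct fun _ : Fin n => b
  have hD := Basis.piTensorProduct fun _ : Fin n => b.dualBasis.tensorProduct b
  have : Module.Finite k (XB k B n n) := .of_basis (hX.tensorProduct hB)
  have : Module.Finite k (⨂[k]^n (Double k B)) := .of_basis hD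
  refine LinearMap.congr_fun (comp_eq_id_of_finrank_eq ?_ (theta b n)
    (phi k B n ∘ₗ flipAll k B n) (LinearMap.ext (phi_flipAll_theta b n))) z
  rw [finrank_tensorPower (b.dualBasis.tensorProduct b),
    Module.finrank_eq_card_basis (hX.tensorProduct hB)]
  simp [mul_pow]

theorem psiDual_bijective [FiniteDimensional k B] (n : ℕ) : Function.Bijective (psiDual k B n) := by
  let b := Module.finBasis k B
  refine Function.bijective_iff_has_inverse.mpr ⟨(theta b n).dualMap, fun f => ?_, fun g => ?_⟩
  · exact LinearMap.ext fun y => congrArg f (phi_flipAll_theta b n y)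
  · exact LinearMap.ext fun z => congrArg g (theta_phi_flipAll b n z)

theorem hochschildD_eq {A : Type*} [AddCommMonoid A] [Module k A] (mul : A →ₗ[k] A →ₗ[k] A)
    (ε : A →ₗ[k] k) (n : ℕ) (f : Module.Dual k (⨂[k]^n A)) :
    hochschildD mul ε n f = ∑ i ∈ Finset.range (n + 2), (-1 : k) ^ i • f ∘ₗ hFace mul ε n i := by
  rw [Finset.sum_range]
  refine LinearMap.ext fun z => ?_
  simp [hochschildD, hFace, LinearMap.sum_apply]

theorem diagD_eq_sum (n : ℕ) (f : Module.Dual k (XB k B n n)) :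
    diagD k B n f = ∑ i ∈ Finset.range (n + 2), (-1 : k) ^ i •
      f ∘ₗ fX k B n n i ∘ₗ fB k B (n + 1) n i := by
  rw [Finset.sum_range]
  refine LinearMap.ext fun z => ?_
  simp [diagD, fX, fB, LinearMap.sum_apply]

/-- Every element of `D(B)^{n+1}` is of the form `Θ(y)`. On such elements the comparison of faces is
`faceD_theta`. -/
theorem psiDual_diagD [FiniteDimensional k B] (n : ℕ) (f : Module.Dual k (XB k B n n)) :
    psiDual k B (n + 1) (diagD k B n f) = dDouble k B n (psiDual k B n f) := by
  let b := Module.finBasis k B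
  refine LinearMap.ext fun z => ?_
  rw [← theta_phi_flipAll b (n + 1) z]
  generalize phi k B (n + 1) (flipAll k B (n + 1) z) = y
  rw [dDouble, hochschildD_eq, diagD_eq_sum]
  simp only [psiDual, LinearMap.dualMap_apply, LinearMap.comp_apply, phi_flipAll_theta,
    LinearMap.sum_apply, LinearMap.smul_apply]
  refine Finset.sum_congr rfl fun i hi => congrArg _ ?_
  have := LinearMap.congr_fun (faceD_theta b n i (by simpa [Nat.lt_succ_iff] using hi)) y
  rw [LinearMap.comp_apply] at this
  rw [this, LinearMap.comp_apply, LinearMap.comp_apply, phi_flipAll_theta]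

/-- The map `(φ c̃)*` induces isomorphisms in cohomology. -/
theorem exists_equiv_psiDual [FiniteDimensional k B] (n : ℕ) :
    ∃ Ψ : Cohomology (diagD k B) n ≃ₗ[k] Cohomology (dDouble k B) n,
      IsInducedBy (diagD k B) (dDouble k B) n (psiDual k B n) Ψ.toLinearMap :=
  exists_equiv_isInducedBy_of_bijective psiDual_diagD psiDual_bijective n

end FlipTheta
end
end BialgebraCohomology

namespace BialgebraCohomology
noncomputable section
universe u v w
set_option linter.unusedSectionVars false

/-! ### Restriction to the edges of a bicosimplicial group -/

namespace BiCosimplicial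

variable (M : BiCosimplicial.{w})

/-- The edge `M 0 *`, extended constantly in the first direction. -/
abbrev constX : BiCosimplicial.{w} where
  obj _ q := M.obj 0 q
  dX _ q _ := AddMonoidHom.id (M.obj 0 q)
  dB _ q i := M.dB 0 q i
  sX _ q _ := AddMonoidHom.id (M.obj 0 q)
  sB _ q i := M.sB 0 q i
  dX_dX _ _ _ _ _ _ _ := rfl
  dB_dB _ q i j x := M.dB_dB 0 q i j x
  sX_dX_lt _ _ _ _ _ _ _ := rfl
  sX_dX_self _ _ _ _ _ := rfl
  sX_dX_succ _ _ _ _ _ := rfl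
  sX_dX_gt _ _ _ _ _ _ _ := rfl
  sB_dB_lt _ q i j x := M.sB_dB_lt 0 q i j x
  sB_dB_self _ q j x := M.sB_dB_self 0 q j x
  sB_dB_succ _ q j x := M.sB_dB_succ 0 q j x
  sB_dB_gt _ q i j x := M.sB_dB_gt 0 q i j x
  dX_dB _ _ _ _ _ _ _ := rfl
  sX_dB _ _ _ _ _ _ _ := rfl
  sB_dX _ _ _ _ _ _ _ := rfl

/-- The edge `M * 0`, extended constantly in the second direction. -/
abbrev constB : BiCosimplicial.{w} where
  obj p _ := M.obj p 0
  dX p _ i := M.dX p 0 i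
  dB p _ _ := AddMonoidHom.id (M.obj p 0)
  sX p _ i := M.sX p 0 i
  sB p _ _ := AddMonoidHom.id (M.obj p 0)
  dX_dX p _ i j x := M.dX_dX p 0 i j x
  dB_dB _ _ _ _ _ _ _ := rfl
  sX_dX_lt p _ i j x := M.sX_dX_lt p 0 i j x
  sX_dX_self p _ j x := M.sX_dX_self p 0 j x
  sX_dX_succ p _ j x := M.sX_dX_succ p 0 j x
  sX_dX_gt p _ i j x := M.sX_dX_gt p 0 i j x
  sB_dB_lt _ _ _ _ _ _ _ := rfl
  sB_dB_self _ _ _ _ _ := rfl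
  sB_dB_succ _ _ _ _ _ := rfl
  sB_dB_gt _ _ _ _ _ _ _ := rfl
  dX_dB _ _ _ _ _ _ _ := rfl
  sX_dB _ _ _ _ _ _ _ := rfl
  sB_dX _ _ _ _ _ _ _ := rfl

/-- The iterated zeroth codegeneracy `M p q → M 0 q`. -/
def degenX (q : ℕ) : ∀ p, M.obj p q →+ M.obj 0 q
  | 0 => AddMonoidHom.id _
  | p + 1 => (degenX q p).comp (M.sX p q 0)

/-- The iterated zeroth codegeneracy `M p q → M p 0`. -/
def degenB (p : ℕ) : ∀ q, M.obj p q →+ M.obj p 0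
  | 0 => AddMonoidHom.id _
  | q + 1 => (degenB p q).comp (M.sB p q 0)

/-- Cofaces of index `0` and `1` cancel against the zeroth codegeneracy at once. The others have
their index lowered until they do. -/
theorem degenX_dX (p q i : ℕ) (x : M.obj p q) (hi : i ≤ p + 1) :
    M.degenX q (p + 1) (M.dX p q i x) = M.degenX q p x := by
  induction p generalizing i with
  | zero =>
    rcases i with _ | i
    · exact congrArg (M.degenX q 0) (M.sX_dX_self 0 q 0 x le_rfl)
    · obtain rfl : i = 0 := by omega
      exact congrArg (M.degenX q 0) (M.sX_dX_succ 0 q 0 x le_rfl)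
  | succ p ih =>
    rcases i with _ | _ | i
    · exact congrArg (M.degenX q _) (M.sX_dX_self (p + 1) q 0 x (by omega))
    · exact congrArg (M.degenX q _) (M.sX_dX_succ (p + 1) q 0 x (by omega))
    · refine (congrArg (M.degenX q _)
        (M.sX_dX_gt p q (i + 1) 0 x (by omega) (by omega))).trans ?_
      exact ih _ _ (by omega)

theorem degenB_dB (p q i : ℕ) (x : M.obj p q) (hi : i ≤ q + 1) :
    M.degenB p (q + 1) (M.dB p q i x) = M.degenB p q x := by
  induction q generalizing i with
  | zero =>
    rcases i with _ | i
    · exact congrArg (M.degenB p 0) (M.sB_dB_self p 0 0 x le_rfl)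
    · obtain rfl : i = 0 := by omega
      exact congrArg (M.degenB p 0) (M.sB_dB_succ p 0 0 x le_rfl)
  | succ q ih =>
    rcases i with _ | _ | i
    · exact congrArg (M.degenB p _) (M.sB_dB_self p (q + 1) 0 x (by omega))
    · exact congrArg (M.degenB p _) (M.sB_dB_succ p (q + 1) 0 x (by omega))
    · refine (congrArg (M.degenB p _)
        (M.sB_dB_gt p q (i + 1) 0 x (by omega) (by omega))).trans ?_
      exact ih _ _ (by omega)

/-- The codegeneracies map `M` to its edge `M 0 *`. -/
def toConstX : Hom M M.constX where
  app p q := M.degenX q p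
  app_dX p q i x hi := M.degenX_dX p q i x hi
  app_dB p q i x hi := by
    induction p with
    | zero => rfl
    | succ p ih =>
      exact (congrArg (M.degenX _ p) (M.sX_dB p q 0 i x (by omega) hi)).trans (ih _)

/-- The codegeneracies map `M` to its edge `M * 0`. -/
def toConstB : Hom M M.constB where
  app p q := M.degenB p q
  app_dB p q i x hi := M.degenB_dB p q i x hi
  app_dX p q i x hi := by
    induction q with
    | zero => rfl
    | succ q ih =>
      exact (congrArg (M.degenB _ q) (M.sB_dX p q i 0 x hi (by omega))).trans (ih _)

/-! ### A total cocycle compared with its Alexander–Whitney image on an edge. -/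

variable {M}

/-- Total cocycles with the same image under the Alexander–Whitney map are cohomologous. -/
theorem exists_totDiff_of_aw_eq {n : ℕ} {f g : M.Fam} (hf : M.IsTotCocycle (n + 1) f)
    (hg : M.IsTotCocycle (n + 1) g) (h : M.aw (n + 1) f = M.aw (n + 1) g) :
    ∃ e, ∀ p q, p + q = n + 1 → M.totDiff e p q = f p q - g p q := by
  refine (aw_bijective (n + 1) M).2 (f - g) (fun p q hpq => ?_) ⟨0, ?_⟩
  · rw [totDiff_sub, Pi.sub_apply, Pi.sub_apply, hf p q hpq, hg p q hpq, sub_zero]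
  · have := M.aw_add (n + 1) (f - g) g
    rw [sub_add_cancel, h] at this
    rw [map_zero]
    exact (left_eq_add.mp (this.trans (add_comm _ _))).symm

/-- A family concentrated in one bidegree. -/
def single (a c : ℕ) (x : M.obj a c) : M.Fam := fun p q =>
  if h : p = a ∧ q = c then h.1 ▸ h.2 ▸ x else 0

theorem single_self (a c : ℕ) (x : M.obj a c) : single a c x a c = x := by simp [single]

theorem single_of_ne {a c p q : ℕ} (x : M.obj a c) (h : ¬(p = a ∧ q = c)) : single a c x p q = 0 :=
  dif_neg h

theorem aw_single {a c n : ℕ} (h : a + c = n) (x : M.obj a c) :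
    M.aw n (single a c x) = (M.zeroB ^ a * M.lastX ^ c) (single a c x) n n := by
  rw [aw, Finset.sum_eq_single (⟨a, c⟩ : ℕ × ℕ)]
  · rintro ⟨p, q⟩ hpq hne
    have hpq : p + q = n := Finset.HasAntidiagonal.mem_antidiagonal.mp hpq
    refine (M.zeroB_pow_mul_lastX_pow_congr (g := 0)
      (single_of_ne x fun e => hne (Prod.ext e.1 e.2)) q p hpq.symm (by omega)).trans ?_
    rw [map_zero]
    rfl
  · intro h'
    exact absurd (Finset.HasAntidiagonal.mem_antidiagonal.mpr h) h'

theorem bD_aw_eq_zero {n : ℕ} {f : M.Fam} (hf : M.IsTotCocycle n f) : M.bD n (M.aw n f) = 0 := by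
  have h0 : M.aw (n + 1) 0 = 0 := by simpa using M.aw_add (n + 1) 0 0
  rw [bD_aw, M.aw_congr (g := 0) fun p q h => hf p q h, h0]

theorem fam_isTotCocycle {N : BiCosimplicial.{w}} (φ : Hom M N) {n : ℕ} {f : M.Fam}
    (hf : M.IsTotCocycle n f) : N.IsTotCocycle n (φ.fam f) := fun p q h => by
  rw [← φ.app_totDiff, hf p q h, map_zero]

theorem lastX_constX (f : M.constX.Fam) (q m : ℕ) : (M.constX.lastX ^ m) f m q = f 0 q := by
  induction m with
  | zero => rfl
  | succ m ih => rw [pow_succ', end_mul_apply, ← ih]; rfl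

theorem zeroB_constB (f : M.constB.Fam) (p m : ℕ) : (M.constB.zeroB ^ m) f p m = f p 0 := by
  induction m with
  | zero => rfl
  | succ m ih =>
    rw [pow_succ', end_mul_apply, ← ih]
    exact M.constB.raiseB_succ _ _ _ _

/-- In the constant direction the first differential is the difference of two identities, hence
zero. So a cocycle on the edge, extended by zero, stays a cocycle. -/
theorem single_constX_isTotCocycle {n : ℕ} (g : M.constX.obj 0 n) (hg : M.constX.bB 0 n g = 0) :
    M.constX.IsTotCocycle n (single 0 n g) := by
  intro p q hpq
  rcases p with _ | p
  · obtain rfl : q = n + 1 := by omega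
    rw [totDiff, raiseX_zero, raiseB_succ, single_self, hg, smul_zero, add_zero]
  · have hB : M.constX.raiseB M.constX.bB (single 0 n g) (p + 1) q = 0 := by
      rcases q with _ | q
      · rw [raiseB_zero]
      · rw [raiseB_succ, single_of_ne _ (by omega), map_zero]
    rw [totDiff, raiseX_succ, hB, smul_zero, add_zero]
    rcases p with _ | p
    · obtain rfl : q = n := by omega
      rw [single_self, bX_apply]
      simp [Finset.sum_range_succ]
    · rw [single_of_ne _ (by omega), map_zero]

theorem single_constB_isTotCocycle {n : ℕ} (g : M.constB.obj n 0) (hg : M.constB.bX n 0 g = 0) :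
    M.constB.IsTotCocycle n (single n 0 g) := by
  intro p q hpq
  rcases q with _ | q
  · obtain rfl : p = n + 1 := by omega
    rw [totDiff, raiseB_zero, raiseX_succ, single_self, hg, smul_zero, add_zero]
  · have hX : M.constB.raiseX M.constB.bX (single n 0 g) p (q + 1) = 0 := by
      rcases p with _ | p
      · rw [raiseX_zero]
      · rw [raiseX_succ, single_of_ne _ (by omega), map_zero]
    rw [totDiff, raiseB_succ, hX, zero_add]
    rcases q with _ | q
    · obtain rfl : p = n := by omega
      rw [single_self, bB_apply]
      simp [Finset.sum_range_succ]
    · rw [single_of_ne _ (by omega), map_zero, smul_zero]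

/-- The restriction of the Alexander–Whitney image of a cocycle to the edge `M 0 *`. -/
theorem exists_bB_eq {n : ℕ} {f : M.Fam} (hf : M.IsTotCocycle (n + 1) f) :
    ∃ y, M.bB 0 n y = f 0 (n + 1) - M.degenX (n + 1) (n + 1) (M.aw (n + 1) f) := by
  have hf' := fam_isTotCocycle M.toConstX hf
  have hw := M.toConstX.app_aw (n + 1) f
  have hg := bD_aw_eq_zero hf'
  rw [← hw, bD_apply] at hg
  -- The last cofaces of `constX` are identities, so the family concentrated on the edge has its own
  -- value as Alexander–Whitney image. That value was chosen to be the image of `f`.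
  obtain ⟨e, he⟩ := exists_totDiff_of_aw_eq (M := M.constX) hf'
    (single_constX_isTotCocycle (M.degenX (n + 1) (n + 1) (M.aw (n + 1) f))
      ((M.constX.bB_apply _ _ _).trans hg)) (by
      rw [aw_single (Nat.zero_add _), pow_zero, one_mul, lastX_constX, single_self, ← hw]
      rfl)
  refine ⟨e 0 n, ?_⟩
  -- In bidegree `(0, n + 1)` only the `B`-differential contributes, so the total coboundary becomes
  -- one on the edge.
  have := he 0 (n + 1) (Nat.zero_add _)
  rw [single_self, totDiff, raiseX_zero, raiseB_succ, pow_zero, one_smul, zero_add] at this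
  exact (M.bB_apply _ _ _).trans ((M.constX.bB_apply _ _ _).symm.trans this)

/-- The restriction of the Alexander–Whitney image of a cocycle to the edge `M * 0`. -/
theorem exists_bX_eq {n : ℕ} {f : M.Fam} (hf : M.IsTotCocycle (n + 1) f) :
    ∃ y, M.bX n 0 y = f (n + 1) 0 - M.degenB (n + 1) (n + 1) (M.aw (n + 1) f) := by
  have hf' := fam_isTotCocycle M.toConstB hf
  have hw := M.toConstB.app_aw (n + 1) f
  have hg := bD_aw_eq_zero hf'
  rw [← hw, bD_apply] at hg
  obtain ⟨e, he⟩ := exists_totDiff_of_aw_eq (M := M.constB) hf'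
    (single_constB_isTotCocycle (M.degenB (n + 1) (n + 1) (M.aw (n + 1) f))
      ((M.constB.bX_apply _ _ _).trans hg)) (by
      rw [aw_single (Nat.add_zero _), pow_zero, mul_one, zeroB_constB, single_self, ← hw]
      rfl)
  refine ⟨e n 0, ?_⟩
  have := he (n + 1) 0 (Nat.add_zero _)
  rw [single_self, totDiff, raiseX_succ, raiseB_zero, smul_zero, add_zero] at this
  exact (M.bX_apply _ _ _).trans ((M.constB.bX_apply _ _ _).symm.trans this)

end BiCosimplicial
end
end BialgebraCohomology

namespace BialgebraCohomology
noncomputable section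
universe u v w
set_option linter.unusedSectionVars false

/-! ### The edges of `𝐂` -/

section Edges

variable {k : Type u} [Field k] {B : Type v} [Ring B] [HopfAlgebra k B]

variable (k B) in
/-- The identification of `Bⁿ` with `X⁰ ⊗ Bⁿ`. -/
def inclEdgeB (n : ℕ) : ⨂[k]^n B →ₗ[k] XB k B 0 n :=
  TensorProduct.mk k (⨂[k]^0 (X k B)) (⨂[k]^n B) (PiTensorProduct.tprod k Fin.elim0)

variable (k B) in
/-- The identification of `Xⁿ` with `Xⁿ ⊗ B⁰`. -/
def inclEdgeX (n : ℕ) : ⨂[k]^n (X k B) →ₗ[k] XB k B n 0 :=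
  (TensorProduct.mk k (⨂[k]^n (X k B)) (⨂[k]^0 B)).flip (PiTensorProduct.tprod k Fin.elim0)

theorem inclEdgeB_apply (n : ℕ) (t : ⨂[k]^n B) : inclEdgeB k B n t = pure k 0 0 ⊗ₜ t := by
  rw [pure_zero]; rfl

theorem inclEdgeX_apply (n : ℕ) (s : ⨂[k]^n (X k B)) : inclEdgeX k B n s = s ⊗ₜ pure k 0 0 := by
  rw [pure_zero]; rfl

/-- The diagonal actions on `X⁰` are through the counit, so the outer faces become those of trivial
coefficients. -/
theorem fB_inclEdgeB (n i : ℕ) (hi : i ≤ n + 1) (t : ⨂[k]^(n + 1) B) :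
    fB k B 0 n i (inclEdgeB k B (n + 1) t) =
      inclEdgeB k B n (hFace (LinearMap.mul k B) Coalgebra.counit n i t) := by
  suffices fB k B 0 n i ∘ₗ inclEdgeB k B (n + 1) =
    inclEdgeB k B n ∘ₗ hFace (LinearMap.mul k B) Coalgebra.counit n i from LinearMap.congr_fun this t
  rcases i with _ | i
  · refine hom_ext_consL fun a t => ?_
    simp only [LinearMap.comp_apply, inclEdgeB_apply, fB_consL, hFace_consL, diagR, diagAct_zero,
      TensorProduct.smul_tmul]
  · rcases eq_or_lt_of_le hi with hi | hi
    · obtain rfl : i = n := by omega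
      refine hom_ext_snocL fun t a => ?_
      simp only [LinearMap.comp_apply, inclEdgeB_apply, fB_snocL, hFace_snocL, diagL, diagAct_zero,
        TensorProduct.smul_tmul]
    · refine LinearMap.ext fun t => ?_
      simp only [LinearMap.comp_apply, inclEdgeB_apply, fB_ctr _ _ _ (show i < n by omega),
        hFace_ctr _ _ _ _ (show i < n by omega)]

theorem fX_inclEdgeX (n i : ℕ) (hi : i ≤ n + 1) (s : ⨂[k]^(n + 1) (X k B)) :
    fX k B n 0 i (inclEdgeX k B (n + 1) s) =
      inclEdgeX k B n (hFace (mulX k B) (counitX k B) n i s) := by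
  suffices fX k B n 0 i ∘ₗ inclEdgeX k B (n + 1) =
    inclEdgeX k B n ∘ₗ hFace (mulX k B) (counitX k B) n i from LinearMap.congr_fun this s
  rcases i with _ | i
  · refine hom_ext_consL fun x s => ?_
    simp only [LinearMap.comp_apply, inclEdgeX_apply, fX_consL, hFace_consL, coactR_zero,
      counitX_apply, TensorProduct.smul_tmul]
  · rcases eq_or_lt_of_le hi with hi | hi
    · obtain rfl : i = n := by omega
      refine hom_ext_snocL fun s x => ?_
      simp only [LinearMap.comp_apply, inclEdgeX_apply, fX_snocL, hFace_snocL, coactL_zero,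
        counitX_apply, TensorProduct.smul_tmul]
    · refine LinearMap.ext fun t => ?_
      simp only [LinearMap.comp_apply, inclEdgeX_apply, fX_ctr _ _ _ (show i < n by omega),
        hFace_ctr _ _ _ _ (show i < n by omega)]

theorem bB_inclEdgeB (n : ℕ) (f : Module.Dual k (XB k B 0 n)) :
    (inclEdgeB k B (n + 1)).dualMap ((bicomplex k B).bB 0 n f) =
      dB k B n ((inclEdgeB k B n).dualMap f) := by
  rw [BiCosimplicial.bB_apply, dB, hochschildD_eq, map_sum]
  refine Finset.sum_congr rfl fun i hi => ?_
  rw [neg_one_pow_zsmul (k := k), map_smul]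
  refine congrArg _ (LinearMap.ext fun t => ?_)
  exact congrArg f (fB_inclEdgeB n i (by simpa [Nat.lt_succ_iff] using hi) t)

theorem bX_inclEdgeX (n : ℕ) (f : Module.Dual k (XB k B n 0)) :
    (inclEdgeX k B (n + 1)).dualMap ((bicomplex k B).bX n 0 f) =
      dX k B n ((inclEdgeX k B n).dualMap f) := by
  rw [BiCosimplicial.bX_apply, dX, hochschildD_eq, map_sum]
  refine Finset.sum_congr rfl fun i hi => ?_
  rw [neg_one_pow_zsmul (k := k), map_smul]
  refine congrArg _ (LinearMap.ext fun t => ?_)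
  exact congrArg f (fX_inclEdgeX n i (by simpa [Nat.lt_succ_iff] using hi) t)

theorem edgeB_totPi (n : ℕ) (f : Tot k B n) :
    edgeB k B n (totPi k B n f) = (inclEdgeB k B n).dualMap (famOf f 0 n) := by
  rw [famOf_apply f (Nat.zero_add n)]
  rfl

theorem edgeX_totPi (n : ℕ) (f : Tot k B n) :
    edgeX k B n (totPi k B n f) = (inclEdgeX k B n).dualMap (famOf f n 0) := by
  rw [famOf_apply f (Nat.add_zero n)]
  rfl

theorem totPi_surjective (n : ℕ) : Function.Surjective (totPi k B n) := Submodule.mkQ_surjective _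

theorem totPi_totD (n : ℕ) (f : Tot k B n) :
    totPi k B (n + 1) (totD k B n f) = tot₁D k B n (totPi k B n f) := rfl

theorem edgeB_tot₁D (n : ℕ) (y : Tot₁ k B n) :
    edgeB k B (n + 1) (tot₁D k B n y) = dB k B n (edgeB k B n y) := by
  obtain ⟨f, rfl⟩ := totPi_surjective n y
  rw [← totPi_totD, edgeB_totPi, edgeB_totPi, famOf_apply _ (Nat.zero_add _), totProj_totD,
    BiCosimplicial.totDiff, BiCosimplicial.raiseX_zero, BiCosimplicial.raiseB_succ, pow_zero, one_smul,
    zero_add, bB_inclEdgeB]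

theorem edgeX_tot₁D (n : ℕ) (y : Tot₁ k B n) :
    edgeX k B (n + 1) (tot₁D k B n y) = dX k B n (edgeX k B n y) := by
  obtain ⟨f, rfl⟩ := totPi_surjective n y
  rw [← totPi_totD, edgeX_totPi, edgeX_totPi, famOf_apply _ (Nat.add_zero _), totProj_totD,
    BiCosimplicial.totDiff, BiCosimplicial.raiseX_succ, BiCosimplicial.raiseB_zero, smul_zero,
    add_zero, bX_inclEdgeX]

theorem inclEdgeB_surjective (n : ℕ) : Function.Surjective (inclEdgeB k B n) := fun y => by
  induction y using TensorProduct.induction_on with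
  | zero => exact ⟨0, map_zero _⟩
  | add y y' hy hy' =>
    obtain ⟨t, rfl⟩ := hy
    obtain ⟨t', rfl⟩ := hy'
    exact ⟨t + t', map_add _ _ _⟩
  | tmul s t =>
    refine ⟨PiTensorProduct.isEmptyEquiv (Fin 0) s • t, ?_⟩
    rw [map_smul, inclEdgeB, TensorProduct.mk_apply, TensorProduct.smul_tmul']
    congr 1
    refine (PiTensorProduct.isEmptyEquiv (R := k) (s := fun _ => X k B) (Fin 0)).injective ?_
    simp

theorem inclEdgeX_surjective (n : ℕ) : Function.Surjective (inclEdgeX k B n) := fun y => by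
  induction y using TensorProduct.induction_on with
  | zero => exact ⟨0, map_zero _⟩
  | add y y' hy hy' =>
    obtain ⟨t, rfl⟩ := hy
    obtain ⟨t', rfl⟩ := hy'
    exact ⟨t + t', map_add _ _ _⟩
  | tmul s t =>
    refine ⟨PiTensorProduct.isEmptyEquiv (Fin 0) t • s, ?_⟩
    rw [map_smul, inclEdgeX, LinearMap.flip_apply, TensorProduct.mk_apply, ← TensorProduct.tmul_smul]
    congr 1
    refine (PiTensorProduct.isEmptyEquiv (R := k) (s := fun _ => B) (Fin 0)).injective ?_
    simp

/-- The two edge components together detect a class modulo `𝐂₀`, because `X⁰ ⊗ Bⁿ` and `Xⁿ ⊗ B⁰` are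
filled by `Bⁿ` and `Xⁿ`. -/
theorem tot₁_ext {n : ℕ} {y y' : Tot₁ k B n} (hB : edgeB k B n y = edgeB k B n y')
    (hX : edgeX k B n y = edgeX k B n y') : y = y' := by
  obtain ⟨f, rfl⟩ := totPi_surjective n y
  obtain ⟨f', rfl⟩ := totPi_surjective n y'
  rw [edgeB_totPi, edgeB_totPi] at hB
  rw [edgeX_totPi, edgeX_totPi] at hX
  have hB' := LinearMap.dualMap_injective_of_surjective (inclEdgeB_surjective n) hB
  have hX' := LinearMap.dualMap_injective_of_surjective (inclEdgeX_surjective n) hX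
  refine (Submodule.Quotient.eq _).mpr ?_
  rintro ⟨⟨p, q⟩, hpq⟩ h
  have e := Finset.HasAntidiagonal.mem_antidiagonal.mp hpq
  refine sub_eq_zero.mpr ?_
  refine (famOf_apply f e).symm.trans (Eq.trans ?_ (famOf_apply f' e))
  rcases h with h | h
  · obtain rfl : p = 0 := h
    obtain rfl : n = q := by omega
    exact hB'
  · obtain rfl : q = 0 := h
    obtain rfl : n = p := by omega
    exact hX'

theorem exists_dualMap_inclEdgeB (n : ℕ) (g : Module.Dual k (⨂[k]^n B)) :
    ∃ f, (inclEdgeB k B n).dualMap f = g := by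
  refine ⟨g ∘ₗ (TensorProduct.lid k _).toLinearMap ∘ₗ (PiTensorProduct.isEmptyEquiv
    (R := k) (s := fun _ => X k B) (Fin 0)).toLinearMap.rTensor _, LinearMap.ext fun t => ?_⟩
  simp [inclEdgeB]

theorem exists_dualMap_inclEdgeX (n : ℕ) (g : Module.Dual k (⨂[k]^n (X k B))) :
    ∃ f, (inclEdgeX k B n).dualMap f = g := by
  refine ⟨g ∘ₗ (TensorProduct.rid k _).toLinearMap ∘ₗ (PiTensorProduct.isEmptyEquiv
    (R := k) (s := fun _ => B) (Fin 0)).toLinearMap.lTensor _, LinearMap.ext fun t => ?_⟩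
  simp [inclEdgeX]

/-- Positive degree matters here: the bidegrees `(0, n + 1)` and `(n + 1, 0)` are distinct, while in
degree `0` both edges share one corner. -/
theorem exists_edge (n : ℕ) (gB : Module.Dual k (⨂[k]^(n + 1) B))
    (gX : Module.Dual k (⨂[k]^(n + 1) (X k B))) :
    ∃ y : Tot₁ k B (n + 1), edgeB k B (n + 1) y = gB ∧ edgeX k B (n + 1) y = gX := by
  obtain ⟨fB, rfl⟩ := exists_dualMap_inclEdgeB (n + 1) gB
  obtain ⟨fX, rfl⟩ := exists_dualMap_inclEdgeX (n + 1) gX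
  let M := bicomplex k B
  refine ⟨totPi k B (n + 1) (totOf (n + 1) (BiCosimplicial.single (M := M) 0 (n + 1) fB +
    BiCosimplicial.single (M := M) (n + 1) 0 fX)), ?_, ?_⟩
  · rw [edgeB_totPi, famOf_totOf _ (Nat.zero_add _), Pi.add_apply, Pi.add_apply,
      BiCosimplicial.single_self, BiCosimplicial.single_of_ne _ (by omega), add_zero]
  · rw [edgeX_totPi, famOf_totOf _ (Nat.add_zero _), Pi.add_apply, Pi.add_apply,
      BiCosimplicial.single_self, BiCosimplicial.single_of_ne _ (by omega), zero_add]

/-- With trivial coefficients both faces `A¹ → A⁰` are the augmentation, so they cancel. This saves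
degree `1`, where the edges in degree `0` below are not independent. -/
theorem hochschildD_zero {A : Type*} [AddCommMonoid A] [Module k A] (mul : A →ₗ[k] A →ₗ[k] A)
    (ε : A →ₗ[k] k) : hochschildD mul ε 0 = 0 := by
  refine LinearMap.ext fun f => hom_ext_consL fun a t => ?_
  rw [hochschildD_eq]
  have h1 : hFace mul ε 0 1 (consL 0 a t) = ε a • t := by rw [← snocL_zero, hFace_snocL]
  simp [Finset.sum_range_succ, hFace_consL, h1]

/-- The edge maps induce an isomorphism in positive degrees. -/
theorem exists_equiv_edge (n : ℕ) :
    ∃ E : Cohomology (tot₁D k B) (n + 1) ≃ₗ[k]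
        Cohomology (dB k B) (n + 1) × Cohomology (dX k B) (n + 1),
      IsInducedBy (tot₁D k B) (dB k B) (n + 1) (edgeB k B (n + 1))
        (LinearMap.fst k _ _ ∘ₗ E.toLinearMap) ∧
      IsInducedBy (tot₁D k B) (dX k B) (n + 1) (edgeX k B (n + 1))
        (LinearMap.snd k _ _ ∘ₗ E.toLinearMap) := by
  obtain ⟨fB, hB⟩ := exists_isInducedBy_of_comm (edgeB_tot₁D (k := k) (B := B)) (n + 1)
  obtain ⟨fX, hX⟩ := exists_isInducedBy_of_comm (edgeX_tot₁D (k := k) (B := B)) (n + 1)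
  suffices h : Function.Bijective (fB.prod fX) from ⟨LinearEquiv.ofBijective _ h, hB, hX⟩
  constructor
  · rw [injective_iff_map_eq_zero]
    intro c hc
    obtain ⟨z, rfl⟩ := cohomologyClass_surjective _ _ c
    obtain ⟨h₁, h₂⟩ := Prod.ext_iff.mp hc
    obtain ⟨hzB, eB⟩ := hB z
    obtain ⟨hzX, eX⟩ := hX z
    have hbB := (cohomologyClass_eq_zero_iff _).mp (eB.symm.trans h₁)
    have hbX := (cohomologyClass_eq_zero_iff _).mp (eX.symm.trans h₂)
    refine (cohomologyClass_eq_zero_iff z).mpr ?_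
    obtain ⟨yB, hyB⟩ := hbB
    obtain ⟨yX, hyX⟩ := hbX
    rcases n with _ | n
    -- In degree `1` the Hochschild coboundaries vanish, so both edge components of the cocycle are
    -- zero and `0` is a primitive.
    · refine ⟨0, tot₁_ext ?_ ?_⟩
      · rw [map_zero, map_zero]
        refine Eq.trans ?_ hyB
        rw [dB, hochschildD_zero, LinearMap.zero_apply]
      · rw [map_zero, map_zero]
        refine Eq.trans ?_ hyX
        rw [dX, hochschildD_zero, LinearMap.zero_apply]
    · obtain ⟨y, rfl, rfl⟩ := exists_edge n yB yX
      exact ⟨y, tot₁_ext ((edgeB_tot₁D _ y).trans hyB) ((edgeX_tot₁D _ y).trans hyX)⟩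
  · rintro ⟨c, c'⟩
    obtain ⟨z, rfl⟩ := cohomologyClass_surjective _ _ c
    obtain ⟨z', rfl⟩ := cohomologyClass_surjective _ _ c'
    obtain ⟨y, hy, hy'⟩ := exists_edge (k := k) (B := B) n z z'
    have hz : y ∈ cocycles (tot₁D k B) (n + 1) := by
      refine tot₁_ext ?_ ?_
      · rw [edgeB_tot₁D, hy, map_zero]
        exact z.2
      · rw [edgeX_tot₁D, hy', map_zero]
        exact z'.2
    refine ⟨cohomologyClass _ _ ⟨y, hz⟩, Prod.ext ?_ ?_⟩
    · obtain ⟨h, e⟩ := hB ⟨y, hz⟩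
      exact e.trans (congrArg _ (Subtype.ext hy))
    · obtain ⟨h, e⟩ := hX ⟨y, hz⟩
      exact e.trans (congrArg _ (Subtype.ext hy'))

end Edges
end
end BialgebraCohomology

namespace BialgebraCohomology
noncomputable section
universe u v w
set_option linter.unusedSectionVars false

/-! ### Restriction from `D(B)` to `B` and `X` -/

section Composite

variable {k : Type u} [Field k]
variable {C : ℕ → Type*} [∀ n, AddCommGroup (C n)] [∀ n, Module k (C n)]
variable {C₁ : ℕ → Type*} [∀ n, AddCommGroup (C₁ n)] [∀ n, Module k (C₁ n)]
variable {C₂ : ℕ → Type*} [∀ n, AddCommGroup (C₂ n)] [∀ n, Module k (C₂ n)]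
variable {C₃ : ℕ → Type*} [∀ n, AddCommGroup (C₃ n)] [∀ n, Module k (C₃ n)]
variable {C₄ : ℕ → Type*} [∀ n, AddCommGroup (C₄ n)] [∀ n, Module k (C₄ n)]
variable {d : ∀ n, C n →ₗ[k] C (n + 1)} {d₁ : ∀ n, C₁ n →ₗ[k] C₁ (n + 1)}
variable {d₂ : ∀ n, C₂ n →ₗ[k] C₂ (n + 1)} {d₃ : ∀ n, C₃ n →ₗ[k] C₃ (n + 1)}
variable {d₄ : ∀ n, C₄ n →ₗ[k] C₄ (n + 1)} {n : ℕ}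

/-- Comparison of a composite `C₂ ← C₁ ← C → C₃ → C₄` on cohomology with a map `C₂ → C₄`. -/
theorem IsInducedBy.zigzag_apply {φ : C n →ₗ[k] C₁ n} {ψ : C₁ n →ₗ[k] C₂ n} {π : C n →ₗ[k] C₃ n}
    {e : C₃ n →ₗ[k] C₄ n} {r : C₂ n →ₗ[k] C₄ n} {Φ : Cohomology d n ≃ₗ[k] Cohomology d₁ n}
    {Ψ : Cohomology d₁ n ≃ₗ[k] Cohomology d₂ n} {P : Cohomology d n →ₗ[k] Cohomology d₃ n}
    {E : Cohomology d₃ n →ₗ[k] Cohomology d₄ n} {R : Cohomology d₂ n →ₗ[k] Cohomology d₄ n}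
    (hΦ : IsInducedBy d d₁ n φ Φ.toLinearMap) (hΨ : IsInducedBy d₁ d₂ n ψ Ψ.toLinearMap)
    (hP : IsInducedBy d d₃ n π P) (hE : IsInducedBy d₃ d₄ n e E) (hR : IsInducedBy d₂ d₄ n r R)
    (h : ∀ z ∈ cocycles d n, e (π z) - r (ψ (φ z)) ∈ coboundaries d₄ n) (c : Cohomology d₂ n) :
    E (P (Φ.symm (Ψ.symm c))) = R c := by
  obtain ⟨c, rfl⟩ := Ψ.surjective c
  obtain ⟨c, rfl⟩ := Φ.surjective c
  obtain ⟨z, rfl⟩ := cohomologyClass_surjective _ _ c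
  obtain ⟨h₁, e₁⟩ := hΦ z
  obtain ⟨h₂, e₂⟩ := hΨ ⟨_, h₁⟩
  obtain ⟨h₃, e₃⟩ := hR ⟨_, h₂⟩
  obtain ⟨h₄, e₄⟩ := hP z
  obtain ⟨h₅, e₅⟩ := hE ⟨_, h₄⟩
  rw [LinearEquiv.symm_apply_apply, LinearEquiv.symm_apply_apply, e₄, e₅]
  refine Eq.symm ((congrArg (fun c => R (Ψ c)) e₁).trans ((congrArg R e₂).trans (e₃.trans ?_)))
  exact ((cohomologyClass_eq_iff _ _).mpr (h z z.2)).symm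

end Composite

/-! ### Restriction as an iterated codegeneracy, and the conclusion. -/

section Restriction

variable {k : Type u} [Field k] {B : Type v} [Ring B] [HopfAlgebra k B]

theorem map_pure {M N : Type*} [AddCommMonoid M] [Module k M] [AddCommMonoid N] [Module k N]
    (f : M →ₗ[k] N) (n : ℕ) (m : ℕ → M) :
    PiTensorProduct.map (fun _ : Fin n => f) (pure k n m) = pure k n fun l => f (m l) :=
  PiTensorProduct.map_tprod _ _

theorem map_consL {M N : Type*} [AddCommMonoid M] [Module k M] [AddCommMonoid N] [Module k N]
    (f : M →ₗ[k] N) (n : ℕ) (a : M) (t : ⨂[k]^n M) :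
    PiTensorProduct.map (fun _ : Fin (n + 1) => f) (consL n a t) =
      consL n (f a) (PiTensorProduct.map (fun _ : Fin n => f) t) := by
  induction t using pure_induction with
  | hadd t t' ht ht' => simp only [map_add, ht, ht']
  | hsmul c t ht => simp only [map_smul, ht]
  | h m =>
    rw [map_pure, consL_pure, consL_pure, map_pure]
    exact pure_congr fun l _ => by cases l <;> rfl

theorem flipAll_zero (m : ℕ → Double k B) (m' : ℕ → X k B) (m'' : ℕ → B) :
    flipAll k B 0 (pure k 0 m) = pure k 0 m' ⊗ₜ pure k 0 m'' := by
  rw [pure_zero, pure_zero, pure_zero]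
  simp [flipAll]

variable (k B) in
/-- The element `ε ⊗ ⋯ ⊗ ε` of `Xⁿ`. -/
def oneXPow (n : ℕ) : ⨂[k]^n (X k B) := pure k n fun _ => oneX k B

variable (k B) in
/-- The element `1 ⊗ ⋯ ⊗ 1` of `Bⁿ`. -/
def onePow (n : ℕ) : ⨂[k]^n B := pure k n fun _ => 1

theorem oneXPow_succ (n : ℕ) : oneXPow k B (n + 1) = consL n (oneX k B) (oneXPow k B n) :=
  pure_succ n _

theorem onePow_succ (n : ℕ) : onePow k B (n + 1) = consL n 1 (onePow k B n) := pure_succ n _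

theorem diagL_oneXPow (n : ℕ) (a : B) :
    diagL k B n a (oneXPow k B n) = Coalgebra.counit (R := k) a • oneXPow k B n := by
  induction n generalizing a with
  | zero => rw [diagL, diagAct_zero]
  | succ n ih =>
    rw [oneXPow_succ, diagL_consL]
    simp only [ih, actL_oneX, map_smul, LinearMap.smul_apply]
    exact sw_counit_right (f := fun u : B => Coalgebra.counit (R := k) u •
      consL n (oneX k B) (oneXPow k B n)) ⟨by simp [add_smul], by simp [mul_smul]⟩ a

theorem diagR_oneXPow (n : ℕ) (a : B) :
    diagR k B n a (oneXPow k B n) = Coalgebra.counit (R := k) a • oneXPow k B n := by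
  induction n generalizing a with
  | zero => rw [diagR, diagAct_zero]
  | succ n ih =>
    rw [oneXPow_succ, diagR_consL]
    simp only [ih, actR_oneX, map_smul, LinearMap.smul_apply]
    exact sw_counit_right (f := fun u : B => Coalgebra.counit (R := k) u •
      consL n (oneX k B) (oneXPow k B n)) ⟨by simp [add_smul], by simp [mul_smul]⟩ a

theorem hatAct_oneXPow (n m : ℕ) (t : ⨂[k]^m B) :
    hatAct (diagL k B n) m (oneXPow k B n ⊗ₜ t) = oneXPow k B n ⊗ₜ t := by
  induction m with
  | zero => exact hatAct_zero _ (diagL_one n) _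
  | succ m ih =>
    induction t using consL_induction with
    | hadd t t' ht ht' => rw [TensorProduct.tmul_add, map_add, ht, ht']
    | hsmul c t ht => rw [TensorProduct.tmul_smul, map_smul, ht]
    | h a t =>
      rw [hatAct_consL_of_mul (diagL_mul n)]
      simp only [ih, TensorProduct.map_tmul, diagL_oneXPow, ← TensorProduct.smul_tmul']
      exact sw_counit_left (f := fun v : B => oneXPow k B n ⊗ₜ[k] consL m v t)
        ⟨by simp [TensorProduct.tmul_add], by simp⟩ a

theorem hatAct_onePow (n m : ℕ) (s : ⨂[k]^n (X k B)) :
    hatAct (diagL k B n) m (s ⊗ₜ onePow k B m) = s ⊗ₜ onePow k B m := by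
  induction m with
  | zero => exact hatAct_zero _ (diagL_one n) _
  | succ m ih =>
    rw [onePow_succ, hatAct_consL_of_mul (diagL_mul n)]
    simp only [ih, TensorProduct.map_tmul]
    rw [sw_one ⟨fun _ => ⟨by simp [TensorProduct.add_tmul], by simp [← TensorProduct.smul_tmul']⟩,
      fun _ => ⟨by simp [TensorProduct.tmul_add], by simp⟩⟩, diagL_one]

variable [FiniteDimensional k B]

theorem counit_antipodeInv (a : B) :
    Coalgebra.counit (R := k) (antipodeInv k B a) = Coalgebra.counit (R := k) a := by
  rw [← HopfAlgebra.counit_antipode (R := k) (antipodeInv k B a), antipode_antipodeInv]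

/-- `B` acts on the unit of `X` by the counit from either side, so moving it past elements of `B`
changes nothing. -/
theorem flipAll_map_inclB (n : ℕ) (t : ⨂[k]^n B) :
    flipAll k B n (PiTensorProduct.map (fun _ : Fin n => inclB k B) t) = oneXPow k B n ⊗ₜ t := by
  induction n with
  | zero =>
    induction t using pure_induction with
    | h m =>
      rw [map_pure]
      exact flipAll_zero _ _ _
    | hadd t t' ht ht' => simp only [map_add, TensorProduct.tmul_add, ht, ht']
    | hsmul c t ht => simp only [map_smul, TensorProduct.tmul_smul, ht]
  | succ n ih =>
    induction t using consL_induction with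
    | hadd t t' ht ht' => simp only [map_add, TensorProduct.tmul_add, ht, ht']
    | hsmul c t ht => simp only [map_smul, TensorProduct.tmul_smul, ht]
    | h a t =>
      rw [map_consL, inclB, TensorProduct.mk_apply, flipAll_consL, ← inclB, ih]
      simp only [TensorProduct.map_tmul, LinearMap.comp_apply, diagR_oneXPow, diagL_oneXPow,
        counit_antipodeInv, map_smul, ← TensorProduct.smul_tmul', sw_smul_fun]
      rw [sw_counit_right (f := fun p : B => sw k (fun u v : B => Coalgebra.counit (R := k) u •
          consL n (oneX k B) (oneXPow k B n) ⊗ₜ[k] consL n v t) p)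
        (sw_isLin ⟨fun _ => ⟨by simp [add_smul], by simp [mul_smul]⟩,
          fun _ => ⟨by simp [TensorProduct.tmul_add],
            fun _ _ => by simp only [map_smul, LinearMap.smul_apply, TensorProduct.tmul_smul]; exact smul_comm _ _ _⟩⟩)]
      rw [sw_counit_left (f := fun v : B => consL n (oneX k B) (oneXPow k B n) ⊗ₜ[k] consL n v t)
        ⟨by simp [TensorProduct.tmul_add], by simp⟩, oneXPow_succ]

/-- The element `1` is grouplike and acts trivially, so the flips past it are plain transpositions.
-/
theorem flipAll_map_inclX (n : ℕ) (s : ⨂[k]^n (X k B)) :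
    flipAll k B n (PiTensorProduct.map (fun _ : Fin n => inclX k B) s) = s ⊗ₜ onePow k B n := by
  induction n with
  | zero =>
    induction s using pure_induction with
    | h m =>
      rw [map_pure]
      exact flipAll_zero _ _ _
    | hadd t t' ht ht' => simp only [map_add, TensorProduct.add_tmul, ht, ht']
    | hsmul c t ht => simp only [map_smul, ← TensorProduct.smul_tmul', ht]
  | succ n ih =>
    induction s using consL_induction with
    | hadd t t' ht ht' => simp only [map_add, TensorProduct.add_tmul, ht, ht']
    | hsmul c t ht => simp only [map_smul, ← TensorProduct.smul_tmul', ht]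
    | h x s =>
      have hb : ∀ c, IsBilin k fun u v : B =>
          consL n x (diagL k B n u (diagR k B n (antipodeInv k B c) s)) ⊗ₜ[k]
            consL n v (onePow k B n) := fun c =>
        ⟨fun _ => ⟨by simp [TensorProduct.add_tmul], by simp [← TensorProduct.smul_tmul']⟩,
          fun _ => ⟨by simp [TensorProduct.tmul_add], by simp⟩⟩
      rw [map_consL, inclX, LinearMap.flip_apply, TensorProduct.mk_apply, flipAll_consL, ← inclX, ih]
      simp only [TensorProduct.map_tmul, LinearMap.comp_apply]
      rw [sw_one ⟨fun c => sw_isLin (hb c), fun p =>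
        isLin_sw (fun u v => ⟨by simp [TensorProduct.add_tmul], by simp [← TensorProduct.smul_tmul']⟩) p⟩,
        sw_one (hb 1), antipodeInv_one, diagR_one, diagL_one, onePow_succ]

/-- `φ` is a left inverse of the twist `𝐱 ⊗ 𝐚 ↦ ^{â₁}𝐱 ⊗ 𝐚₂`, so it fixes whatever the twist fixes.
-/
theorem phi_of_hatAct {n : ℕ} {y : XB k B n n} (h : hatAct (diagL k B n) n y = y) :
    phi k B n y = y := by
  rw [phi_eq]
  conv_lhs => rw [← h]
  exact hatAct_antipodeInv_hatAct (diagL_mul n) (diagL_one n) n y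

theorem degenX_apply (p q : ℕ) (f : Module.Dual k (XB k B p q)) (t : ⨂[k]^q B) :
    (inclEdgeB k B q).dualMap ((bicomplex k B).degenX q p f) t = f (oneXPow k B p ⊗ₜ t) := by
  induction p with
  | zero => exact congrArg f ((inclEdgeB_apply q t).trans (by rw [oneXPow, pure_zero, pure_zero]))
  | succ p ih =>
    refine (ih ((degX k B p q 0).dualMap f)).trans ?_
    rw [LinearMap.dualMap_apply, degX, LinearMap.rTensor_tmul, ins_zero, oneXPow_succ]

theorem degenB_apply (p q : ℕ) (f : Module.Dual k (XB k B p q)) (s : ⨂[k]^p (X k B)) :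
    (inclEdgeX k B p).dualMap ((bicomplex k B).degenB p q f) s = f (s ⊗ₜ onePow k B q) := by
  induction q with
  | zero => exact congrArg f ((inclEdgeX_apply p s).trans (by rw [onePow, pure_zero, pure_zero]))
  | succ q ih =>
    refine (ih ((degB k B p q 0).dualMap f)).trans ?_
    rw [LinearMap.dualMap_apply, degB, LinearMap.lTensor_tmul, ins_zero, onePow_succ]

/-- Both sides evaluate `f` on `ε ⊗ ⋯ ⊗ ε ⊗ 𝐛`: the left one because `φ c̃` sends `1 ⋈ 𝐛` there, the
right one because codegeneracies insert units. -/
theorem resB_psiDual (n : ℕ) (f : Module.Dual k (XB k B n n)) :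
    resB k B n (psiDual k B n f) = (inclEdgeB k B n).dualMap ((bicomplex k B).degenX n n f) := by
  refine LinearMap.ext fun t => ?_
  rw [degenX_apply]
  change f (phi k B n (flipAll k B n (PiTensorProduct.map (fun _ => inclB k B) t))) = _
  rw [flipAll_map_inclB, phi_of_hatAct (hatAct_oneXPow n n t)]

theorem resX_psiDual (n : ℕ) (f : Module.Dual k (XB k B n n)) :
    resX k B n (psiDual k B n f) = (inclEdgeX k B n).dualMap ((bicomplex k B).degenB n n f) := by
  refine LinearMap.ext fun s => ?_
  rw [degenB_apply]
  change f (phi k B n (flipAll k B n (PiTensorProduct.map (fun _ => inclX k B) s))) = _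
  rw [flipAll_map_inclX, phi_of_hatAct (hatAct_onePow n n s)]

/-- Every cochain of `D(B)` comes from the diagonal, where restriction is a codegeneracy. The latter
turns each diagonal coface into the corresponding `B`-coface of the edge. -/
theorem resB_dDouble (n : ℕ) (g : Module.Dual k (⨂[k]^n (Double k B))) :
    resB k B (n + 1) (dDouble k B n g) = dB k B n (resB k B n g) := by
  obtain ⟨f, rfl⟩ := (psiDual_bijective n).2 g
  rw [← psiDual_diagD, resB_psiDual, resB_psiDual, ← bB_inclEdgeB, diagD_eq]
  refine congrArg _ (((bicomplex k B).toConstX.app_bD n f).trans ?_)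
  rw [BiCosimplicial.bD_apply, BiCosimplicial.bB_apply]
  rfl

theorem resX_dDouble (n : ℕ) (g : Module.Dual k (⨂[k]^n (Double k B))) :
    resX k B (n + 1) (dDouble k B n g) = dX k B n (resX k B n g) := by
  obtain ⟨f, rfl⟩ := (psiDual_bijective n).2 g
  rw [← psiDual_diagD, resX_psiDual, resX_psiDual, ← bX_inclEdgeX, diagD_eq]
  refine congrArg _ (((bicomplex k B).toConstB.app_bD n f).trans ?_)
  rw [BiCosimplicial.bD_apply, BiCosimplicial.bX_apply]
  rfl

theorem famOf_isTotCocycle {n : ℕ} {z : Tot k B n} (hz : z ∈ cocycles (totD k B) n) :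
    (bicomplex k B).IsTotCocycle n (famOf z) := fun p q h => by
  rw [← totProj_totD n p q h, hz, map_zero]

/-- The cochain-level form of the assertion about `B`: going through the edge and going through
`D(B)` differ by the coboundary supplied by `exists_bB_eq`. -/
theorem edgeB_sub_resB {n : ℕ} {z : Tot k B (n + 1)} (hz : z ∈ cocycles (totD k B) (n + 1)) :
    edgeB k B (n + 1) (totPi k B (n + 1) z) -
      resB k B (n + 1) (psiDual k B (n + 1) (alexanderWhitney k B (n + 1) z)) ∈
      coboundaries (dB k B) (n + 1) := by
  obtain ⟨y, hy⟩ := BiCosimplicial.exists_bB_eq (famOf_isTotCocycle hz)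
  refine ⟨(inclEdgeB k B n).dualMap y, ?_⟩
  rw [← bB_inclEdgeB, hy, map_sub, edgeB_totPi, resB_psiDual, alexanderWhitney_eq]

theorem edgeX_sub_resX {n : ℕ} {z : Tot k B (n + 1)} (hz : z ∈ cocycles (totD k B) (n + 1)) :
    edgeX k B (n + 1) (totPi k B (n + 1) z) -
      resX k B (n + 1) (psiDual k B (n + 1) (alexanderWhitney k B (n + 1) z)) ∈
      coboundaries (dX k B) (n + 1) := by
  obtain ⟨y, hy⟩ := BiCosimplicial.exists_bX_eq (famOf_isTotCocycle hz)
  refine ⟨(inclEdgeX k B n).dualMap y, ?_⟩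
  rw [← bX_inclEdgeX, hy, map_sub, edgeX_totPi, resX_psiDual, alexanderWhitney_eq]

theorem exists_isPiBar (n : ℕ) : ∃ πbar, IsPiBar k B (n + 1) πbar := by
  obtain ⟨Ψ, hΨ⟩ := exists_equiv_psiDual (k := k) (B := B) (n + 1)
  obtain ⟨Φ, hΦ⟩ := exists_equiv_alexanderWhitney (k := k) (B := B) (n + 1)
  obtain ⟨Hπ, hπ⟩ := exists_isInducedBy_of_comm (totPi_totD (k := k) (B := B)) (n + 1)
  obtain ⟨E, hE⟩ := exists_equiv_edge (k := k) (B := B) n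
  exact ⟨_, Ψ, Φ, Hπ, E, hΨ, hΦ, hπ, hE.1, hE.2, rfl⟩

/-- The map `πbar` is restriction in each component. -/
theorem IsPiBar.exists_restriction {n : ℕ}
    {πbar : Cohomology (dDouble k B) (n + 1) →ₗ[k]
      Cohomology (dB k B) (n + 1) × Cohomology (dX k B) (n + 1)} (h : IsPiBar k B (n + 1) πbar) :
    ∃ (rB : Cohomology (dDouble k B) (n + 1) →ₗ[k] Cohomology (dB k B) (n + 1))
      (rX : Cohomology (dDouble k B) (n + 1) →ₗ[k] Cohomology (dX k B) (n + 1)),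
      IsInducedBy (dDouble k B) (dB k B) (n + 1) (resB k B (n + 1)) rB ∧
      IsInducedBy (dDouble k B) (dX k B) (n + 1) (resX k B (n + 1)) rX ∧ πbar = rB.prod rX := by
  obtain ⟨Ψ, Φ, Hπ, E, hΨ, hΦ, hπ, hEB, hEX, rfl⟩ := h
  obtain ⟨rB, hrB⟩ := exists_isInducedBy_of_comm (resB_dDouble (k := k) (B := B)) (n + 1)
  obtain ⟨rX, hrX⟩ := exists_isInducedBy_of_comm (resX_dDouble (k := k) (B := B)) (n + 1)
  refine ⟨rB, rX, hrB, hrX, LinearMap.ext fun c => Prod.ext ?_ ?_⟩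
  · exact IsInducedBy.zigzag_apply hΦ hΨ hπ hEB hrB (fun z hz => edgeB_sub_resB hz) c
  · exact IsInducedBy.zigzag_apply hΦ hΨ hπ hEX hrX (fun z hz => edgeX_sub_resX hz) c

end Restriction
end
end BialgebraCohomology

/-! ### The theorem. -/

theorem mainTheorem3 {k : Type*} [Field k] {B : Type*} [Ring B] [HopfAlgebra k B]
    [FiniteDimensional k B] (i : ℕ) (hi : 1 ≤ i) :
    (∃ πbar, BialgebraCohomology.IsPiBar k B i πbar) ∧
    ∀ πbar, BialgebraCohomology.IsPiBar k B i πbar →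
      ∃ (rB : BialgebraCohomology.Cohomology (BialgebraCohomology.dDouble k B) i →ₗ[k]
            BialgebraCohomology.Cohomology (BialgebraCohomology.dB k B) i)
        (rX : BialgebraCohomology.Cohomology (BialgebraCohomology.dDouble k B) i →ₗ[k]
            BialgebraCohomology.Cohomology (BialgebraCohomology.dX k B) i),
        BialgebraCohomology.IsInducedBy (BialgebraCohomology.dDouble k B)
          (BialgebraCohomology.dB k B) i (BialgebraCohomology.resB k B i) rB ∧
        BialgebraCohomology.IsInducedBy (BialgebraCohomology.dDouble k B)
          (BialgebraCohomology.dX k B) i (BialgebraCohomology.resX k B i) rX ∧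
        πbar = rB.prod rX := by
  -- Writing `i = n + 1` is where positivity of the degree enters; the edge isomorphism is available
  -- only there.
  obtain ⟨n, rfl⟩ := Nat.exists_eq_add_of_le' hi
  exact ⟨BialgebraCohomology.exists_isPiBar n, fun _ h => h.exists_restriction⟩
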